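/- Let $B$ be a $C^*$-algebra. A *partial automorphism* of $B$ is a $*$-isomorphism $\theta\colon \mathrm{Dom}(\theta)\to\mathrm{Img}(\theta)$ between closed two-sided ideals of $B$; write $\mathrm{PAut}(B)$ for the set of all of them, $\theta\theta'$ for the composition ($\theta'$ first, defined wherever it makes sense), $\theta^*=\theta^{-1}$, $\theta\le\theta'$ if $\theta'$ extends $\theta$, and $\theta\wedge\theta'$ for the largest partial automorphism extended by both $\theta$ and $\theta'$. A *right $C^*$-$B$-$B$-bimodule* is a full Hilbert $C^*$-module $E$ over $B$ (inner product linear in the second variable) with a nondegenerate $*$-representation of $B$ by adjointable operators. These bimodules, with the adjointable operators commuting with the left action of $B$ as morphisms, form a category $B\textbf{-bimod}$; it is monoidal with the internal tensor product $E\otimes F$ (where $\langle \xi\otimes\eta|\xi'\otimes\eta'\rangle=\langle\eta|\langle\xi|\xi'\rangle\eta'\rangle$), the unit $B$, the associativity isomorphisms $(\xi\otimes\eta)\otimes\zeta\mapsto\xi\otimes(\eta\otimes\zeta)$ and the unit isomorphisms $b\otimes\xi\mapsto b\xi$, $\xi\otimes b\mapsto\xi b$. For $\theta\in\mathrm{PAut}(B)$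 let $E_\theta$ be the set of all $\xi\in E\,\mathrm{Dom}(\theta)$ with $\xi b=\theta(b)\xi$ for all $b\in\mathrm{Dom}(\theta)$. For an inverse semigroup $\Theta\subseteq\mathrm{PAut}(B)$, call $E$ *$\Theta$-decomposable* if $\bigcup_{\theta\in\Theta}E_\theta$ is linearly dense in $E$ (*decomposable* if this holds with $\Theta=\mathrm{PAut}(B)$), and *$\Theta$-supported* if for every $\theta\in\mathrm{PAut}(B)$ the space $E_\theta$ is the closed linear span of all $E_{\theta'}$ with $\theta'\in\Theta$, $\theta'\le\theta$. The inverse semigroup $\Theta$ is *admissible* if $B$ is $\Theta$-supported, $\mathrm{Id}_B\in\Theta$, and $\theta\wedge\theta'\in\Theta$ for all $\theta,\theta'\in\Theta$. Consider families $\mathcal C=(\mathcal C^\rho_\sigma)_{\rho,\sigma\in\mathrm{PAut}(B)}$ of sets of bounded operators between bimodules. An operator $S\colon F\to E$ is the adjoint of $T\colon E\to F$ with respect to $\sigma$ if $\langle S\eta|\xi\rangle\in\mathrm{Dom}(\sigma)$ and $\langle\eta|T\xi\rangle=\sigma(\langle S\eta|\xi\rangle)$ for all $\xi\in E$, $\eta\in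 F$. Let $(\mathcal C^*)^\rho_\sigma$ consist of the adjoints, with respect to $\sigma^*$, of the elements of $\mathcal C^{\rho^*}_{\sigma^*}$, and let $[\mathcal D\mathcal C]^{\rho''}_{\sigma''}$ be the closed linear span of all $T'T$ with $T'\in\mathcal D^{\rho'}_{\sigma'}$, $T\in\mathcal C^\rho_\sigma$, $\rho'\rho\le\rho''$, $\sigma'\sigma\le\sigma''$. For $\xi\in E$, $\eta\in F$ put $l(\xi)\colon B\to E$, $b\mapsto\xi b$; $r(\xi)\colon B\to E$, $b\mapsto b\xi$; $|\xi\rangle_1\colon F\to E\otimes F$, $\eta'\mapsto\xi\otimes\eta'$; $|\eta]_2\colon E\to E\otimes F$, $\xi'\mapsto\xi'\otimes\eta$. Let $l(E)$, $r(E)$, $|E\rangle_1$, $|F]_2$ be the families with components $$l(E)^\theta_{\mathrm{Id}}=l(E_\theta),\quad r(E)^{\mathrm{Id}}_\theta=r(E_{\theta^*}),\quad (|E\rangle_1)^\theta_{\mathrm{Id}}=|E_\theta\rangle_1,\quad (|F]_2)^{\mathrm{Id}}_\theta=|F_{\theta^*}]_2\qquad(\theta\in\mathrm{PAut}(B)),$$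 and with component $0$ at all indices $(\rho,\sigma)$ not of the displayed form. For admissible $\Theta$, call $E$ *$\Theta$-admissible* if it is $\Theta$-decomposable, $[l(E)^*l(E)]=l(B)$ and $[r(E)^*r(E)]=r(B)$. **Theorem.** Let $\Theta\subseteq\mathrm{PAut}(B)$ be an admissible inverse semigroup. 1. If $E$ and $F$ are $\Theta$-admissible right $C^*$-$B$-$B$-bimodules, then $E\otimes F$ is $\Theta$-admissible. For every $\theta''\in\mathrm{PAut}(B)$, the space $(E\otimes F)_{\theta''}$ is the closed linear span of all $\xi\otimes\eta$ with $\xi\in E_\theta$, $\eta\in F_{\theta'}$, where $\theta,\theta'\in\Theta$ and $\theta\theta'\le\theta''$. Moreover, $$l(E\otimes F)=[|E\rangle_1\, l(F)],\qquad r(E\otimes F)=[|F]_2\, r(E)].$$ 2. If $B$ is decomposable (as a bimodule over itself), then the $\Theta$-admissible bimodules form a monoidal full subcategory of $B\textbf{-bimod}$: it contains the unit $B$ and is closed under the internal tensor product. -/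

import Mathlib

open CategoryTheory MonoidalCategory
open scoped TensorProduct ComplexConjugate

universe u

section Defs

variable {B : Type u} [NonUnitalCStarAlgebra B] [PartialOrder B] [StarOrderedRing B]

/-! ### Semi-inner-product modules and their completions -/

/-- A complex vector space `X` with a right action of the C⋆-algebra `B` (`rmul b x` is `x b`) and
a `B`-valued positive semi-definite form `inner x y = ⟨x|y⟩`, conjugate-linear in the first
variable and linear in the second one. (Mathlib's `CStarModule` is the version for left actions.) -/
structure PreHilbertModule (B : Type u) [NonUnitalCStarAlgebra B] [PartialOrder B]
    [StarOrderedRing B] (X : Type u) [AddCommGroup X] [Module ℂ X] where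
  inner : X →ₗ⋆[ℂ] X →ₗ[ℂ] B
  rmul : B →ₗ[ℂ] X →ₗ[ℂ] X
  star_inner : ∀ x y, star (inner x y) = inner y x
  inner_self_nonneg : ∀ x, 0 ≤ inner x x
  inner_rmul : ∀ x y b, inner x (rmul b y) = inner x y * b
  rmul_mul : ∀ a b x, rmul (a * b) x = rmul b (rmul a x)

namespace PreHilbertModule

variable {X : Type u} [AddCommGroup X] [Module ℂ X] (d : PreHilbertModule B X)

theorem rmul_inner (x y : X) (b : B) : d.inner (d.rmul b x) y = star b * d.inner x y := by
  rw [← d.star_inner, d.inner_rmul, star_mul, d.star_inner]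

theorem inner_mul_le (x y : X) {t : ℝ} (ht : ‖d.inner x x‖ < t) :
    star (d.inner x y) * d.inner x y ≤ t • d.inner y y := by
  have ht0 : 0 < t := (norm_nonneg _).trans_lt ht
  set a := d.inner x y with ha
  have h1 : 0 ≤ star a * d.inner x x * a - t • (star a * a) - t • (star a * a)
      + t • (t • d.inner y y) := by
    have := d.inner_self_nonneg (d.rmul a x - (t : ℂ) • y)
    have hyx : d.inner y x = star a := by rw [ha, d.star_inner]
    simp only [map_sub, LinearMap.sub_apply, d.inner_rmul, d.rmul_inner, map_smul,
      map_smulₛₗ, LinearMap.smul_apply, hyx, ← ha, Complex.conj_ofReal] at this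
    convert this using 1
    simp only [Complex.coe_smul, smul_sub]
    abel
  have h2 : star a * d.inner x x * a ≤ t • (star a * a) := by
    refine (CStarAlgebra.star_left_conjugate_le_norm_smul
      (hb := (d.star_inner x x))).trans ?_
    exact smul_le_smul_of_nonneg_right ht.le (star_mul_self_nonneg a)
  have h3 : t • (star a * a) ≤ t • (t • d.inner y y) := by
    have h4 : 0 ≤ - (t • (star a * a)) + t • (t • d.inner y y) := by
      refine h1.trans ?_
      have : star a * d.inner x x * a - t • (star a * a) ≤ 0 := sub_nonpos.mpr h2
      calc _ ≤ 0 - t • (star a * a) + t • (t • d.inner y y) := by gcongr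
        _ = _ := by simp
    rwa [neg_add_eq_sub, sub_nonneg] at h4
  rwa [smul_le_smul_iff_of_pos_left ht0] at h3

theorem norm_inner_sq_le (x y : X) :
    ‖d.inner x y‖ ^ 2 ≤ ‖d.inner x x‖ * ‖d.inner y y‖ := by
  have key : ∀ t, ‖d.inner x x‖ < t → ‖d.inner x y‖ ^ 2 ≤ t * ‖d.inner y y‖ := by
    intro t ht
    have h := CStarAlgebra.norm_le_norm_of_nonneg_of_le (star_mul_self_nonneg _)
      (d.inner_mul_le x y ht)
    rw [CStarRing.norm_star_mul_self, norm_smul, ← sq, Real.norm_of_nonneg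
      ((norm_nonneg _).trans ht.le)] at h
    exact h
  refine ge_of_tendsto (f := fun t : ℝ => t * ‖d.inner y y‖)
    (x := nhdsWithin ‖d.inner x x‖ (Set.Ioi ‖d.inner x x‖)) ?_
    (Filter.eventually_of_mem self_mem_nhdsWithin key)
  exact (Filter.tendsto_id.mul_const _).mono_left nhdsWithin_le_nhds

theorem norm_inner_le (x y : X) :
    ‖d.inner x y‖ ≤ √‖d.inner x x‖ * √‖d.inner y y‖ := by
  rw [← Real.sqrt_mul (norm_nonneg _)]
  exact Real.le_sqrt_of_sq_le (d.norm_inner_sq_le x y)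

theorem sqrt_add_le (x y : X) :
    √‖d.inner (x + y) (x + y)‖ ≤ √‖d.inner x x‖ + √‖d.inner y y‖ := by
  rw [Real.sqrt_le_left (by positivity)]
  have h1 := d.norm_inner_le x y
  have h2 := d.norm_inner_le y x
  have h3 := Real.sq_sqrt (norm_nonneg (d.inner x x))
  have h4 := Real.sq_sqrt (norm_nonneg (d.inner y y))
  simp only [map_add, LinearMap.add_apply]
  calc _ ≤ ‖d.inner x x‖ + ‖d.inner y x‖ + (‖d.inner x y‖ + ‖d.inner y y‖) :=
        (norm_add_le _ _).trans (add_le_add (norm_add_le _ _) (norm_add_le _ _))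
    _ ≤ _ := by nlinarith

/-- A copy of `X` that carries the seminorm `‖x‖ = ‖⟨x|x⟩‖^(1/2)`. -/
def Space (_ : PreHilbertModule B X) : Type u := X

instance : AddCommGroup d.Space := inferInstanceAs (AddCommGroup X)

instance : Module ℂ d.Space := inferInstanceAs (Module ℂ X)

noncomputable instance : Norm d.Space := ⟨fun x => √‖d.inner x x‖⟩

theorem seminormCore : SeminormedSpace.Core ℂ d.Space where
  norm_nonneg x := Real.sqrt_nonneg _
  norm_smul c (x : X) := by
    change √‖d.inner (c • x) (c • x)‖ = _ * √‖d.inner x x‖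
    rw [map_smul, map_smulₛₗ, LinearMap.smul_apply, norm_smul, norm_smul, ← mul_assoc,
      Real.sqrt_mul (by positivity), RCLike.norm_conj, Real.sqrt_mul_self (norm_nonneg _)]
  norm_triangle x y := d.sqrt_add_le x y

noncomputable instance : SeminormedAddCommGroup d.Space :=
  SeminormedAddCommGroup.ofCore (𝕜 := ℂ) (E := d.Space) d.seminormCore

noncomputable instance : NormedSpace ℂ d.Space where
  norm_smul_le c x := (d.seminormCore.norm_smul c x).le

/-- The separated completion of `X` for the seminorm `‖x‖ = ‖⟨x|x⟩‖^(1/2)`: null vectors are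
factored out and the quotient is completed. -/
abbrev Completion : Type u := UniformSpace.Completion d.Space

/-- The canonical map of `X` into its completion. -/
noncomputable def toCompletion : X →ₗ[ℂ] d.Completion :=
  (UniformSpace.Completion.toComplₗᵢ (𝕜 := ℂ) (E := d.Space)).toLinearMap

theorem denseRange_toCompletion : DenseRange d.toCompletion :=
  UniformSpace.Completion.denseRange_coe (α := d.Space)

theorem norm_toCompletion (x : X) : ‖d.toCompletion x‖ = √‖d.inner x x‖ :=
  UniformSpace.Completion.norm_coe (E := d.Space) x

theorem norm_toCompletion_sq (x : X) : ‖d.toCompletion x‖ ^ 2 = ‖d.inner x x‖ := by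
  rw [norm_toCompletion, Real.sq_sqrt (norm_nonneg _)]

theorem norm_inner_le' (x y : X) :
    ‖d.inner x y‖ ≤ ‖d.toCompletion x‖ * ‖d.toCompletion y‖ := by
  rw [norm_toCompletion, norm_toCompletion]; exact d.norm_inner_le x y

/-- The form `⟨x| · ⟩`, for `x` in `X`, extended to the completion. -/
noncomputable def innerRight : X →ₗ⋆[ℂ] (d.Completion →L[ℂ] B) where
  toFun x := (d.inner x).extendOfNorm d.toCompletion
  map_add' x y := by
    refine LinearMap.extendOfNorm_unique d.denseRange_toCompletion
      (‖d.toCompletion (x + y)‖) (d.norm_inner_le' _) _ ?_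
    ext z
    simp [LinearMap.extendOfNorm_eq d.denseRange_toCompletion ⟨_, d.norm_inner_le' _⟩]
  map_smul' c x := by
    refine LinearMap.extendOfNorm_unique d.denseRange_toCompletion
      (‖d.toCompletion (c • x)‖) (d.norm_inner_le' _) _ ?_
    ext z
    simp [LinearMap.extendOfNorm_eq d.denseRange_toCompletion ⟨_, d.norm_inner_le' _⟩]

theorem innerRight_apply (x y : X) : d.innerRight x (d.toCompletion y) = d.inner x y :=
  LinearMap.extendOfNorm_eq d.denseRange_toCompletion ⟨_, d.norm_inner_le' _⟩ y

theorem norm_innerRight_le (x : X) : ‖d.innerRight x‖ ≤ 1 * ‖d.toCompletion x‖ := by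
  rw [one_mul]
  exact LinearMap.opNorm_extendOfNorm_le d.denseRange_toCompletion (norm_nonneg _)
    (d.norm_inner_le' x)

/-- The form `⟨ · | · ⟩` extended to the completion. -/
noncomputable def innerL : d.Completion →L⋆[ℂ] (d.Completion →L[ℂ] B) :=
  d.innerRight.extendOfNorm d.toCompletion

theorem innerL_apply (x y : X) :
    d.innerL (d.toCompletion x) (d.toCompletion y) = d.inner x y := by
  rw [innerL, LinearMap.extendOfNorm_eq d.denseRange_toCompletion ⟨1, d.norm_innerRight_le⟩,
    innerRight_apply]

theorem norm_rmul_le (b : B) (x : X) :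
    ‖d.toCompletion (d.rmul b x)‖ ≤ ‖b‖ * ‖d.toCompletion x‖ := by
  refine le_of_sq_le_sq ?_ (by positivity)
  rw [norm_toCompletion_sq, mul_pow, norm_toCompletion_sq, d.inner_rmul, d.rmul_inner]
  refine (norm_mul_le _ _).trans ?_
  have := norm_mul_le (star b) (d.inner x x)
  rw [norm_star] at this
  nlinarith [norm_nonneg b]

/-- A linear map on `X` that is bounded for the seminorm, extended to the completion. -/
noncomputable def extendMap (f : X →ₗ[ℂ] X) : d.Completion →L[ℂ] d.Completion :=
  (d.toCompletion ∘ₗ f).extendOfNorm d.toCompletion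

theorem extendMap_apply {f : X →ₗ[ℂ] X}
    (hf : ∃ C, ∀ x, ‖d.toCompletion (f x)‖ ≤ C * ‖d.toCompletion x‖) (x : X) :
    d.extendMap f (d.toCompletion x) = d.toCompletion (f x) :=
  LinearMap.extendOfNorm_eq (f := d.toCompletion ∘ₗ f) d.denseRange_toCompletion hf x

theorem rmul_extend_apply (b : B) (x : X) :
    d.extendMap (d.rmul b) (d.toCompletion x) = d.toCompletion (d.rmul b x) :=
  d.extendMap_apply ⟨‖b‖, d.norm_rmul_le b⟩ x

theorem completion_ext {V : Type*} [NormedAddCommGroup V] [NormedSpace ℂ V]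
    {f g : d.Completion →L[ℂ] V} (h : ∀ x, f (d.toCompletion x) = g (d.toCompletion x)) :
    f = g :=
  ContinuousLinearMap.ext fun x =>
    congrFun (d.denseRange_toCompletion.equalizer f.continuous g.continuous (funext h)) x

theorem continuous_innerL : Continuous fun p : d.Completion × d.Completion => d.innerL p.1 p.2 :=
  (d.innerL.continuous.comp continuous_fst).clm_apply continuous_snd

/-- The right action extended to the completion. -/
noncomputable def rmulL : B →ₗ[ℂ] (d.Completion →L[ℂ] d.Completion) where
  toFun b := d.extendMap (d.rmul b)
  map_add' a b := d.completion_ext fun x => by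
    rw [_root_.add_apply, rmul_extend_apply, rmul_extend_apply, rmul_extend_apply,
      ← map_add, map_add, LinearMap.add_apply]
  map_smul' c b := d.completion_ext fun x => by
    rw [_root_.smul_apply, rmul_extend_apply, rmul_extend_apply]
    simp only [map_smul, LinearMap.smul_apply, RingHom.id_apply]

theorem rmulL_apply (b : B) (x : X) :
    d.rmulL b (d.toCompletion x) = d.toCompletion (d.rmul b x) :=
  d.rmul_extend_apply b x

/-- The completion as a Hilbert module. -/
noncomputable def completion : PreHilbertModule B d.Completion where
  inner := LinearMap.mk₂'ₛₗ _ _ (fun x y => d.innerL x y)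
    (fun x y z => by rw [map_add]; rfl) (fun c x y => by rw [map_smulₛₗ]; rfl)
    (fun x => map_add (d.innerL x)) (fun c x => map_smul (d.innerL x) c)
  rmul := LinearMap.mk₂ ℂ (fun b x => d.rmulL b x)
    (fun a b x => by rw [map_add]; rfl) (fun c b x => by rw [map_smul]; rfl)
    (fun b => map_add (d.rmulL b)) (fun c b => map_smul (d.rmulL b) c)
  star_inner x y := by
    refine d.denseRange_toCompletion.induction_on₂
      (p := fun x y => star (d.innerL x y) = d.innerL y x)
      (isClosed_eq d.continuous_innerL.star (d.continuous_innerL.comp continuous_swap))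
      (fun x y => ?_) x y
    simp only [innerL_apply, d.star_inner]
  inner_self_nonneg x := by
    refine d.denseRange_toCompletion.induction_on (p := fun x => 0 ≤ d.innerL x x) x
      (isClosed_le continuous_const
        (d.continuous_innerL.comp (continuous_id.prodMk continuous_id))) fun x => ?_
    simp only [innerL_apply, d.inner_self_nonneg]
  inner_rmul x y b := by
    refine d.denseRange_toCompletion.induction_on₂
      (p := fun x y => d.innerL x (d.rmulL b y) = d.innerL x y * b)
      (isClosed_eq (d.continuous_innerL.comp
        (continuous_fst.prodMk ((d.rmulL b).continuous.comp continuous_snd)))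
        (d.continuous_innerL.mul continuous_const)) (fun x y => ?_) x y
    simp only [innerL_apply, rmulL_apply, d.inner_rmul]
  rmul_mul a b x := by
    have : d.rmulL (a * b) = (d.rmulL b).comp (d.rmulL a) := d.completion_ext fun x => by
      rw [ContinuousLinearMap.comp_apply, rmulL_apply, rmulL_apply, rmulL_apply, d.rmul_mul]
    exact DFunLike.congr_fun this x

theorem completion_inner (x y : X) :
    d.completion.inner (d.toCompletion x) (d.toCompletion y) = d.inner x y :=
  d.innerL_apply x y

theorem completion_rmul (b : B) (x : X) :
    d.completion.rmul b (d.toCompletion x) = d.toCompletion (d.rmul b x) :=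
  d.rmulL_apply b x

theorem completion_norm_sq (x : d.Completion) : ‖x‖ ^ 2 = ‖d.completion.inner x x‖ := by
  refine d.denseRange_toCompletion.induction_on (p := fun x => ‖x‖ ^ 2 = ‖d.innerL x x‖) x
    (isClosed_eq (continuous_norm.pow 2)
      (d.continuous_innerL.comp (continuous_id.prodMk continuous_id)).norm) fun x => ?_
  rw [innerL_apply, norm_toCompletion_sq]

end PreHilbertModule

namespace PreHilbertModule

variable {X : Type u} [AddCommGroup X] [Module ℂ X] (d : PreHilbertModule B X)

/-- A symmetric operator whose iterates grow at most like `K ^ n` on each vector is bounded by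
`K`. -/
theorem norm_le_of_symmetric (f : X → X) (hf : ∀ x y, d.inner (f x) y = d.inner x (f y))
    {K : ℝ} (hK : 0 ≤ K)
    (h : ∀ x, ∃ C, ∀ n, ‖d.toCompletion (f^[n] x)‖ ≤ C * K ^ n) (x : X) :
    ‖d.toCompletion (f x)‖ ≤ K * ‖d.toCompletion x‖ := by
  set a : ℕ → ℝ := fun n => ‖d.toCompletion (f^[n] x)‖ with ha
  have ha0 : ∀ n, 0 ≤ a n := fun n => norm_nonneg _
  have hlog : ∀ n, a (n + 1) ^ 2 ≤ a n * a (n + 2) := by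
    intro n
    simp only [ha]
    rw [norm_toCompletion_sq]
    simp only [Function.iterate_succ_apply' f]
    rw [hf]
    exact d.norm_inner_le' _ _
  by_contra! hlt
  change K * a 0 < a 1 at hlt
  have h0 : 0 < a 0 := by
    rcases (ha0 0).lt_or_eq with h0 | h0
    · exact h0
    · have := hlog 0
      rw [← h0] at this hlt
      nlinarith
  set r := a 1 / a 0 with hr
  have hKr : K < r := by rw [hr, lt_div_iff₀ h0]; exact hlt
  have hr0 : 0 < r := hK.trans_lt hKr
  have step : ∀ n, 0 < a n ∧ r * a n ≤ a (n + 1) := by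
    intro n
    induction n with
    | zero => exact ⟨h0, by rw [hr, div_mul_cancel₀ _ h0.ne']⟩
    | succ n ih =>
      have h1 : 0 < a (n + 1) := (mul_pos hr0 ih.1).trans_le ih.2
      refine ⟨h1, ?_⟩
      have h2 := hlog n
      have h3 : r * a n * a (n + 1) ≤ a n * a (n + 2) := by nlinarith
      have : a n * (r * a (n + 1)) ≤ a n * a (n + 2) := by linarith
      exact le_of_mul_le_mul_left this ih.1
  have hpow : ∀ n, r ^ n * a 0 ≤ a n := by
    intro n
    induction n with
    | zero => simp
    | succ n ih =>
      calc r ^ (n + 1) * a 0 = r * (r ^ n * a 0) := by ring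
        _ ≤ r * a n := by gcongr
        _ ≤ _ := (step n).2
  obtain ⟨C, hC⟩ := h x
  rcases hK.lt_or_eq with hK | hK
  · obtain ⟨n, hn⟩ := pow_unbounded_of_one_lt (C / a 0) ((one_lt_div hK).mpr hKr)
    have h1 := (hpow n).trans (hC n)
    rw [div_lt_iff₀ h0, div_pow, div_mul_eq_mul_div, lt_div_iff₀ (pow_pos hK n)] at hn
    linarith
  · have h1 := (hpow 1).trans (hC 1)
    rw [← hK] at h1
    nlinarith

end PreHilbertModule

/-! ### Bimodules -/

/-- A right C⋆-`B`-`B`-bimodule: a full Hilbert C⋆-module over `B` with a nondegenerate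
representation `lmul` of `B` by adjointable operators (`mod.rmul b x` is `x b`, `lmul b x` is
`b x`). That the operators `lmul b` are right `B`-linear and bounded follows from
`inner_lmul`. -/
structure CStarBimod (B : Type u) [NonUnitalCStarAlgebra B] [PartialOrder B]
    [StarOrderedRing B] where
  carrier : Type u
  [normedAddCommGroup : NormedAddCommGroup carrier]
  [normedSpace : NormedSpace ℂ carrier]
  [completeSpace : CompleteSpace carrier]
  mod : PreHilbertModule B carrier
  norm_sq : ∀ x, ‖x‖ ^ 2 = ‖mod.inner x x‖
  full : closure (Submodule.span ℂ {b | ∃ x y, mod.inner x y = b} : Set B) = Set.univ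
  lmul : B →ₙₐ[ℂ] Module.End ℂ carrier
  inner_lmul : ∀ b x y, mod.inner (lmul b x) y = mod.inner x (lmul (star b) y)
  nondegenerate : closure (Submodule.span ℂ {x | ∃ b y, lmul b y = x} : Set carrier) = Set.univ

namespace CStarBimod

instance : CoeSort (CStarBimod B) (Type u) := ⟨carrier⟩

attribute [instance] normedAddCommGroup normedSpace completeSpace

section Basic

variable (E F : CStarBimod B)

theorem norm_inner_le (x y : E) : ‖E.mod.inner x y‖ ≤ ‖x‖ * ‖y‖ := by
  refine le_of_sq_le_sq ?_ (by positivity)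
  rw [mul_pow, E.norm_sq, E.norm_sq]
  exact E.mod.norm_inner_sq_le x y

variable {E} in
theorem ext_inner {x y : E} (h : ∀ z, E.mod.inner z x = E.mod.inner z y) : x = y := by
  rw [← sub_eq_zero, ← norm_eq_zero, ← sq_eq_zero_iff, E.norm_sq, norm_eq_zero, map_sub, h,
    sub_self]

theorem norm_toCompletion (x : E) : ‖E.mod.toCompletion x‖ = ‖x‖ := by
  rw [PreHilbertModule.norm_toCompletion, ← E.norm_sq, Real.sqrt_sq (norm_nonneg _)]

theorem norm_rmul_le (b : B) (x : E) : ‖E.mod.rmul b x‖ ≤ ‖x‖ * ‖b‖ := by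
  rw [← norm_toCompletion, ← norm_toCompletion, mul_comm]
  exact E.mod.norm_rmul_le b x

theorem norm_lmul_selfAdjoint_le (p : B) (hp : star p = p) (x : E) :
    ‖E.lmul p x‖ ≤ ‖p‖ * ‖x‖ := by
  have key := E.mod.norm_le_of_symmetric (E.lmul p)
    (fun x y => by rw [E.inner_lmul, hp]) (norm_nonneg p) (fun x => ?_) x
  · rwa [norm_toCompletion, norm_toCompletion] at key
  let f : B →ₗ[ℂ] B :=
    { toFun := fun b => E.mod.inner x (E.lmul b x)
      map_add' := fun a b => by simp
      map_smul' := fun c b => by simp }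
  have hf : ∀ b, 0 ≤ b → 0 ≤ f b := by
    intro b hb
    obtain ⟨c, rfl⟩ := CStarAlgebra.nonneg_iff_eq_star_mul_self.mp hb
    change 0 ≤ E.mod.inner x (E.lmul (star c * c) x)
    rw [map_mul, Module.End.mul_apply, ← E.inner_lmul]
    exact E.mod.inner_self_nonneg _
  obtain ⟨C, hC⟩ := (PositiveLinearMap.mk₀ f hf).exists_norm_apply_le
  have hsymm : ∀ n : ℕ, ∀ y z : E, E.mod.inner ((E.lmul p)^[n] y) z =
      E.mod.inner y ((E.lmul p)^[n] z) := by
    intro n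
    induction n with
    | zero => simp
    | succ n ih =>
      intro y z
      rw [Function.iterate_succ_apply, ih, E.inner_lmul, hp, Function.iterate_succ_apply']
  have hpow : ∀ n : ℕ, ∀ y : E, ∃ q : B, ‖q‖ ≤ ‖p‖ ^ (n + 1) ∧
      (E.lmul p)^[n + 1] y = E.lmul q y := by
    intro n y
    induction n with
    | zero => exact ⟨p, by simp, rfl⟩
    | succ n ih =>
      obtain ⟨q, hq, hqy⟩ := ih
      refine ⟨p * q, (norm_mul_le _ _).trans ?_, ?_⟩
      · rw [pow_succ' _ (n + 1)]; gcongr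
      · rw [Function.iterate_succ_apply', hqy, map_mul, Module.End.mul_apply]
  refine ⟨max (√(C : ℝ)) ‖x‖, fun n => ?_⟩
  rw [norm_toCompletion]
  rcases n with _ | n
  · simp
  refine le_of_sq_le_sq ?_ (by positivity)
  obtain ⟨q, hq, hqx⟩ := hpow (n + 1 + n) x
  rw [E.norm_sq, hsymm, ← Function.iterate_add_apply,
    show n + 1 + (n + 1) = n + 1 + n + 1 by ring, hqx]
  calc ‖f q‖ ≤ C * ‖q‖ := hC q
    _ ≤ C * ‖p‖ ^ (n + 1 + n + 1) := by gcongr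
    _ = √(C : ℝ) ^ 2 * (‖p‖ ^ (n + 1)) ^ 2 := by
      rw [Real.sq_sqrt C.coe_nonneg]; ring
    _ = (√(C : ℝ) * ‖p‖ ^ (n + 1)) ^ 2 := by ring
    _ ≤ _ := by gcongr; exact le_max_left _ _

theorem norm_lmul_le (b : B) (x : E) : ‖E.lmul b x‖ ≤ ‖b‖ * ‖x‖ := by
  refine le_of_sq_le_sq ?_ (by positivity)
  rw [E.norm_sq, E.inner_lmul, ← Module.End.mul_apply, ← map_mul]
  calc _ ≤ ‖x‖ * (‖star b * b‖ * ‖x‖) := (E.norm_inner_le _ _).trans (by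
        gcongr
        exact E.norm_lmul_selfAdjoint_le _ (by simp) x)
    _ = _ := by rw [CStarRing.norm_star_mul_self]; ring

/-- Left multiplication by `b` as a bounded operator. -/
noncomputable def lmulL (b : B) : E →L[ℂ] E :=
  (E.lmul b).mkContinuous ‖b‖ (E.norm_lmul_le b)

@[simp] theorem lmulL_apply (b : B) (x : E) : E.lmulL b x = E.lmul b x := rfl

theorem inner_lmul' (b : B) (x y : E) :
    E.mod.inner x (E.lmul b y) = E.mod.inner (E.lmul (star b) x) y := by
  rw [E.inner_lmul, star_star]

theorem rmul_lmul (a b : B) (x : E) : E.mod.rmul b (E.lmul a x) = E.lmul a (E.mod.rmul b x) :=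
  ext_inner fun z => by
    rw [E.mod.inner_rmul, inner_lmul', inner_lmul', E.mod.inner_rmul]

/-- The form as a bounded operator in the second variable. -/
noncomputable def innerL (x : E) : E →L[ℂ] B :=
  (E.mod.inner x).mkContinuous ‖x‖ (E.norm_inner_le x)

@[simp] theorem innerL_apply (x y : E) : E.innerL x y = E.mod.inner x y := rfl

theorem continuous_inner : Continuous fun p : E × E => E.mod.inner p.1 p.2 := by
  let f : E →L⋆[ℂ] E →L[ℂ] B := LinearMap.mkContinuous₂ E.mod.inner 1 fun x y => by
    rw [one_mul]; exact E.norm_inner_le x y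
  exact (f.continuous.comp continuous_fst).clm_apply continuous_snd

end Basic

/-! ### The category of bimodules -/

/-- A morphism: an adjointable operator that commutes with the left action of `B`. The adjoint is
recorded with the operator; it is determined by the operator, and two morphisms are equal as soon
as the operators are. -/
structure Hom (E F : CStarBimod B) where
  toCLM : E →L[ℂ] F
  adj : F →L[ℂ] E
  inner_adj : ∀ x y, F.mod.inner (toCLM x) y = E.mod.inner x (adj y)
  map_lmul : ∀ b x, toCLM (E.lmul b x) = F.lmul b (toCLM x)

namespace Hom

variable {E F G : CStarBimod B}

instance : CoeFun (Hom E F) fun _ => E → F := ⟨fun f => f.toCLM⟩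

@[ext] theorem ext {f g : Hom E F} (h : ∀ x, f x = g x) : f = g := by
  obtain ⟨f, f', hf, _⟩ := f
  obtain ⟨g, g', hg, _⟩ := g
  have h1 : f = g := ContinuousLinearMap.ext h
  subst h1
  have h2 : f' = g' := ContinuousLinearMap.ext fun y => ext_inner fun z => by rw [← hf, hg]
  subst h2
  rfl

theorem adj_inner (f : Hom E F) (x : F) (y : E) :
    E.mod.inner (f.adj x) y = F.mod.inner x (f y) := by
  rw [← E.mod.star_inner, ← f.inner_adj, F.mod.star_inner]

theorem adj_lmul (f : Hom E F) (b : B) (y : F) : f.adj (F.lmul b y) = E.lmul b (f.adj y) :=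
  ext_inner fun z => by
    rw [← f.inner_adj, F.inner_lmul', ← f.map_lmul, f.inner_adj, ← E.inner_lmul']

/-- The adjoint morphism. -/
noncomputable def dagger (f : Hom E F) : Hom F E := ⟨f.adj, f.toCLM, f.adj_inner, f.adj_lmul⟩

end Hom

instance : Category (CStarBimod B) where
  Hom := Hom
  id E := ⟨.id ℂ E, .id ℂ E, fun _ _ => rfl, fun _ _ => rfl⟩
  comp f g := ⟨g.toCLM.comp f.toCLM, f.adj.comp g.adj,
    fun x y => by simp [g.inner_adj, f.inner_adj], fun b x => by simp [f.map_lmul, g.map_lmul]⟩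

@[simp] theorem id_apply (E : CStarBimod B) (x : E) : Hom.toCLM (𝟙 E) x = x := rfl

@[simp] theorem comp_apply {E F G : CStarBimod B} (f : E ⟶ F) (g : F ⟶ G) (x : E) :
    Hom.toCLM (f ≫ g) x = Hom.toCLM g (Hom.toCLM f x) := rfl

theorem hom_ext {E F : CStarBimod B} {f g : E ⟶ F}
    (h : ∀ x, Hom.toCLM f x = Hom.toCLM g x) : f = g := Hom.ext h

/-- A morphism that preserves inner products and has dense range is an isomorphism. -/
theorem exists_iso {E F : CStarBimod B} (f : E →L[ℂ] F)
    (hinner : ∀ x y, F.mod.inner (f x) (f y) = E.mod.inner x y) (hdense : DenseRange f)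
    (hmul : ∀ b x, f (E.lmul b x) = F.lmul b (f x)) :
    ∃ i : E ≅ F, ∀ x, Hom.toCLM i.hom x = f x := by
  have hnorm : ∀ x, ‖f x‖ = ‖x‖ := fun x => by
    rw [← sq_eq_sq₀ (norm_nonneg _) (norm_nonneg _), F.norm_sq, E.norm_sq, hinner]
  let g : E →ₗᵢ[ℂ] F := ⟨f.toLinearMap, hnorm⟩
  have hsurj : Function.Surjective g := by
    have hc : IsClosed (Set.range g) := g.isometry.isClosedEmbedding.isClosed_range
    rw [← Set.range_eq_univ, ← hc.closure_eq]
    exact hdense.closure_range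
  let e : E ≃ₗᵢ[ℂ] F := LinearIsometryEquiv.ofSurjective g hsurj
  have hef : ∀ x, e x = f x := fun x => rfl
  have hadj : ∀ x y, F.mod.inner (e x) y = E.mod.inner x (e.symm y) := fun x y => by
    obtain ⟨z, rfl⟩ := e.surjective y
    rw [hef, hef, hinner, ← hef, e.symm_apply_apply]
  refine ⟨⟨⟨(e : E →L[ℂ] F), (e.symm : F →L[ℂ] E), hadj, hmul⟩,
    ⟨(e.symm : F →L[ℂ] E), (e : E →L[ℂ] F), fun x y => ?_, fun b x => ?_⟩, ?_, ?_⟩,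
    fun x => rfl⟩
  · change E.mod.inner (e.symm x) y = F.mod.inner x (e y)
    rw [← E.mod.star_inner, ← hadj, F.mod.star_inner]
  · change e.symm (F.lmul b x) = E.lmul b (e.symm x)
    rw [LinearIsometryEquiv.symm_apply_eq, hef, hmul, ← hef, e.apply_symm_apply]
  · exact hom_ext fun x => e.symm_apply_apply x
  · exact hom_ext fun x => e.apply_symm_apply x

/-! ### The C⋆-algebra `B` as a bimodule -/

variable (B) in
/-- `B` as a right C⋆-`B`-`B`-bimodule, with `⟨a|b⟩ = a⋆ b`. -/
noncomputable def unit : CStarBimod B where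
  carrier := B
  mod :=
    { inner := LinearMap.mk₂'ₛₗ _ _ (fun a b => star a * b) (fun a b c => by simp [add_mul])
        (fun c a b => by rw [star_smul, smul_mul_assoc]; rfl)
        (fun a b c => mul_add _ _ _) (fun c a b => mul_smul_comm _ _ _)
      rmul := LinearMap.mk₂ ℂ (fun b x => x * b) (fun a b c => mul_add _ _ _)
        (fun c a b => mul_smul_comm _ _ _) (fun a b c => add_mul _ _ _)
        (fun c a b => smul_mul_assoc _ _ _)
      star_inner := fun a b => by simp
      inner_self_nonneg := fun a => star_mul_self_nonneg a
      inner_rmul := fun a b c => (mul_assoc _ _ _).symm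
      rmul_mul := fun a b c => (mul_assoc _ _ _).symm }
  norm_sq a := by
    change ‖a‖ ^ 2 = ‖star a * a‖
    rw [CStarRing.norm_star_mul_self, sq]
  full := by
    have : Submodule.span ℂ {b : B | ∃ x y : B, star x * y = b} = ⊤ := by
      rw [eq_top_iff, ← CStarAlgebra.span_nonneg, Submodule.span_le]
      intro b hb
      obtain ⟨c, rfl⟩ := CStarAlgebra.nonneg_iff_eq_star_mul_self.mp hb
      exact Submodule.subset_span ⟨c, c, rfl⟩
    change closure ((Submodule.span ℂ {b : B | ∃ x y : B, star x * y = b} : Submodule ℂ B) :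
      Set B) = _
    rw [this]; simp
  lmul := NonUnitalAlgHom.lmul ℂ B
  inner_lmul b x y := by
    change star (b * x) * y = star x * (star b * y)
    rw [star_mul, mul_assoc]
  nondegenerate := by
    have : Submodule.span ℂ {b : B | ∃ x y : B, x * y = b} = ⊤ := by
      rw [eq_top_iff, ← CStarAlgebra.span_nonneg, Submodule.span_le]
      intro b hb
      obtain ⟨c, rfl⟩ := CStarAlgebra.nonneg_iff_eq_star_mul_self.mp hb
      exact Submodule.subset_span ⟨star c, c, rfl⟩
    change closure ((Submodule.span ℂ {b : B | ∃ x y : B, x * y = b} : Submodule ℂ B) :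
      Set B) = _
    rw [this]; simp

end CStarBimod

namespace CStarBimod

/-! ### The internal tensor product -/

section Tensor

variable (E F : CStarBimod B)

theorem exists_decomp {M : Type*} [NonUnitalCStarAlgebra M] [PartialOrder M] [StarOrderedRing M]
    (G : M) (hG : star G = G) :
    ∃ P N R : M, G = P - N ∧ 0 ≤ P ∧ N * P = 0 ∧ star N = N ∧ N = star R * R := by
  have hN : 0 ≤ G⁻ := CFC.negPart_nonneg G
  obtain ⟨R, hR⟩ := CStarAlgebra.nonneg_iff_eq_star_mul_self.mp hN
  exact ⟨G⁺, G⁻, R, (CFC.posPart_sub_negPart G hG).symm, CFC.posPart_nonneg G,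
    CFC.negPart_mul_posPart G, hN.isSelfAdjoint, hR⟩

theorem exists_sqrt {M : Type*} [NonUnitalCStarAlgebra M] [PartialOrder M] [StarOrderedRing M]
    {G : M} (hG : 0 ≤ G) : ∃ H : M, G = star H * H :=
  CStarAlgebra.nonneg_iff_eq_star_mul_self.mp hG

/-- The Gram matrix of finitely many elements is of the form `H⋆ H`. -/
theorem exists_gram_eq {ι : Type*} [Fintype ι] (ξ : ι → E) :
    ∃ H : ι → ι → B, ∀ i j, E.mod.inner (ξ i) (ξ j) = ∑ k, star (H k i) * H k j := by
  let G : CStarMatrix ι ι B := CStarMatrix.ofMatrix fun i j => E.mod.inner (ξ i) (ξ j)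
  have hG : star G = G := by
    ext i j
    exact E.mod.star_inner _ _
  obtain ⟨P, N, R, h1, hP, h2, hNs, hR⟩ := exists_decomp G hG
  have hprod : star N * G * N = -(N * N * N) := by
    rw [hNs]
    nth_rewrite 1 [h1]
    rw [mul_sub, sub_mul, h2, zero_mul, zero_sub]
  have hNNN : N * N * N = star (R * N) * (R * N) := by
    rw [star_mul, hNs]
    conv_lhs => rw [mul_assoc, ← mul_assoc]
    nth_rewrite 2 [hR]
    simp only [mul_assoc]
  have hdiag1 : ∀ j, 0 ≤ (star N * G * N) j j := by
    intro j
    have : (star N * G * N) j j =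
        E.mod.inner (∑ i, E.mod.rmul (N i j) (ξ i)) (∑ i, E.mod.rmul (N i j) (ξ i)) := by
      simp only [CStarMatrix.mul_apply, map_sum, LinearMap.sum_apply, E.mod.inner_rmul,
        E.mod.rmul_inner, Finset.sum_mul, CStarMatrix.star_apply]
      rfl
    rw [this]
    exact E.mod.inner_self_nonneg _
  have hdiag2 : ∀ j, (N * N * N) j j = ∑ i, star ((R * N) i j) * (R * N) i j := by
    intro j
    rw [hNNN, CStarMatrix.mul_apply]
    simp only [CStarMatrix.star_apply]
  have hRN : R * N = 0 := by
    ext i j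
    have h1 : ∑ i, star ((R * N) i j) * (R * N) i j = 0 := by
      refine le_antisymm ?_ (Finset.sum_nonneg fun i _ => star_mul_self_nonneg _)
      rw [← hdiag2, ← neg_nonneg]
      have := hdiag1 j
      rwa [hprod] at this
    have h2 := (Finset.sum_eq_zero_iff_of_nonneg fun i _ =>
      star_mul_self_nonneg ((R * N) i j)).mp h1 i (Finset.mem_univ i)
    exact (CStarRing.star_mul_self_eq_zero_iff _).mp h2
  have hN0 : N = 0 := by
    have : star N * N = 0 := by
      rw [hNs]
      nth_rewrite 1 [hR]
      rw [mul_assoc, hRN, mul_zero]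
    exact (CStarRing.star_mul_self_eq_zero_iff _).mp this
  have hGnn : 0 ≤ G := by
    rw [h1, hN0, sub_zero]
    exact hP
  obtain ⟨H, hH⟩ := exists_sqrt hGnn
  refine ⟨H, fun i j => ?_⟩
  change G i j = _
  rw [hH, CStarMatrix.mul_apply]
  simp only [CStarMatrix.star_apply]

/-- The form `⟨ξ ⊗ η|ξ' ⊗ η'⟩ = ⟨η|⟨ξ|ξ'⟩η'⟩` on the algebraic tensor product. -/
noncomputable def tensorForm : (E ⊗[ℂ] F) →ₗ⋆[ℂ] (E ⊗[ℂ] F) →ₗ[ℂ] B :=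
  TensorProduct.lift (LinearMap.mk₂'ₛₗ (starRingEnd ℂ) (starRingEnd ℂ)
    (fun ξ η => TensorProduct.lift
      (LinearMap.mk₂ ℂ (fun ξ' η' => F.mod.inner η (F.lmul (E.mod.inner ξ ξ') η'))
        (fun x y z => by simp) (fun c x y => by simp) (fun x y z => by simp)
        (fun c x y => by simp)))
    (fun x y z => TensorProduct.ext' fun a b => by simp)
    (fun c x y => TensorProduct.ext' fun a b => by simp)
    (fun x y z => TensorProduct.ext' fun a b => by simp)
    (fun c x y => TensorProduct.ext' fun a b => by simp))

@[simp] theorem tensorForm_tmul (ξ ξ' : E) (η η' : F) :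
    tensorForm E F (ξ ⊗ₜ η) (ξ' ⊗ₜ η') = F.mod.inner η (F.lmul (E.mod.inner ξ ξ') η') := rfl

theorem tensorForm_nonneg (x : E ⊗[ℂ] F) : 0 ≤ tensorForm E F x x := by
  obtain ⟨S, rfl⟩ := TensorProduct.exists_finset x
  obtain ⟨H, hH⟩ := E.exists_gram_eq fun i : S => i.1.1
  have : tensorForm E F (∑ i ∈ S, i.1 ⊗ₜ[ℂ] i.2) (∑ i ∈ S, i.1 ⊗ₜ[ℂ] i.2) =
      ∑ k : S, F.mod.inner (∑ i : S, F.lmul (H k i) i.1.2) (∑ j : S, F.lmul (H k j) j.1.2) := by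
    rw [← Finset.sum_coe_sort S]
    simp only [map_sum, LinearMap.sum_apply, tensorForm_tmul, hH, F.inner_lmul]
    simp only [← Module.End.mul_apply, ← map_mul]
    exact (Finset.sum_congr rfl fun x _ => Finset.sum_comm).trans Finset.sum_comm
  rw [this]
  exact Finset.sum_nonneg fun k _ => F.mod.inner_self_nonneg _

/-- The algebraic tensor product `E ⊗ F` with the form `⟨ξ ⊗ η|ξ' ⊗ η'⟩ = ⟨η|⟨ξ|ξ'⟩η'⟩` and the
right action `(ξ ⊗ η) b = ξ ⊗ η b`. -/
noncomputable def preTensor : PreHilbertModule B (E ⊗[ℂ] F) where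
  inner := tensorForm E F
  rmul := LinearMap.lTensorHom E ∘ₗ F.mod.rmul
  star_inner x y := by
    induction x using TensorProduct.induction_on with
    | zero => simp
    | add x x' hx hx' => simp [hx, hx']
    | tmul ξ η =>
      induction y using TensorProduct.induction_on with
      | zero => simp
      | add y y' hy hy' => simp [hy, hy']
      | tmul ξ' η' =>
        rw [tensorForm_tmul, tensorForm_tmul, F.mod.star_inner, F.inner_lmul, E.mod.star_inner]
  inner_self_nonneg := tensorForm_nonneg E F
  inner_rmul x y b := by
    change tensorForm E F x ((F.mod.rmul b).lTensor E y) = _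
    induction x using TensorProduct.induction_on with
    | zero => simp
    | add x x' hx hx' => simp [hx, hx', add_mul]
    | tmul ξ η =>
      induction y using TensorProduct.induction_on with
      | zero => simp
      | add y y' hy hy' => simp [hy, hy', add_mul]
      | tmul ξ' η' =>
        rw [LinearMap.lTensor_tmul, tensorForm_tmul, tensorForm_tmul, ← F.rmul_lmul,
          F.mod.inner_rmul]
  rmul_mul a b x := by
    change (F.mod.rmul (a * b)).lTensor E x =
      (F.mod.rmul b).lTensor E ((F.mod.rmul a).lTensor E x)
    induction x using TensorProduct.induction_on with
    | zero => simp
    | add x x' hx hx' => rw [map_add, map_add, map_add, hx, hx']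
    | tmul ξ η => simp [F.mod.rmul_mul]

theorem preTensor_inner (ξ ξ' : E) (η η' : F) :
    (preTensor E F).inner (ξ ⊗ₜ η) (ξ' ⊗ₜ η') =
      F.mod.inner η (F.lmul (E.mod.inner ξ ξ') η') := rfl

theorem preTensor_rmul (ξ : E) (η : F) (b : B) :
    (preTensor E F).rmul b (ξ ⊗ₜ η) = ξ ⊗ₜ F.mod.rmul b η := rfl

theorem norm_tmul_le (ξ : E) (η : F) :
    ‖(preTensor E F).toCompletion (ξ ⊗ₜ η)‖ ≤ ‖ξ‖ * ‖η‖ := by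
  refine le_of_sq_le_sq ?_ (by positivity)
  rw [PreHilbertModule.norm_toCompletion_sq, preTensor_inner]
  calc _ ≤ ‖η‖ * (‖E.mod.inner ξ ξ‖ * ‖η‖) :=
        (F.norm_inner_le _ _).trans (by gcongr; exact F.norm_lmul_le _ _)
    _ = _ := by rw [← E.norm_sq]; ring

variable {E F} {E' F' : CStarBimod B}

/-- The operator `S ⊗ T` on the algebraic tensor product. -/
noncomputable def preMap (S : E →L[ℂ] E') (T : F →L[ℂ] F') : E ⊗[ℂ] F →ₗ[ℂ] E' ⊗[ℂ] F' :=
  TensorProduct.map S.toLinearMap T.toLinearMap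

theorem preMap_tmul (S : E →L[ℂ] E') (T : F →L[ℂ] F') (ξ : E) (η : F) :
    preMap S T (ξ ⊗ₜ η) = S ξ ⊗ₜ T η := rfl

theorem inner_preMap (S : E →L[ℂ] E') (S' : E' →L[ℂ] E)
    (hS : ∀ x y, E'.mod.inner (S x) y = E.mod.inner x (S' y)) (T : Hom F F')
    (x : E ⊗[ℂ] F) (y : E' ⊗[ℂ] F') :
    (preTensor E' F').inner (preMap S T.toCLM x) y =
      (preTensor E F).inner x (preMap S' T.adj y) := by
  induction x using TensorProduct.induction_on with
  | zero => simp
  | add x x' hx hx' => simp [hx, hx']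
  | tmul ξ η =>
    induction y using TensorProduct.induction_on with
    | zero => simp
    | add y y' hy hy' => simp [hy, hy']
    | tmul ξ' η' =>
      rw [preMap_tmul, preMap_tmul, preTensor_inner, preTensor_inner, hS, T.inner_adj, T.adj_lmul]

/-- `S ⊗ T` is bounded for the seminorms if `S` is adjointable and `T` is a morphism. -/
theorem exists_norm_preMap_le (S : E →L[ℂ] E') (S' : E' →L[ℂ] E)
    (hS : ∀ x y, E'.mod.inner (S x) y = E.mod.inner x (S' y)) (T : Hom F F') :
    ∃ C, ∀ x : E ⊗[ℂ] F, ‖(preTensor E' F').toCompletion (preMap S T.toCLM x)‖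
        ≤ C * ‖(preTensor E F).toCompletion x‖ := by
  set K : ℝ := ‖S'.comp S‖ * ‖T.adj.comp T.toCLM‖ with hK
  have hK0 : 0 ≤ K := by positivity
  let P : E ⊗[ℂ] F →ₗ[ℂ] E ⊗[ℂ] F := preMap S' T.adj ∘ₗ preMap S T.toCLM
  have hP : ∀ x y, (preTensor E F).inner (P x) y = (preTensor E F).inner x (P y) := fun x y => by
    rw [← (preTensor E F).star_inner]
    change star ((preTensor E F).inner y (preMap S' T.adj (preMap S T.toCLM x))) =
      (preTensor E F).inner x (preMap S' T.adj (preMap S T.toCLM y))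
    rw [← inner_preMap S S' hS, ← inner_preMap S S' hS, PreHilbertModule.star_inner]
  have hpow : ∀ (A : E →L[ℂ] E) (n : ℕ) (z : E), ‖A^[n] z‖ ≤ ‖A‖ ^ n * ‖z‖ := by
    intro A n z
    induction n with
    | zero => simp
    | succ n ih =>
      rw [Function.iterate_succ_apply']
      refine (A.le_opNorm _).trans ?_
      rw [pow_succ', mul_assoc]
      gcongr
  have hpow' : ∀ (A : F →L[ℂ] F) (n : ℕ) (z : F), ‖A^[n] z‖ ≤ ‖A‖ ^ n * ‖z‖ := by
    intro A n z
    induction n with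
    | zero => simp
    | succ n ih =>
      rw [Function.iterate_succ_apply']
      refine (A.le_opNorm _).trans ?_
      rw [pow_succ', mul_assoc]
      gcongr
  have hb := (preTensor E F).norm_le_of_symmetric P hP hK0 fun x => by
    induction x using TensorProduct.induction_on with
    | zero => exact ⟨0, fun n => by simp⟩
    | add x y hx hy =>
      obtain ⟨C, hC⟩ := hx
      obtain ⟨D, hD⟩ := hy
      refine ⟨C + D, fun n => ?_⟩
      rw [iterate_map_add, map_add, add_mul]
      exact (norm_add_le _ _).trans (add_le_add (hC n) (hD n))
    | tmul ξ η =>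
      refine ⟨‖ξ‖ * ‖η‖, fun n => ?_⟩
      have : P^[n] (ξ ⊗ₜ η) = (S'.comp S)^[n] ξ ⊗ₜ (T.adj.comp T.toCLM)^[n] η := by
        induction n with
        | zero => rfl
        | succ n ih =>
          rw [Function.iterate_succ_apply', ih, Function.iterate_succ_apply',
            Function.iterate_succ_apply']
          rfl
      rw [this]
      calc _ ≤ _ := norm_tmul_le _ _ _ _
        _ ≤ (‖S'.comp S‖ ^ n * ‖ξ‖) * (‖T.adj.comp T.toCLM‖ ^ n * ‖η‖) := by
          gcongr
          · exact hpow _ _ _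
          · exact hpow' _ _ _
        _ = _ := by rw [hK, mul_pow]; ring
  refine ⟨√K, fun x => ?_⟩
  refine le_of_sq_le_sq ?_ (by positivity)
  rw [PreHilbertModule.norm_toCompletion_sq, inner_preMap S S' hS, mul_pow, Real.sq_sqrt hK0]
  calc _ ≤ _ := PreHilbertModule.norm_inner_le' _ _ _
    _ ≤ ‖(preTensor E F).toCompletion x‖ * (K * ‖(preTensor E F).toCompletion x‖) := by
      gcongr
      exact hb x
    _ = _ := by ring

/-- `S ⊗ T` extended to the completed tensor products. -/
noncomputable def mapL (S : E →L[ℂ] E') (T : F →L[ℂ] F') :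
    (preTensor E F).Completion →L[ℂ] (preTensor E' F').Completion :=
  ((preTensor E' F').toCompletion ∘ₗ preMap S T).extendOfNorm (preTensor E F).toCompletion

theorem mapL_apply (S : E →L[ℂ] E') (S' : E' →L[ℂ] E)
    (hS : ∀ x y, E'.mod.inner (S x) y = E.mod.inner x (S' y)) (T : Hom F F') (x : E ⊗[ℂ] F) :
    mapL S T.toCLM ((preTensor E F).toCompletion x) =
      (preTensor E' F').toCompletion (preMap S T.toCLM x) :=
  LinearMap.extendOfNorm_eq (f := (preTensor E' F').toCompletion ∘ₗ preMap S T.toCLM)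
    (preTensor E F).denseRange_toCompletion (exists_norm_preMap_le S S' hS T) x

/-- The elementary tensors span a dense subspace of the completed tensor product. -/
theorem tensor_clm_ext {V : Type*} [NormedAddCommGroup V] [NormedSpace ℂ V]
    {f g : (preTensor E F).Completion →L[ℂ] V}
    (h : ∀ ξ η, f ((preTensor E F).toCompletion (ξ ⊗ₜ η)) =
      g ((preTensor E F).toCompletion (ξ ⊗ₜ η))) : f = g :=
  (preTensor E F).completion_ext fun x => by
    induction x using TensorProduct.induction_on with
    | zero => simp
    | add x y hx hy => rw [map_add, map_add, map_add, hx, hy]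
    | tmul ξ η => exact h ξ η

theorem mapL_tmul (S : E →L[ℂ] E') (S' : E' →L[ℂ] E)
    (hS : ∀ x y, E'.mod.inner (S x) y = E.mod.inner x (S' y)) (T : Hom F F') (ξ : E) (η : F) :
    mapL S T.toCLM ((preTensor E F).toCompletion (ξ ⊗ₜ η)) =
      (preTensor E' F').toCompletion (S ξ ⊗ₜ T η) :=
  mapL_apply S S' hS T _

theorem mapL_inner (S : E →L[ℂ] E') (S' : E' →L[ℂ] E)
    (hS : ∀ x y, E'.mod.inner (S x) y = E.mod.inner x (S' y)) (T : Hom F F')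
    (x : (preTensor E F).Completion) (y : (preTensor E' F').Completion) :
    (preTensor E' F').completion.inner (mapL S T.toCLM x) y =
      (preTensor E F).completion.inner x (mapL S' T.adj y) := by
  have hS' : ∀ x y, E.mod.inner (S' x) y = E'.mod.inner x (S y) := fun x y => by
    rw [← E.mod.star_inner, ← hS, E'.mod.star_inner]
  refine (preTensor E F).denseRange_toCompletion.induction_on
    (p := fun x => (preTensor E' F').innerL (mapL S T.toCLM x) y =
      (preTensor E F).innerL x (mapL S' T.adj y)) x
    (isClosed_eq ((preTensor E' F').continuous_innerL.comp
      ((mapL S T.toCLM).continuous.prodMk continuous_const))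
      ((preTensor E F).continuous_innerL.comp
      (continuous_id.prodMk continuous_const))) fun x => ?_
  refine (preTensor E' F').denseRange_toCompletion.induction_on
    (p := fun y => (preTensor E' F').innerL
        (mapL S T.toCLM ((preTensor E F).toCompletion x)) y =
      (preTensor E F).innerL ((preTensor E F).toCompletion x) (mapL S' T.adj y)) y
    (isClosed_eq (((preTensor E' F').innerL _).continuous)
      (((preTensor E F).innerL _).continuous.comp (mapL S' T.adj).continuous)) fun y => ?_
  have h : mapL S' T.adj ((preTensor E' F').toCompletion y) =
    (preTensor E F).toCompletion (preMap S' T.adj y) := mapL_apply S' S hS' T.dagger y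
  rw [mapL_apply S S' hS, h, PreHilbertModule.innerL_apply, PreHilbertModule.innerL_apply,
    inner_preMap S S' hS]

/-- A bounded operator maps a closed linear span into any closed subspace that contains the images
of the generators. -/
theorem map_mem_of_dense {V W : Type*} [NormedAddCommGroup V] [NormedSpace ℂ V]
    [NormedAddCommGroup W] [NormedSpace ℂ W] {s : Set V}
    (hs : closure (Submodule.span ℂ s : Set V) = Set.univ) (f : V →L[ℂ] W) {U : Submodule ℂ W}
    (hU : IsClosed (U : Set W)) (h : ∀ x ∈ s, f x ∈ U) (x : V) : f x ∈ U := by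
  have h1 : Submodule.span ℂ s ≤ U.comap f.toLinearMap := Submodule.span_le.mpr h
  have h2 : closure (Submodule.span ℂ s : Set V) ⊆ f ⁻¹' U :=
    closure_minimal h1 (hU.preimage f.continuous)
  exact h2 (hs ▸ Set.mem_univ x)

variable (E F) in
/-- The map `(ξ, η) ↦ ξ ⊗ η` into the completed tensor product. -/
noncomputable def preTmul : E →L[ℂ] F →L[ℂ] (preTensor E F).Completion :=
  LinearMap.mkContinuous₂
    ((TensorProduct.mk ℂ E F).compr₂ (preTensor E F).toCompletion) 1
    (fun ξ η => by rw [one_mul]; exact norm_tmul_le E F ξ η)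

theorem preTmul_apply (ξ : E) (η : F) :
    preTmul E F ξ η = (preTensor E F).toCompletion (ξ ⊗ₜ η) := rfl

theorem mem_of_tmul_mem {U : Submodule ℂ (preTensor E F).Completion}
    (hU : IsClosed (U : Set (preTensor E F).Completion)) (h : ∀ ξ η, preTmul E F ξ η ∈ U)
    (x : (preTensor E F).Completion) : x ∈ U := by
  refine (preTensor E F).denseRange_toCompletion.induction_on (p := fun x => x ∈ U) x hU
    fun x => ?_
  induction x using TensorProduct.induction_on with
  | zero => rw [map_zero]; exact U.zero_mem
  | add x y hx hy => rw [map_add]; exact U.add_mem hx hy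
  | tmul ξ η => exact h ξ η

variable (E) in
/-- The operator `b ↦ b ξ`. -/
noncomputable def rket (ξ : E) : B →L[ℂ] E :=
  LinearMap.mkContinuous
    { toFun := fun b => E.lmul b ξ
      map_add' := fun a b => by simp
      map_smul' := fun c b => by simp } ‖ξ‖
    (fun b => by rw [mul_comm]; exact E.norm_lmul_le b ξ)

variable (E) in
/-- The operator `b ↦ ξ b`. -/
noncomputable def lket (ξ : E) : B →L[ℂ] E :=
  LinearMap.mkContinuous
    { toFun := fun b => E.mod.rmul b ξ
      map_add' := fun a b => by simp
      map_smul' := fun c b => by simp } ‖ξ‖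
    (fun b => E.norm_rmul_le b ξ)

@[simp] theorem rket_apply (ξ : E) (b : B) : E.rket ξ b = E.lmul b ξ := rfl

@[simp] theorem lket_apply (ξ : E) (b : B) : E.lket ξ b = E.mod.rmul b ξ := rfl

theorem lmulL_inner (b : B) (x y : E) :
    E.mod.inner (E.lmulL b x) y = E.mod.inner x (E.lmulL (star b) y) :=
  E.inner_lmul b x y

variable (E F) in
/-- The internal tensor product of bimodules: the separated completion of the algebraic tensor
product for the form `⟨ξ ⊗ η|ξ' ⊗ η'⟩ = ⟨η|⟨ξ|ξ'⟩η'⟩`, with the actions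
`(ξ ⊗ η) b = ξ ⊗ η b` and `b (ξ ⊗ η) = b ξ ⊗ η`. -/
noncomputable def tensor : CStarBimod B where
  carrier := (preTensor E F).Completion
  mod := (preTensor E F).completion
  norm_sq := (preTensor E F).completion_norm_sq
  full := by
    set s : Set B := {b | ∃ x y, (preTensor E F).completion.inner x y = b} with hs
    have hU : IsClosed ((Submodule.span ℂ s).topologicalClosure : Set B) :=
      Submodule.isClosed_topologicalClosure _
    have h1 : ∀ (η η' : F) (ξ ξ' : E), F.mod.inner η (F.lmul (E.mod.inner ξ ξ') η') ∈
        (Submodule.span ℂ s).topologicalClosure := fun η η' ξ ξ' =>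
      Submodule.le_topologicalClosure _ (Submodule.subset_span
        ⟨_, _, (preTensor E F).completion_inner (ξ ⊗ₜ η) (ξ' ⊗ₜ η')⟩)
    have h2 : ∀ (η η' : F) (b : B), F.mod.inner η (F.lmul b η') ∈
        (Submodule.span ℂ s).topologicalClosure := fun η η' b =>
      map_mem_of_dense E.full ((F.innerL η).comp (F.rket η')) hU
        (by rintro _ ⟨ξ, ξ', rfl⟩; exact h1 η η' ξ ξ') b
    have h3 : ∀ η η' : F, F.mod.inner η η' ∈ (Submodule.span ℂ s).topologicalClosure :=
      fun η η' => map_mem_of_dense F.nondegenerate (F.innerL η) hU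
        (by rintro _ ⟨b, y, rfl⟩; exact h2 η y b) η'
    refine Set.eq_univ_of_forall fun b => ?_
    exact map_mem_of_dense F.full (.id ℂ B) hU (by rintro _ ⟨x, y, rfl⟩; exact h3 x y) b
  lmul :=
    { toFun := fun b => (mapL (E.lmulL b) (Hom.toCLM (𝟙 F))).toLinearMap
      map_smul' := fun c b => by
        rw [← ContinuousLinearMap.toLinearMap_smul]
        congr 1
        refine tensor_clm_ext fun ξ η => ?_
        rw [_root_.smul_apply, mapL_tmul _ _ (lmulL_inner _), mapL_tmul _ _ (lmulL_inner _),
          lmulL_apply, lmulL_apply, map_smul, LinearMap.smul_apply, ← TensorProduct.smul_tmul',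
          map_smul]
        rfl
      map_zero' := by
        rw [← ContinuousLinearMap.toLinearMap_zero]
        congr 1
        refine tensor_clm_ext fun ξ η => ?_
        rw [mapL_tmul _ _ (lmulL_inner _), lmulL_apply, map_zero, LinearMap.zero_apply,
          TensorProduct.zero_tmul, map_zero, _root_.zero_apply]
      map_add' := fun a b => by
        rw [← ContinuousLinearMap.toLinearMap_add]
        congr 1
        refine tensor_clm_ext fun ξ η => ?_
        rw [_root_.add_apply, mapL_tmul _ _ (lmulL_inner _), mapL_tmul _ _ (lmulL_inner _),
          mapL_tmul _ _ (lmulL_inner _), lmulL_apply, lmulL_apply, lmulL_apply, map_add,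
          LinearMap.add_apply, TensorProduct.add_tmul, map_add]
      map_mul' := fun a b => by
        rw [Module.End.mul_eq_comp, ← ContinuousLinearMap.toLinearMap_comp]
        congr 1
        refine tensor_clm_ext fun ξ η => ?_
        rw [ContinuousLinearMap.comp_apply, mapL_tmul _ _ (lmulL_inner _),
          mapL_tmul _ _ (lmulL_inner _), mapL_tmul _ _ (lmulL_inner _), lmulL_apply, lmulL_apply,
          lmulL_apply, map_mul]
        rfl }
  inner_lmul b x y := mapL_inner _ _ (lmulL_inner b) (𝟙 F) x y
  nondegenerate := by
    refine Set.eq_univ_of_forall fun x => ?_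
    refine mem_of_tmul_mem (U := Submodule.topologicalClosure _)
      (Submodule.isClosed_topologicalClosure _) (fun ξ η => ?_) x
    refine map_mem_of_dense E.nondegenerate ((preTmul E F).flip η)
      (Submodule.isClosed_topologicalClosure _) ?_ ξ
    rintro _ ⟨b, ξ, rfl⟩
    refine Submodule.le_topologicalClosure _ (Submodule.subset_span ⟨b, preTmul E F ξ η, ?_⟩)
    exact mapL_tmul _ _ (lmulL_inner b) (𝟙 F) ξ η

variable (E F) in
/-- The elementary tensors `ξ ⊗ η` in the internal tensor product. -/
noncomputable def tmul : E →L[ℂ] F →L[ℂ] tensor E F := preTmul E F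

theorem tensor_inner (ξ ξ' : E) (η η' : F) :
    (tensor E F).mod.inner (tmul E F ξ η) (tmul E F ξ' η') =
      F.mod.inner η (F.lmul (E.mod.inner ξ ξ') η') :=
  (preTensor E F).completion_inner (ξ ⊗ₜ η) (ξ' ⊗ₜ η')

theorem tensor_rmul (b : B) (ξ : E) (η : F) :
    (tensor E F).mod.rmul b (tmul E F ξ η) = tmul E F ξ (F.mod.rmul b η) :=
  (preTensor E F).completion_rmul b (ξ ⊗ₜ η)

theorem tensor_lmul (b : B) (ξ : E) (η : F) :
    (tensor E F).lmul b (tmul E F ξ η) = tmul E F (E.lmul b ξ) η :=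
  mapL_tmul _ _ (lmulL_inner b) (𝟙 F) ξ η

theorem tensor_ext {V : Type*} [NormedAddCommGroup V] [NormedSpace ℂ V]
    {f g : tensor E F →L[ℂ] V} (h : ∀ ξ η, f (tmul E F ξ η) = g (tmul E F ξ η)) : f = g :=
  tensor_clm_ext h

theorem tensor_mem {U : Submodule ℂ (tensor E F)} (hU : IsClosed (U : Set (tensor E F)))
    (h : ∀ ξ η, tmul E F ξ η ∈ U) (x : tensor E F) : x ∈ U :=
  mem_of_tmul_mem hU h x

/-- The tensor product `S ⊗ T` of morphisms. -/
noncomputable def tensorMap (S : Hom E E') (T : Hom F F') : Hom (tensor E F) (tensor E' F') where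
  toCLM := mapL S.toCLM T.toCLM
  adj := mapL S.adj T.adj
  inner_adj := mapL_inner _ _ S.inner_adj T
  map_lmul b x := by
    let M : tensor E F →L[ℂ] tensor E' F' := mapL S.toCLM T.toCLM
    have h : ∀ ξ η, M (tmul E F ξ η) = tmul E' F' (S ξ) (T η) := mapL_tmul _ _ S.inner_adj T
    have : M.comp ((tensor E F).lmulL b) = ((tensor E' F').lmulL b).comp M :=
      tensor_ext fun ξ η => by
        rw [ContinuousLinearMap.comp_apply, ContinuousLinearMap.comp_apply, lmulL_apply,
          tensor_lmul, h, h, lmulL_apply, tensor_lmul, S.map_lmul]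
    exact DFunLike.congr_fun this x

theorem tensorMap_tmul (S : Hom E E') (T : Hom F F') (ξ : E) (η : F) :
    tensorMap S T (tmul E F ξ η) = tmul E' F' (S ξ) (T η) :=
  mapL_tmul _ _ S.inner_adj T ξ η

end Tensor

end CStarBimod

namespace CStarBimod

/-! ### The monoidal structure -/

section Monoidal

variable {E F G H : CStarBimod B}

variable (B) in
/-- The underlying element of `B`. -/
noncomputable def ofUnit : unit B →L[ℂ] B := ContinuousLinearMap.id ℂ B

variable (B) in
/-- An element of `B`, viewed in the bimodule `B`. -/
noncomputable def toUnit : B →L[ℂ] unit B := ContinuousLinearMap.id ℂ B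

theorem ofUnit_toUnit (b : B) : ofUnit B (toUnit B b) = b := rfl

theorem unit_inner (a b : unit B) :
    (unit B).mod.inner a b = star (ofUnit B a) * ofUnit B b := rfl

theorem ofUnit_lmul (a : B) (b : unit B) : ofUnit B ((unit B).lmul a b) = a * ofUnit B b := rfl

theorem ofUnit_rmul (a : B) (b : unit B) :
    ofUnit B ((unit B).mod.rmul a b) = ofUnit B b * a := rfl

theorem Hom.map_rmul (f : Hom E F) (b : B) (x : E) :
    f (E.mod.rmul b x) = F.mod.rmul b (f x) :=
  ext_inner fun z => by
    rw [← f.adj_inner, E.mod.inner_rmul, f.adj_inner, F.mod.inner_rmul]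

/-- The tensor product is balanced over `B`. -/
theorem tmul_balanced (ξ : E) (η : F) (b : B) :
    tmul E F ξ (F.lmul b η) = tmul E F (E.mod.rmul b ξ) η := by
  rw [← sub_eq_zero, ← norm_eq_zero, ← sq_eq_zero_iff, (tensor E F).norm_sq, norm_eq_zero]
  simp only [map_sub, LinearMap.sub_apply, tensor_inner, E.mod.inner_rmul, E.mod.rmul_inner,
    F.inner_lmul, map_mul, Module.End.mul_apply]
  abel

/-- Bounded bilinear maps that are compatible with the inner products extend to the internal tensor
product. -/
theorem exists_lift (f : E →L[ℂ] F →L[ℂ] H)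
    (hf : ∀ ξ ξ' η η', H.mod.inner (f ξ η) (f ξ' η') =
      F.mod.inner η (F.lmul (E.mod.inner ξ ξ') η')) :
    ∃ g : tensor E F →L[ℂ] H, (∀ ξ η, g (tmul E F ξ η) = f ξ η) ∧
      ∀ x y, H.mod.inner (g x) (g y) = (tensor E F).mod.inner x y := by
  let f₀ : E ⊗[ℂ] F →ₗ[ℂ] H := TensorProduct.lift f.toLinearMap₁₂
  have hf₀ : ∀ ξ η, f₀ (ξ ⊗ₜ η) = f ξ η := fun ξ η => rfl
  have hinner : ∀ x y, H.mod.inner (f₀ x) (f₀ y) = (preTensor E F).inner x y := by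
    intro x y
    induction x using TensorProduct.induction_on with
    | zero => simp
    | add x x' hx hx' => simp [hx, hx']
    | tmul ξ η =>
      induction y using TensorProduct.induction_on with
      | zero => simp
      | add y y' hy hy' => simp [hy, hy']
      | tmul ξ' η' => rw [hf₀, hf₀, hf, preTensor_inner]
  have hnorm : ∀ x, ‖f₀ x‖ ≤ 1 * ‖(preTensor E F).toCompletion x‖ := fun x => by
    refine le_of_sq_le_sq ?_ (by positivity)
    rw [one_mul, H.norm_sq, hinner, PreHilbertModule.norm_toCompletion_sq]
  let g : tensor E F →L[ℂ] H := f₀.extendOfNorm (preTensor E F).toCompletion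
  have hg : ∀ x, g ((preTensor E F).toCompletion x) = f₀ x :=
    LinearMap.extendOfNorm_eq (preTensor E F).denseRange_toCompletion ⟨1, hnorm⟩
  refine ⟨g, fun ξ η => hg _, fun x y => ?_⟩
  refine (preTensor E F).denseRange_toCompletion.induction_on₂
    (p := fun x y => H.mod.inner (g x) (g y) = (tensor E F).mod.inner x y)
    (isClosed_eq (H.continuous_inner.comp
      ((g.continuous.comp continuous_fst).prodMk (g.continuous.comp continuous_snd)))
      (tensor E F).continuous_inner) (fun x y => ?_) x y
  rw [hg, hg, hinner]
  exact ((preTensor E F).completion_inner x y).symm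

theorem exists_extend (Φ : E ⊗[ℂ] F →ₗ[ℂ] (G →L[ℂ] H))
    (hΦ : ∀ x y ζ ζ', H.mod.inner (Φ x ζ) (Φ y ζ') =
      G.mod.inner ζ (G.lmul ((preTensor E F).inner x y) ζ')) :
    ∃ f : tensor E F →L[ℂ] G →L[ℂ] H, (∀ ξ η, f (tmul E F ξ η) = Φ (ξ ⊗ₜ η)) ∧
      ∀ x y ζ ζ', H.mod.inner (f x ζ) (f y ζ') =
        G.mod.inner ζ (G.lmul ((tensor E F).mod.inner x y) ζ') := by
  have hnorm : ∀ x, ‖Φ x‖ ≤ 1 * ‖(preTensor E F).toCompletion x‖ := fun x => by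
    refine ContinuousLinearMap.opNorm_le_bound _ (by positivity) fun ζ => ?_
    refine le_of_sq_le_sq ?_ (by positivity)
    rw [one_mul, H.norm_sq, hΦ, mul_pow, PreHilbertModule.norm_toCompletion_sq]
    calc _ ≤ ‖ζ‖ * (‖(preTensor E F).inner x x‖ * ‖ζ‖) :=
          (G.norm_inner_le _ _).trans (by gcongr; exact G.norm_lmul_le _ _)
      _ = _ := by ring
  let f : tensor E F →L[ℂ] G →L[ℂ] H := Φ.extendOfNorm (preTensor E F).toCompletion
  have hf : ∀ x, f ((preTensor E F).toCompletion x) = Φ x :=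
    LinearMap.extendOfNorm_eq (preTensor E F).denseRange_toCompletion ⟨1, hnorm⟩
  refine ⟨f, fun ξ η => hf _, fun x y ζ ζ' => ?_⟩
  have hc : ∀ ζ : G, Continuous fun x => f x ζ := fun ζ => f.continuous.clm_apply continuous_const
  refine (preTensor E F).denseRange_toCompletion.induction_on₂
    (p := fun x y => H.mod.inner (f x ζ) (f y ζ') =
      G.mod.inner ζ (G.lmul ((tensor E F).mod.inner x y) ζ'))
    (isClosed_eq (H.continuous_inner.comp
      (((hc ζ).comp continuous_fst).prodMk ((hc ζ').comp continuous_snd)))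
      (((G.innerL ζ).comp (G.rket ζ')).continuous.comp (tensor E F).continuous_inner))
    (fun x y => ?_) x y
  rw [hf, hf, hΦ]
  exact congrArg (fun b => G.mod.inner ζ (G.lmul b ζ'))
    ((preTensor E F).completion_inner x y).symm

theorem clm_ext₃ {V : Type*} [NormedAddCommGroup V] [NormedSpace ℂ V]
    {f g : tensor (tensor E F) G →L[ℂ] V}
    (h : ∀ ξ η ζ, f (tmul _ G (tmul E F ξ η) ζ) = g (tmul _ G (tmul E F ξ η) ζ)) : f = g :=
  tensor_ext fun x ζ => by
    have : f.comp ((tmul (tensor E F) G).flip ζ) = g.comp ((tmul (tensor E F) G).flip ζ) :=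
      tensor_ext fun ξ η => h ξ η ζ
    exact DFunLike.congr_fun this x

theorem hom_ext₂ {f g : tensor E F ⟶ G}
    (h : ∀ ξ η, Hom.toCLM f (tmul E F ξ η) = Hom.toCLM g (tmul E F ξ η)) : f = g :=
  hom_ext fun x => DFunLike.congr_fun (tensor_ext (f := Hom.toCLM f) (g := Hom.toCLM g) h) x

theorem hom_ext₃ {f g : tensor (tensor E F) G ⟶ H}
    (h : ∀ ξ η ζ, Hom.toCLM f (tmul _ G (tmul E F ξ η) ζ) =
      Hom.toCLM g (tmul _ G (tmul E F ξ η) ζ)) : f = g :=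
  hom_ext fun x => DFunLike.congr_fun (clm_ext₃ (f := Hom.toCLM f) (g := Hom.toCLM g) h) x

theorem hom_ext₄ {K : CStarBimod B} {f g : tensor (tensor (tensor E F) G) H ⟶ K}
    (h : ∀ ξ η ζ ω, Hom.toCLM f (tmul _ H (tmul _ G (tmul E F ξ η) ζ) ω) =
      Hom.toCLM g (tmul _ H (tmul _ G (tmul E F ξ η) ζ) ω)) : f = g :=
  hom_ext₂ fun x ω => by
    have : (Hom.toCLM f).comp ((tmul (tensor (tensor E F) G) H).flip ω) =
        (Hom.toCLM g).comp ((tmul (tensor (tensor E F) G) H).flip ω) :=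
      clm_ext₃ fun ξ η ζ => h ξ η ζ ω
    exact DFunLike.congr_fun this x

theorem denseRange_of_mem {V W : Type*} [NormedAddCommGroup V] [NormedSpace ℂ V]
    [NormedAddCommGroup W] [NormedSpace ℂ W] (g : V →L[ℂ] W)
    (h : ∀ U : Submodule ℂ W, IsClosed (U : Set W) → (∀ x, g x ∈ U) → ∀ y, y ∈ U) :
    DenseRange g := fun y => by
  have := h g.range.topologicalClosure (Submodule.isClosed_topologicalClosure _)
    (fun x => Submodule.le_topologicalClosure _ ⟨x, rfl⟩) y
  exact this

variable (E F G) in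
theorem exists_associator : ∃ α : tensor (tensor E F) G ≅ tensor E (tensor F G),
    ∀ ξ η ζ, Hom.toCLM α.hom (tmul (tensor E F) G (tmul E F ξ η) ζ) =
      tmul E (tensor F G) ξ (tmul F G η ζ) := by
  let Φ : E ⊗[ℂ] F →ₗ[ℂ] (G →L[ℂ] tensor E (tensor F G)) := TensorProduct.lift
    (LinearMap.mk₂ ℂ (fun ξ η => (tmul E (tensor F G) ξ).comp (tmul F G η))
      (fun x y z => by ext; simp) (fun c x y => by ext; simp)
      (fun x y z => by ext; simp) (fun c x y => by ext; simp))
  have hΦ₀ : ∀ ξ η ζ, Φ (ξ ⊗ₜ η) ζ = tmul E (tensor F G) ξ (tmul F G η ζ) := fun ξ η ζ => rfl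
  obtain ⟨f, hf, hf'⟩ := exists_extend Φ fun x y ζ ζ' => by
    induction x using TensorProduct.induction_on with
    | zero => simp
    | add x x' hx hx' => simp [hx, hx']
    | tmul ξ η =>
      induction y using TensorProduct.induction_on with
      | zero => simp
      | add y y' hy hy' => simp [hy, hy']
      | tmul ξ' η' =>
        rw [hΦ₀, hΦ₀, tensor_inner, tensor_lmul, tensor_inner, preTensor_inner]
  obtain ⟨g, hg, hg'⟩ := exists_lift f fun x y ζ ζ' => hf' x y ζ ζ'
  have hgt : ∀ ξ η ζ, g (tmul (tensor E F) G (tmul E F ξ η) ζ) =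
      tmul E (tensor F G) ξ (tmul F G η ζ) := fun ξ η ζ => by rw [hg, hf, hΦ₀]
  obtain ⟨i, hi⟩ := exists_iso g hg' (denseRange_of_mem g fun U hU h x => by
      refine tensor_mem hU (fun ξ y => ?_) x
      refine tensor_mem (U := U.comap (tmul E (tensor F G) ξ).toLinearMap)
        (hU.preimage (tmul E (tensor F G) ξ).continuous) (fun η ζ => ?_) y
      have := h (tmul (tensor E F) G (tmul E F ξ η) ζ)
      rwa [hgt] at this) (fun b x => by
      have : g.comp ((tensor (tensor E F) G).lmulL b) =
          ((tensor E (tensor F G)).lmulL b).comp g := clm_ext₃ fun ξ η ζ => by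
        rw [ContinuousLinearMap.comp_apply, ContinuousLinearMap.comp_apply, lmulL_apply,
          lmulL_apply, tensor_lmul, tensor_lmul, hgt, hgt, tensor_lmul]
      exact DFunLike.congr_fun this x)
  exact ⟨i, fun ξ η ζ => (hi _).trans (hgt ξ η ζ)⟩

variable (E) in
theorem exists_leftUnitor : ∃ l : tensor (unit B) E ≅ E,
    ∀ (b : unit B) (ξ : E), Hom.toCLM l.hom (tmul (unit B) E b ξ) = E.lmul (ofUnit B b) ξ := by
  let f₀ : B →L[ℂ] E →L[ℂ] E := LinearMap.mkContinuous₂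
    (LinearMap.mk₂ ℂ (fun b ξ => E.lmul b ξ) (by simp) (by simp) (by simp) (by simp)) 1
    (fun b ξ => by rw [one_mul]; exact E.norm_lmul_le b ξ)
  let f : unit B →L[ℂ] E →L[ℂ] E := f₀.comp (ofUnit B)
  have hf : ∀ (b : unit B) ξ, f b ξ = E.lmul (ofUnit B b) ξ := fun b ξ => rfl
  obtain ⟨g, hg, hg'⟩ := exists_lift (E := unit B) f fun a b ξ ξ' => by
    rw [hf, hf, E.inner_lmul, ← Module.End.mul_apply, ← map_mul, unit_inner]
  have hgt : ∀ (b : unit B) ξ, g (tmul (unit B) E b ξ) = E.lmul (ofUnit B b) ξ := fun b ξ => hg b ξ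
  obtain ⟨i, hi⟩ := exists_iso g hg' (denseRange_of_mem g fun U hU h x =>
      map_mem_of_dense E.nondegenerate (.id ℂ E) hU (by
        rintro _ ⟨b, y, rfl⟩
        have h1 : E.lmul b y ∈ U := hgt (toUnit B b) y ▸ h (tmul (unit B) E (toUnit B b) y)
        exact h1) x) (fun b x => by
      have : g.comp ((tensor (unit B) E).lmulL b) = (E.lmulL b).comp g :=
        tensor_ext fun a ξ => by
          rw [ContinuousLinearMap.comp_apply, ContinuousLinearMap.comp_apply, lmulL_apply,
            lmulL_apply, tensor_lmul, hgt, hgt, ofUnit_lmul, map_mul, Module.End.mul_apply]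
      exact DFunLike.congr_fun this x)
  exact ⟨i, fun b ξ => (hi _).trans (hg b ξ)⟩

theorem mem_of_rmul_mem {U : Submodule ℂ E} (hU : IsClosed (U : Set E))
    (h : ∀ b ξ, E.mod.rmul b ξ ∈ U) (ξ : E) : ξ ∈ U := by
  have hl := CStarAlgebra.increasingApproximateUnit B
  set l := CStarAlgebra.approximateUnit B
  have := hl.neBot
  refine hU.mem_of_tendsto (b := l) (f := fun u => E.mod.rmul u ξ) ?_
    (Filter.Eventually.of_forall fun u => h u ξ)
  set a := E.mod.inner ξ ξ with ha
  rw [tendsto_iff_norm_sub_tendsto_zero]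
  have h1 : Filter.Tendsto (fun u => √(2 * ‖a * u - a‖)) l (nhds 0) := by
    have h2 : Filter.Tendsto (fun u => ‖a * u - a‖) l (nhds 0) :=
      tendsto_iff_norm_sub_tendsto_zero.mp (hl.tendsto_mul_left a)
    have h3 := (h2.const_mul 2).sqrt
    rwa [mul_zero, Real.sqrt_zero] at h3
  refine squeeze_zero' (Filter.Eventually.of_forall fun u => norm_nonneg _) ?_ h1
  filter_upwards [hl.eventually_norm] with u hu
  refine Real.le_sqrt_of_sq_le ?_
  rw [E.norm_sq]
  have : E.mod.inner (E.mod.rmul u ξ - ξ) (E.mod.rmul u ξ - ξ) =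
      star u * (a * u - a) - (a * u - a) := by
    simp only [map_sub, LinearMap.sub_apply, E.mod.inner_rmul, E.mod.rmul_inner, ← ha, mul_sub,
      mul_assoc]
    abel
  rw [this]
  calc _ ≤ ‖star u‖ * ‖a * u - a‖ + ‖a * u - a‖ :=
        (norm_sub_le _ _).trans (by gcongr; exact norm_mul_le _ _)
    _ ≤ 1 * ‖a * u - a‖ + ‖a * u - a‖ := by rw [norm_star]; gcongr
    _ = _ := by ring

variable (E) in
theorem exists_rightUnitor : ∃ r : tensor E (unit B) ≅ E,
    ∀ (ξ : E) (b : unit B), Hom.toCLM r.hom (tmul E (unit B) ξ b) = E.mod.rmul (ofUnit B b) ξ := by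
  let f₀ : E →L[ℂ] B →L[ℂ] E := LinearMap.mkContinuous₂ E.mod.rmul.flip 1
    (fun ξ b => by rw [one_mul]; exact E.norm_rmul_le b ξ)
  let f : E →L[ℂ] unit B →L[ℂ] E := (f₀.flip.comp (ofUnit B)).flip
  have hf : ∀ ξ (b : unit B), f ξ b = E.mod.rmul (ofUnit B b) ξ := fun b ξ => rfl
  obtain ⟨g, hg, hg'⟩ := exists_lift (F := unit B) f fun ξ ξ' a b => by
    rw [hf, hf, E.mod.inner_rmul, E.mod.rmul_inner, unit_inner, ofUnit_lmul, mul_assoc]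
  have hgt : ∀ ξ (b : unit B), g (tmul E (unit B) ξ b) = E.mod.rmul (ofUnit B b) ξ :=
    fun ξ b => hg ξ b
  obtain ⟨i, hi⟩ := exists_iso g hg' (denseRange_of_mem g fun U hU h x =>
      mem_of_rmul_mem hU (fun b ξ => by
        have h1 : E.mod.rmul b ξ ∈ U := hgt ξ (toUnit B b) ▸ h (tmul E (unit B) ξ (toUnit B b))
        exact h1) x) (fun b x => by
      have : g.comp ((tensor E (unit B)).lmulL b) = (E.lmulL b).comp g :=
        tensor_ext fun ξ a => by
          rw [ContinuousLinearMap.comp_apply, ContinuousLinearMap.comp_apply, lmulL_apply,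
            lmulL_apply, tensor_lmul, hgt, hgt, E.rmul_lmul]
      exact DFunLike.congr_fun this x)
  exact ⟨i, fun b ξ => (hi _).trans (hg b ξ)⟩

variable (E F G) in
/-- The isomorphism `(ξ ⊗ η) ⊗ ζ ↦ ξ ⊗ (η ⊗ ζ)`. -/
noncomputable def associator : tensor (tensor E F) G ≅ tensor E (tensor F G) :=
  (exists_associator E F G).choose

theorem associator_tmul (ξ : E) (η : F) (ζ : G) :
    Hom.toCLM (associator E F G).hom (tmul (tensor E F) G (tmul E F ξ η) ζ) =
      tmul E (tensor F G) ξ (tmul F G η ζ) :=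
  (exists_associator E F G).choose_spec ξ η ζ

variable (E) in
/-- The isomorphism `b ⊗ ξ ↦ b ξ`. -/
noncomputable def leftUnitor : tensor (unit B) E ≅ E := (exists_leftUnitor E).choose

theorem leftUnitor_tmul (b : unit B) (ξ : E) :
    Hom.toCLM (leftUnitor E).hom (tmul (unit B) E b ξ) = E.lmul (ofUnit B b) ξ :=
  (exists_leftUnitor E).choose_spec b ξ

variable (E) in
/-- The isomorphism `ξ ⊗ b ↦ ξ b`. -/
noncomputable def rightUnitor : tensor E (unit B) ≅ E := (exists_rightUnitor E).choose

theorem rightUnitor_tmul (ξ : E) (b : unit B) :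
    Hom.toCLM (rightUnitor E).hom (tmul E (unit B) ξ b) = E.mod.rmul (ofUnit B b) ξ :=
  (exists_rightUnitor E).choose_spec ξ b

/-- The tensor product `S ⊗ T` as a morphism of the category. -/
noncomputable def tensorHom' {E E' F F' : CStarBimod B} (S : E ⟶ E') (T : F ⟶ F') :
    tensor E F ⟶ tensor E' F' := tensorMap S T

theorem tensorHom'_tmul {E E' F F' : CStarBimod B} (S : E ⟶ E') (T : F ⟶ F') (ξ : E) (η : F) :
    Hom.toCLM (tensorHom' S T) (tmul E F ξ η) = tmul E' F' (Hom.toCLM S ξ) (Hom.toCLM T η) :=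
  tensorMap_tmul S T ξ η

/-- The monoidal category of bimodules with the internal tensor product and the unit `B`. -/
noncomputable instance : MonoidalCategory (CStarBimod B) where
  tensorObj := tensor
  whiskerLeft E _ _ T := tensorHom' (𝟙 E) T
  whiskerRight S F := tensorHom' S (𝟙 F)
  tensorHom S T := tensorHom' S T
  tensorUnit := unit B
  associator := associator
  leftUnitor := leftUnitor
  rightUnitor := rightUnitor
  tensorHom_def S T := hom_ext₂ fun ξ η => by
    simp only [comp_apply, tensorHom'_tmul, id_apply]
  id_tensorHom_id E F := hom_ext₂ fun ξ η => by
    simp only [tensorHom'_tmul, id_apply]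
  tensorHom_comp_tensorHom S T S' T' := hom_ext₂ fun ξ η => by
    simp only [comp_apply, tensorHom'_tmul]
  whiskerLeft_id E F := hom_ext₂ fun ξ η => by
    simp only [tensorHom'_tmul, id_apply]
  id_whiskerRight E F := hom_ext₂ fun ξ η => by
    simp only [tensorHom'_tmul, id_apply]
  associator_naturality R S T := hom_ext₃ fun ξ η ζ => by
    simp only [comp_apply, tensorHom'_tmul, associator_tmul]
  leftUnitor_naturality S := hom_ext₂ fun b ξ => by
    rw [comp_apply, comp_apply, tensorHom'_tmul, leftUnitor_tmul, id_apply, leftUnitor_tmul]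
    exact (Hom.map_lmul S _ ξ).symm
  rightUnitor_naturality S := hom_ext₂ fun ξ b => by
    rw [comp_apply, comp_apply, tensorHom'_tmul, rightUnitor_tmul, id_apply, rightUnitor_tmul]
    exact (Hom.map_rmul S _ ξ).symm
  pentagon E F G H := hom_ext₄ fun ξ η ζ ω => by
    simp only [comp_apply, tensorHom'_tmul, associator_tmul, id_apply]
  triangle E F := hom_ext₃ fun ξ b η => by
    rw [comp_apply, tensorHom'_tmul, associator_tmul, tensorHom'_tmul, id_apply, id_apply]
    rw [leftUnitor_tmul, rightUnitor_tmul]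
    exact tmul_balanced ξ η _

end Monoidal

end CStarBimod

/-! ### Partial automorphisms -/

/-- A closed two-sided ideal of `B`. -/
def IsClosedIdeal (I : Set B) : Prop :=
  IsClosed I ∧ ∃ J : TwoSidedIdeal B, {b | b ∈ J} = I

/-- The domain of a partial bijection. -/
def pdom (θ : B ≃. B) : Set B := {b | ∃ b', b' ∈ θ b}

/-- A partial automorphism: a ⋆-isomorphism between two closed ideals of `B`, encoded as a partial
bijection `θ` of `B`; here `b' ∈ θ b` means that `b` is in the domain of `θ` and that `θ b` is `b'`.
The adjoint of `θ` is its inverse `θ.symm`, and `θ ≤ θ'` means that `θ'` extends `θ`. -/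
structure IsPartialAut (θ : B ≃. B) : Prop where
  isClosedIdeal_dom : IsClosedIdeal (pdom θ)
  isClosedIdeal_img : IsClosedIdeal (pdom θ.symm)
  map_add : ∀ a a' b b', a' ∈ θ a → b' ∈ θ b → a' + b' ∈ θ (a + b)
  map_smul : ∀ (c : ℂ) a a', a' ∈ θ a → c • a' ∈ θ (c • a)
  map_mul : ∀ a a' b b', a' ∈ θ a → b' ∈ θ b → a' * b' ∈ θ (a * b)
  map_star : ∀ a a', a' ∈ θ a → star a' ∈ θ (star a)

/-- The composition `θ θ'`: first `θ'`, then `θ`. -/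
def pcomp (θ θ' : B ≃. B) : B ≃. B := θ'.trans θ

/-- An inverse semigroup of partial automorphisms. -/
structure IsInverseSemigroup (Θ : Set (B ≃. B)) : Prop where
  isPartialAut : ∀ θ ∈ Θ, IsPartialAut θ
  comp_mem : ∀ θ ∈ Θ, ∀ θ' ∈ Θ, pcomp θ θ' ∈ Θ
  symm_mem : ∀ θ ∈ Θ, θ.symm ∈ Θ

/-- `τ` is the largest partial automorphism that is extended by `θ` and by `θ'`. -/
def IsMeet (θ θ' τ : B ≃. B) : Prop :=
  IsGreatest {κ | IsPartialAut κ ∧ κ ≤ θ ∧ κ ≤ θ'} τ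

/-- The closed linear span of a set. -/
def clspan {V : Type*} [NormedAddCommGroup V] [NormedSpace ℂ V] (s : Set V) : Set V :=
  closure (Submodule.span ℂ s : Set V)

namespace CStarBimod

/-! ### Homogeneous elements -/

/-- The space `E_θ` of `θ`-homogeneous elements of `E`: all `ξ` in `E Dom(θ)` such that
`ξ b = θ(b) ξ` for all `b` in `Dom(θ)`. -/
def homog (E : CStarBimod B) (θ : B ≃. B) : Set E :=
  {ξ | (∃ η : E, ∃ b ∈ pdom θ, ξ = E.mod.rmul b η) ∧
    ∀ b b', b' ∈ θ b → E.mod.rmul b ξ = E.lmul b' ξ}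

/-- `E` is decomposable: the homogeneous elements are linearly dense. -/
def IsDecomposable (E : CStarBimod B) : Prop :=
  clspan {ξ : E | ∃ θ, IsPartialAut θ ∧ ξ ∈ E.homog θ} = Set.univ

/-- `E` is `Θ`-decomposable. -/
def IsDecomposableFor (Θ : Set (B ≃. B)) (E : CStarBimod B) : Prop :=
  clspan {ξ : E | ∃ θ ∈ Θ, ξ ∈ E.homog θ} = Set.univ

/-- `E` is `Θ`-supported. -/
def IsSupportedFor (Θ : Set (B ≃. B)) (E : CStarBimod B) : Prop :=
  ∀ θ, IsPartialAut θ → E.homog θ = clspan {ξ : E | ∃ θ' ∈ Θ, θ' ≤ θ ∧ ξ ∈ E.homog θ'}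

/-! ### Families of operators -/

/-- `S` is the adjoint of `T` with respect to `σ`: for all `ξ` and `η`, the element `⟨Sη|ξ⟩` is in
the domain of `σ`, and `⟨η|Tξ⟩ = σ(⟨Sη|ξ⟩)`. -/
def IsAdjoint {E F : CStarBimod B} (σ : B ≃. B) (T : E →L[ℂ] F) (S : F →L[ℂ] E) : Prop :=
  ∀ ξ η, F.mod.inner η (T ξ) ∈ σ (E.mod.inner (S η) ξ)

/-- Families `C = (C^ρ_σ)` of sets of operators from `E` to `F`, indexed by pairs of partial
automorphisms; `C ρ σ` is `C^ρ_σ`. Only indices that are partial automorphisms matter. -/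
def Fam (E F : CStarBimod B) : Type u := (ρ σ : B ≃. B) → Set (E →L[ℂ] F)

namespace Fam

variable {E F G : CStarBimod B}

/-- Equality of families. -/
def Eqv (C D : Fam E F) : Prop :=
  ∀ ρ σ, IsPartialAut ρ → IsPartialAut σ → C ρ σ = D ρ σ

/-- The family `C⋆`: its component at `(ρ,σ)` consists of the adjoints of the operators in the
component of `C` at `(ρ⋆,σ⋆)`. -/
def adjoint (C : Fam E F) : Fam F E := fun ρ σ =>
  {S | ∃ T ∈ C ρ.symm σ.symm, IsAdjoint σ.symm T S}

/-- The product family `[D C]`. -/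
def prod (D : Fam F G) (C : Fam E F) : Fam E G := fun ρ'' σ'' =>
  clspan {R | ∃ ρ ρ' σ σ', IsPartialAut ρ ∧ IsPartialAut ρ' ∧ IsPartialAut σ ∧ IsPartialAut σ' ∧
    pcomp ρ' ρ ≤ ρ'' ∧ pcomp σ' σ ≤ σ'' ∧
    ∃ T' ∈ D ρ' σ', ∃ T ∈ C ρ σ, R = T'.comp T}

end Fam

/-- The operator `l(ξ) : B → E`, `b ↦ ξ b`. -/
noncomputable def lOp (E : CStarBimod B) (ξ : E) : unit B →L[ℂ] E := (E.lket ξ).comp (ofUnit B)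

/-- The operator `r(ξ) : B → E`, `b ↦ b ξ`. -/
noncomputable def rOp (E : CStarBimod B) (ξ : E) : unit B →L[ℂ] E := (E.rket ξ).comp (ofUnit B)

open Classical in
/-- The family `l(E)`, with component `l(E_θ)` at `(θ,Id)` and `0` at `(θ,σ)` for `σ ≠ Id`. -/
noncomputable def famL (E : CStarBimod B) : Fam (unit B) E := fun θ σ =>
  if σ = PEquiv.refl B then E.lOp '' E.homog θ else {0}

open Classical in
/-- The family `r(E)`, with component `r(E_θ⋆)` at `(Id,θ)` and `0` at `(ρ,θ)` for `ρ ≠ Id`. -/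
noncomputable def famR (E : CStarBimod B) : Fam (unit B) E := fun ρ θ =>
  if ρ = PEquiv.refl B then E.rOp '' E.homog θ.symm else {0}

open Classical in
/-- The family of the operators `|ξ⟩₁ : F → E ⊗ F`, `η' ↦ ξ ⊗ η'`, with component `|E_θ⟩₁` at
`(θ,Id)` and `0` at `(θ,σ)` for `σ ≠ Id`. -/
noncomputable def famKet (E F : CStarBimod B) : Fam F (tensor E F) := fun θ σ =>
  if σ = PEquiv.refl B then (fun ξ => tmul E F ξ) '' E.homog θ else {0}

open Classical in
/-- The family of the operators `|η]₂ : E → E ⊗ F`, `ξ' ↦ ξ' ⊗ η`, with component `|F_θ⋆]₂` at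
`(Id,θ)` and `0` at `(ρ,θ)` for `ρ ≠ Id`. -/
noncomputable def famKet' (E F : CStarBimod B) : Fam E (tensor E F) := fun ρ θ =>
  if ρ = PEquiv.refl B then (fun η => (tmul E F).flip η) '' F.homog θ.symm else {0}

/-! ### Admissibility -/

/-- An inverse semigroup `Θ` of partial automorphisms is admissible if `B` is `Θ`-supported, `Θ`
contains the identity, and `Θ` is closed under meets. -/
structure IsAdmissibleSemigroup (Θ : Set (B ≃. B)) : Prop where
  isInverseSemigroup : IsInverseSemigroup Θ
  supported : IsSupportedFor Θ (unit B)
  refl_mem : PEquiv.refl B ∈ Θ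
  meet_mem : ∀ θ ∈ Θ, ∀ θ' ∈ Θ, ∃ τ ∈ Θ, IsMeet θ θ' τ

/-- `E` is `Θ`-admissible: it is `Θ`-decomposable, and `[l(E)⋆ l(E)] = l(B)` and
`[r(E)⋆ r(E)] = r(B)`. -/
structure IsAdmissible (Θ : Set (B ≃. B)) (E : CStarBimod B) : Prop where
  decomposable : IsDecomposableFor Θ E
  left : (E.famL.adjoint.prod E.famL).Eqv (unit B).famL
  right : (E.famR.adjoint.prod E.famR).Eqv (unit B).famR

/-- The `Θ`-admissible bimodules, as a property of objects of the category of bimodules. -/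
def admissible (Θ : Set (B ≃. B)) : ObjectProperty (CStarBimod B) := fun E => IsAdmissible Θ E

end CStarBimod

end Defs

/-!
The theorem rests on two facts about the spaces `E_θ` of homogeneous elements.

*Cube roots* (`exists_homog_cube_root`). Every `ξ ∈ E_θ` has the form `ξ = ζ ⟨ζ|ζ⟩` with `ζ ∈ E_θ`,
and `⟨ζ|ζ⟩` is central in `B`. Functional calculus gives such a `ζ` as a limit of elements `ξ b`,
with `b` in the closed ⋆-subalgebra generated by `⟨ξ|ξ⟩`. That subalgebra consists of elements of
`Dom(θ)` that commute with `Dom(θ)`, so that it preserves `E_θ`. In particular, a homogeneous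
element absorbs central elements of `B` on either side (`exists_central_factor`).

*Homogeneous decomposition of `E ⊗ F`* (`mem_clspan_tmul_bra`). Let `E` be `Θ`-decomposable. The
operators `|ξ⟩⟨ξ'| ⊗ 1` on `E ⊗ F` with `ξ, ξ' ∈ E_ρ` and `ρ ∈ Θ` are closed under products and
adjoints, and they act nondegenerately by the existence of cube roots. Hence an approximate unit of
the C⋆-algebra they generate shows that each `x` is in the closed linear span of the elements
`ξ ⊗ ⟨ξ'|x⟩` (`mem_clspan_of_nondegenerate`). If `x` is `θ`-homogeneous, then `⟨ξ'|x⟩ ∈ F_{ρ⋆θ}`.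
For `F = B`, and `B` being `Θ`-supported, this proves that a `Θ`-decomposable bimodule is
`Θ`-supported (`IsDecomposableFor.isSupportedFor`). Then, for a `Θ`-supported `F`, it yields the
description of `(E ⊗ F)_θ` by elementary tensors (`homog_tensor`).

The families `l(E)`, `r(E)`, `|E⟩₁` and `|F]₂` are supported on the indices `(θ, Id)` or `(Id, θ)`,
where products of families reduce to closed linear spans of products. As `ξ ↦ l(ξ)` and `ξ ↦ r(ξ)`
are isometric, the latter by nondegeneracy of the left action, identities between such families are
identities between subspaces of bimodules. In this way `l(E ⊗ F) = [|E⟩₁ l(F)]` and `r(E ⊗ F) =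
[|F]₂ r(E)]` follow from the description of `(E ⊗ F)_θ`. The conditions `[l(E)⋆ l(E)] = l(B)` and
`[r(E)⋆ r(E)] = r(B)` say that `B_θ` is the closed linear span of the elements `⟨ξ|η⟩` with `ξ ∈
E_σ`, `η ∈ E_τ` and `σ⋆τ ≤ θ` (`left_eqv_iff`) and of the elements `σ(⟨ξ|η⟩)` with `τσ⋆ ≤ θ`
(`right_eqv_iff`), respectively.

Both conditions pass to `E ⊗ F`. As `⟨ξ ⊗ η|ξ' ⊗ η'⟩ = ⟨η|⟨ξ|ξ'⟩ η'⟩`, it suffices to write `η'` as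
`c ζ` with central `c` and to approximate `c` by inner products in `E` (`left_tensor`), and
symmetrically for `r` (`right_tensor`). For `E = B` both conditions follow from the factorization of
homogeneous elements of `B`, and decomposability with respect to `Θ` follows from decomposability
as `B` is `Θ`-supported (`isAdmissible_unit`).
-/

/-! ### Cube roots in Hilbert modules -/

section

variable {B : Type u} [NonUnitalCStarAlgebra B] [PartialOrder B] [StarOrderedRing B]

/-- In the closed ⋆-subalgebra generated by a positive element `h` there are a sixth root `p` of `h`
and a sequence that approximates the (usually non-existent) element `p ^ (-2)`. -/
theorem exists_sixth_root {S : NonUnitalStarSubalgebra ℂ B} (hS : IsClosed (S : Set B)) {h : B}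
    (hh : 0 ≤ h) (hhS : h ∈ S) :
    ∃ p ∈ S, star p = p ∧ p * p * (p * p) * (p * p) = h ∧ ∃ c : ℕ → B,
      (∀ n, c n ∈ S ∧ star (c n) = c n) ∧
      Filter.Tendsto (fun n => p * p * p * c n) Filter.atTop (nhds p) := by
  have : IsClosed (S : Set B) := hS
  set q : B := h ^ ((3 : NNReal)⁻¹) with hq
  have hq0 : 0 ≤ q := CFC.nnrpow_nonneg
  set p : B := q ^ ((2 : NNReal)⁻¹) with hp
  have hp0 : 0 ≤ p := CFC.nnrpow_nonneg
  have hqS : q ∈ S := by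
    rw [hq, CFC.nnrpow_eq_cfcₙ_real _ _ hh]
    exact cfcₙ_mem (𝕜' := ℂ) _ hhS
  have hpS : p ∈ S := by
    rw [hp, CFC.nnrpow_eq_cfcₙ_real _ _ hq0]
    exact cfcₙ_mem (𝕜' := ℂ) _ hqS
  have hps : IsSelfAdjoint p := hp0.isSelfAdjoint
  have hpp : p * p = q := by
    rw [← CFC.nnrpow_two p hp0, hp, CFC.nnrpow_inv_nnrpow _ two_ne_zero hq0]
  have hqqq : q * q * q = h := by
    rw [← CFC.nnrpow_three q hq0, hq, CFC.nnrpow_inv_nnrpow _ three_ne_zero hh]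
  -- continuous functions vanishing at `0` with `|t ^ 3 * f n t - t| ≤ 1 / (n + 1)`
  let f : ℕ → ℝ → ℝ := fun n t => t ^ 2 / (t ^ 4 + (1 / ((n : ℝ) + 1)) ^ 4)
  have hden : ∀ (n : ℕ) (t : ℝ), 0 < t ^ 4 + (1 / ((n : ℝ) + 1)) ^ 4 := fun n t => by positivity
  have hf : ∀ n, Continuous (f n) := fun n =>
    (continuous_pow 2).div (by fun_prop) fun t => (hden n t).ne'
  refine ⟨p, hpS, hps, by rw [hpp, hqqq], fun n => cfcₙ (f n) p, fun n =>
    ⟨cfcₙ_mem (𝕜' := ℂ) _ hpS, cfcₙ_predicate (f n) p⟩, ?_⟩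
  rw [tendsto_iff_norm_sub_tendsto_zero]
  refine squeeze_zero (fun n => norm_nonneg _) (fun n => ?_)
    tendsto_one_div_add_atTop_nhds_zero_nat
  have h1 : p * p * p * cfcₙ (f n) p - p = cfcₙ (fun t : ℝ => t * t * t * f n t - t) p := by
    have hc := (hf n).continuousOn (s := quasispectrum ℝ p)
    have hf0 : f n 0 = 0 := by simp [f]
    rw [cfcₙ_sub (fun t : ℝ => t * t * t * f n t) (fun t => t) p
        (((continuousOn_id.mul continuousOn_id).mul continuousOn_id).mul hc) (by simp)
        continuousOn_id rfl,
      cfcₙ_mul (fun t : ℝ => t * t * t) (f n) p (by fun_prop) (by simp) hc hf0,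
      cfcₙ_mul (fun t : ℝ => t * t) (fun t => t) p (by fun_prop) (by simp) (by fun_prop) rfl,
      cfcₙ_mul (fun t : ℝ => t) (fun t => t) p (by fun_prop) rfl (by fun_prop) rfl,
      cfcₙ_id' ℝ p]
  rw [h1]
  refine norm_cfcₙ_le fun t _ => ?_
  set δ : ℝ := 1 / ((n : ℝ) + 1) with hδ
  have hδ0 : 0 < δ := by positivity
  have h2 : t * t * t * f n t - t = -(t * δ ^ 4) / (t ^ 4 + δ ^ 4) := by
    simp only [f]
    rw [← hδ]
    have := (hden n t).ne'
    rw [← hδ] at this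
    field_simp
    ring
  have h3 : |t| * δ ^ 4 ≤ δ * (t ^ 4 + δ ^ 4) := by
    have h4 : t ^ 4 = |t| ^ 4 := (Even.pow_abs (by decide) t).symm
    rw [h4]
    have h0 := abs_nonneg t
    rcases le_total |t| δ with h | h
    · have h5 : |t| * δ ^ 4 ≤ δ * δ ^ 4 := by gcongr
      have h6 : 0 ≤ δ * |t| ^ 4 := by positivity
      linarith
    · have h5 : |t| * δ ^ 4 ≤ δ * |t| ^ 4 := by
        calc |t| * δ ^ 4 = δ * (|t| * δ ^ 3) := by ring
          _ ≤ δ * (|t| * |t| ^ 3) := by gcongr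
          _ = _ := by ring
      have h6 : 0 ≤ δ * δ ^ 4 := by positivity
      linarith
  rw [h2, norm_div, norm_neg, norm_mul, Real.norm_eq_abs, Real.norm_of_nonneg (by positivity),
    Real.norm_of_nonneg (hden n t).le, div_le_iff₀ (hden n t)]
  exact h3

namespace CStarBimod

/-- Every element `ξ` of a Hilbert module is of the form `ζ ⟨ζ|ζ⟩`, where `ζ` is a limit of
elements `ξ c` with `c` in the C⋆-algebra generated by `⟨ξ|ξ⟩`. -/
theorem exists_cube_root (E : CStarBimod B) {S : NonUnitalStarSubalgebra ℂ B}
    (hS : IsClosed (S : Set B)) (ξ : E) (hξ : E.mod.inner ξ ξ ∈ S) :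
    ∃ ζ : E, ξ = E.mod.rmul (E.mod.inner ζ ζ) ζ ∧ E.mod.inner ζ ζ ∈ S ∧
      ζ ∈ closure {x | ∃ c ∈ S, x = E.mod.rmul c ξ} := by
  obtain ⟨p, hpS, hps, hph, c, hc, hlim⟩ :=
    exists_sixth_root hS (E.mod.inner_self_nonneg ξ) hξ
  -- as `⟨ξ|ξ⟩ = p ^ 6`, the map `ξ a ↦ p ^ 3 a` is isometric, and `ξ (c n)` converges because
  -- `p ^ 3 (c n)` does
  have hnorm : ∀ a : B, ‖E.mod.rmul a ξ‖ = ‖p * p * p * a‖ := fun a => by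
    rw [← sq_eq_sq₀ (norm_nonneg _) (norm_nonneg _), E.norm_sq, E.mod.inner_rmul,
      E.mod.rmul_inner, sq, ← CStarRing.norm_star_mul_self, ← hph]
    simp only [star_mul, hps, mul_assoc]
  have hnorm' : ∀ a : B, ‖E.mod.rmul a ξ - ξ‖ = ‖p * p * p * a - p * p * p‖ := fun a => by
    rw [← sq_eq_sq₀ (norm_nonneg _) (norm_nonneg _), E.norm_sq, sq,
      ← CStarRing.norm_star_mul_self]
    simp only [map_sub, LinearMap.sub_apply, E.mod.inner_rmul, E.mod.rmul_inner, ← hph, star_sub,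
      star_mul, hps, mul_assoc, mul_sub, sub_mul]
  have hcauchy : CauchySeq fun n => E.mod.rmul (c n) ξ := by
    have h1 := hlim.cauchySeq
    rw [Metric.cauchySeq_iff] at h1 ⊢
    intro ε hε
    obtain ⟨N, hN⟩ := h1 ε hε
    refine ⟨N, fun m hm n hn => ?_⟩
    have := hN m hm n hn
    rwa [dist_eq_norm, ← LinearMap.sub_apply, ← map_sub, hnorm, mul_sub, ← dist_eq_norm]
  obtain ⟨ζ, hζ⟩ := cauchySeq_tendsto_of_complete hcauchy
  have hin : E.mod.inner ζ ζ = p * p := by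
    have h1 : Filter.Tendsto (fun n => E.mod.inner (E.mod.rmul (c n) ξ) (E.mod.rmul (c n) ξ))
        Filter.atTop (nhds (E.mod.inner ζ ζ)) :=
      (E.continuous_inner.tendsto (ζ, ζ)).comp (hζ.prodMk_nhds hζ)
    have h2 : Filter.Tendsto (fun n => star (p * p * p * c n) * (p * p * p * c n))
        Filter.atTop (nhds (star p * p)) := hlim.star.mul hlim
    rw [hps] at h2
    refine tendsto_nhds_unique h1 (h2.congr fun n => ?_)
    rw [E.mod.inner_rmul, E.mod.rmul_inner, ← hph]
    simp only [star_mul, hps, (hc n).2, mul_assoc]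
  refine ⟨ζ, ?_, ?_, ?_⟩
  · have h1 : Filter.Tendsto (fun n => E.mod.rmul (p * p) (E.mod.rmul (c n) ξ))
        Filter.atTop (nhds (E.mod.rmul (p * p) ζ)) :=
      ((E.mod.rmul (p * p)).mkContinuous ‖p * p‖
        fun x => by rw [mul_comm]; exact E.norm_rmul_le _ x).continuous.tendsto ζ |>.comp hζ
    have h2 : Filter.Tendsto (fun n => E.mod.rmul (p * p) (E.mod.rmul (c n) ξ))
        Filter.atTop (nhds ξ) := by
      rw [tendsto_iff_norm_sub_tendsto_zero]
      have h3 := (tendsto_iff_norm_sub_tendsto_zero.mp (hlim.mul_const (p * p)))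
      refine h3.congr fun n => ?_
      rw [← E.mod.rmul_mul, hnorm']
      simp only [mul_assoc]
    rw [hin]
    exact tendsto_nhds_unique h2 h1
  · rw [hin]; exact mul_mem hpS hpS
  · exact mem_closure_of_tendsto hζ (Filter.Eventually.of_forall fun n => ⟨c n, (hc n).1, rfl⟩)

end CStarBimod

/-- In a closed ⋆-subalgebra every element is a product of two elements. -/
theorem exists_mul_of_mem {S : NonUnitalStarSubalgebra ℂ B} (hS : IsClosed (S : Set B)) {b : B}
    (hb : b ∈ S) : ∃ c ∈ S, ∃ d ∈ S, b = c * d := by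
  -- apply the cube root to `b` as an element of the Hilbert module `B`
  obtain ⟨ζ, h1, h2, h3⟩ := (CStarBimod.unit B).exists_cube_root hS b (mul_mem (star_mem hb) hb)
  refine ⟨ζ, ?_, _, h2, h1⟩
  refine closure_minimal ?_ hS h3
  rintro _ ⟨c, hc, rfl⟩
  exact mul_mem hb hc

end

/-! ### Partial automorphisms -/

section

section PEquiv

variable {B : Type u}

theorem mem_pcomp {θ θ' : B ≃. B} {a c : B} : c ∈ pcomp θ θ' a ↔ ∃ b, b ∈ θ' a ∧ c ∈ θ b :=
  PEquiv.mem_trans _ _ _ _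

theorem mem_pdom {θ : B ≃. B} {b b' : B} (h : b' ∈ θ b) : b ∈ pdom θ := ⟨b', h⟩

theorem pdom_mono {θ θ' : B ≃. B} (h : θ ≤ θ') : pdom θ ⊆ pdom θ' := fun _ ⟨b', hb⟩ =>
  ⟨b', PEquiv.le_def.mp h _ _ hb⟩

theorem pcomp_assoc (θ θ' θ'' : B ≃. B) : pcomp (pcomp θ θ') θ'' = pcomp θ (pcomp θ' θ'') :=
  (PEquiv.trans_assoc _ _ _).symm

theorem pcomp_symm (θ θ' : B ≃. B) : (pcomp θ θ').symm = pcomp θ'.symm θ.symm :=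
  PEquiv.symm_trans_rev _ _

theorem pcomp_mono {θ₁ θ₂ θ₁' θ₂' : B ≃. B} (h : θ₁ ≤ θ₂) (h' : θ₁' ≤ θ₂') :
    pcomp θ₁ θ₁' ≤ pcomp θ₂ θ₂' := by
  rw [PEquiv.le_def] at *
  intro a c hac
  obtain ⟨b, h1, h2⟩ := mem_pcomp.mp hac
  exact mem_pcomp.mpr ⟨b, h' _ _ h1, h _ _ h2⟩

theorem symm_mono {θ θ' : B ≃. B} (h : θ ≤ θ') : θ.symm ≤ θ'.symm := by
  rw [PEquiv.le_def] at *
  exact fun a b hab => (PEquiv.mem_iff_mem _).mpr (h _ _ ((PEquiv.mem_iff_mem _).mp hab))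

@[simp] theorem pcomp_refl (θ : B ≃. B) : pcomp θ (.refl B) = θ := PEquiv.refl_trans θ

@[simp] theorem refl_pcomp (θ : B ≃. B) : pcomp (.refl B) θ = θ := PEquiv.trans_refl θ

theorem symm_pcomp_self_le (θ : B ≃. B) : pcomp θ.symm θ ≤ .refl B := by
  rw [PEquiv.le_def]
  intro a c hac
  obtain ⟨b, h1, h2⟩ := mem_pcomp.mp hac
  have := θ.inj h1 ((PEquiv.mem_iff_mem _).mp h2)
  rw [this]; rfl

theorem self_pcomp_symm_le (θ : B ≃. B) : pcomp θ θ.symm ≤ .refl B := symm_pcomp_self_le θ.symm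

end PEquiv

variable {B : Type u} [NonUnitalCStarAlgebra B]

theorem isClosedIdeal_of_mem {I : Set B} (hI : IsClosed I) (zero : 0 ∈ I)
    (add : ∀ a ∈ I, ∀ b ∈ I, a + b ∈ I) (neg : ∀ a ∈ I, -a ∈ I)
    (left : ∀ a, ∀ b ∈ I, a * b ∈ I) (right : ∀ a ∈ I, ∀ b, a * b ∈ I) : IsClosedIdeal I :=
  ⟨hI, .mk' I zero (fun ha hb => add _ ha _ hb) (fun ha => neg _ ha)
    (fun hb => left _ _ hb) (fun ha => right _ ha _), by ext; simp [TwoSidedIdeal.mem_mk']⟩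

namespace IsClosedIdeal

variable {I : Set B} (hI : IsClosedIdeal I)
include hI

theorem zero_mem : (0 : B) ∈ I := by
  obtain ⟨_, J, rfl⟩ := hI
  exact J.zero_mem

theorem mul_mem_left (a : B) {b : B} (hb : b ∈ I) : a * b ∈ I := by
  obtain ⟨_, J, rfl⟩ := hI
  exact J.mul_mem_left a b hb

theorem mul_mem_right {a : B} (ha : a ∈ I) (b : B) : a * b ∈ I := by
  obtain ⟨_, J, rfl⟩ := hI
  exact J.mul_mem_right a b ha

end IsClosedIdeal

/-- The value of a partial bijection at `b`, with the junk value `0` outside of its domain. -/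
noncomputable def papply (θ : B ≃. B) (b : B) : B := (θ b).getD 0

theorem papply_eq {θ : B ≃. B} {b b' : B} (h : b' ∈ θ b) : papply θ b = b' := by
  rw [papply, Option.mem_def.mp h, Option.getD_some]

theorem papply_mem {θ : B ≃. B} {b : B} (h : b ∈ pdom θ) : papply θ b ∈ θ b := by
  obtain ⟨b', hb⟩ := h
  rwa [papply_eq hb]

theorem papply_mem_pdom_symm {θ : B ≃. B} {b : B} (h : b ∈ pdom θ) : papply θ b ∈ pdom θ.symm :=
  ⟨b, (PEquiv.mem_iff_mem _).mpr (papply_mem h)⟩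

theorem symm_papply_mem {θ : B ≃. B} {b : B} (h : b ∈ pdom θ.symm) :
    b ∈ θ (papply θ.symm b) := (PEquiv.mem_iff_mem _).mp (papply_mem h)

namespace IsPartialAut

theorem refl : IsPartialAut (PEquiv.refl B) where
  isClosedIdeal_dom := by
    have : pdom (PEquiv.refl B) = Set.univ := Set.eq_univ_of_forall fun b => ⟨b, rfl⟩
    rw [this]
    exact isClosedIdeal_of_mem isClosed_univ (by simp) (by simp) (by simp) (by simp) (by simp)
  isClosedIdeal_img := by
    have : pdom (PEquiv.refl B).symm = Set.univ := Set.eq_univ_of_forall fun b => ⟨b, rfl⟩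
    rw [this]
    exact isClosedIdeal_of_mem isClosed_univ (by simp) (by simp) (by simp) (by simp) (by simp)
  map_add := by rintro a _ b _ ⟨⟩ ⟨⟩; rfl
  map_smul := by rintro c a _ ⟨⟩; rfl
  map_mul := by rintro a _ b _ ⟨⟩ ⟨⟩; rfl
  map_star := by rintro a _ ⟨⟩; rfl

variable {θ θ' : B ≃. B} (hθ : IsPartialAut θ) (hθ' : IsPartialAut θ')
include hθ

theorem symm : IsPartialAut θ.symm where
  isClosedIdeal_dom := hθ.isClosedIdeal_img
  isClosedIdeal_img := hθ.isClosedIdeal_dom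
  map_add a a' b b' h h' := by
    rw [PEquiv.mem_iff_mem] at *; exact hθ.map_add _ _ _ _ h h'
  map_smul c a a' h := by
    rw [PEquiv.mem_iff_mem] at *; exact hθ.map_smul _ _ _ h
  map_mul a a' b b' h h' := by
    rw [PEquiv.mem_iff_mem] at *; exact hθ.map_mul _ _ _ _ h h'
  map_star a a' h := by
    rw [PEquiv.mem_iff_mem] at *; exact hθ.map_star _ _ h

/-- The domain of a partial automorphism as a ⋆-subalgebra of `B`. -/
def dom : NonUnitalStarSubalgebra ℂ B where
  carrier := pdom θ
  add_mem' := fun ⟨_, ha⟩ ⟨_, hb⟩ => ⟨_, hθ.map_add _ _ _ _ ha hb⟩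
  zero_mem' := hθ.isClosedIdeal_dom.zero_mem
  mul_mem' := fun ⟨_, ha⟩ ⟨_, hb⟩ => ⟨_, hθ.map_mul _ _ _ _ ha hb⟩
  smul_mem' := fun c _ ⟨_, ha⟩ => ⟨_, hθ.map_smul c _ _ ha⟩
  star_mem' := fun ⟨_, ha⟩ => ⟨_, hθ.map_star _ _ ha⟩

theorem isClosed_dom : IsClosed (hθ.dom : Set B) := hθ.isClosedIdeal_dom.1

theorem zero_mem_zero : (0 : B) ∈ θ 0 := by
  have := hθ.map_smul 0 0 _ (papply_mem hθ.isClosedIdeal_dom.zero_mem)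
  rwa [zero_smul, zero_smul] at this

theorem papply_add {a b : B} (ha : a ∈ pdom θ) (hb : b ∈ pdom θ) :
    papply θ (a + b) = papply θ a + papply θ b :=
  papply_eq (hθ.map_add _ _ _ _ (papply_mem ha) (papply_mem hb))

theorem papply_smul (c : ℂ) {a : B} (ha : a ∈ pdom θ) : papply θ (c • a) = c • papply θ a :=
  papply_eq (hθ.map_smul _ _ _ (papply_mem ha))

theorem papply_mul {a b : B} (ha : a ∈ pdom θ) (hb : b ∈ pdom θ) :
    papply θ (a * b) = papply θ a * papply θ b :=
  papply_eq (hθ.map_mul _ _ _ _ (papply_mem ha) (papply_mem hb))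

theorem papply_star {a : B} (ha : a ∈ pdom θ) : papply θ (star a) = star (papply θ a) :=
  papply_eq (hθ.map_star _ _ (papply_mem ha))

/-- A partial automorphism is isometric, as an injective ⋆-homomorphism of C⋆-algebras. -/
theorem norm_papply {a : B} (ha : a ∈ pdom θ) : ‖papply θ a‖ = ‖a‖ := by
  have := hθ.isClosed_dom
  let φ : hθ.dom →⋆ₙₐ[ℂ] B :=
    { toFun := fun a => papply θ a
      map_smul' := fun c a => hθ.papply_smul c a.2
      map_zero' := papply_eq hθ.zero_mem_zero
      map_add' := fun a b => hθ.papply_add a.2 b.2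
      map_mul' := fun a b => hθ.papply_mul a.2 b.2
      map_star' := fun a => hθ.papply_star a.2 }
  have hφ : Function.Injective φ := fun a b hab => Subtype.ext <| by
    have h1 := papply_mem (θ := θ) a.2
    have h2 := papply_mem (θ := θ) b.2
    have hab' : papply θ a = papply θ b := hab
    rw [hab'] at h1
    exact θ.inj h1 h2
  exact NonUnitalStarAlgHom.norm_map φ hφ ⟨a, ha⟩

theorem continuousOn_papply : ContinuousOn (papply θ) (pdom θ) := by
  refine LipschitzOnWith.continuousOn (K := 1) (LipschitzOnWith.of_dist_le_mul fun a ha b hb => ?_)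
  have h1 : a - b ∈ pdom θ := sub_mem (H := hθ.dom) ha hb
  have h2 : papply θ a = papply θ (a - b) + papply θ b := by
    rw [← hθ.papply_add h1 hb, sub_add_cancel]
  rw [dist_eq_norm, dist_eq_norm, h2, add_sub_cancel_right, hθ.norm_papply h1, NNReal.coe_one,
    one_mul]

omit hθ in
theorem mem_pdom_pcomp {b : B} : b ∈ pdom (pcomp θ' θ) ↔ b ∈ pdom θ ∧ papply θ b ∈ pdom θ' := by
  constructor
  · rintro ⟨c, hc⟩
    obtain ⟨d, h1, h2⟩ := mem_pcomp.mp hc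
    exact ⟨⟨d, h1⟩, c, by rwa [papply_eq h1]⟩
  · rintro ⟨h1, c, hc⟩
    exact ⟨c, mem_pcomp.mpr ⟨_, papply_mem h1, hc⟩⟩

/-- An element of the domain that commutes with the domain commutes with `B`. -/
theorem commute_of_commute_dom {z : B} (hz : z ∈ pdom θ) (h : ∀ d ∈ pdom θ, d * z = z * d)
    (b : B) : b * z = z * b := by
  -- both products are in the domain, so it suffices to compare them after multiplication by it
  have h1 : ∀ e ∈ pdom θ, e * (b * z - z * b) = 0 := fun e he => by
    rw [mul_sub, ← mul_assoc e b, h (e * b) (hθ.isClosedIdeal_dom.mul_mem_right he b),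
      ← mul_assoc e z, h e he, mul_assoc, sub_self]
  have h2 : b * z - z * b ∈ hθ.dom := sub_mem (H := hθ.dom)
    (hθ.isClosedIdeal_dom.mul_mem_left b hz) (hθ.isClosedIdeal_dom.mul_mem_right hz b)
  have h3 := h1 _ (star_mem (s := hθ.dom) h2)
  rw [CStarRing.star_mul_self_eq_zero_iff] at h3
  exact sub_eq_zero.mp h3

variable [PartialOrder B] [StarOrderedRing B]

include hθ' in
theorem isClosedIdeal_pdom_pcomp : IsClosedIdeal (pdom (pcomp θ' θ)) := by
  have hset : pdom (pcomp θ' θ) = pdom θ ∩ papply θ ⁻¹' pdom θ' := by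
    ext b; exact mem_pdom_pcomp
  have hcl : IsClosed (pdom (pcomp θ' θ)) := by
    rw [hset]
    exact hθ.continuousOn_papply.preimage_isClosed_of_isClosed hθ.isClosedIdeal_dom.1
      hθ'.isClosedIdeal_dom.1
  let K : NonUnitalStarSubalgebra ℂ B :=
    { carrier := pdom (pcomp θ' θ)
      add_mem' := by
        rintro a b ⟨a', ha⟩ ⟨b', hb⟩
        obtain ⟨a'', h1, h2⟩ := mem_pcomp.mp ha
        obtain ⟨b'', h3, h4⟩ := mem_pcomp.mp hb
        exact ⟨_, mem_pcomp.mpr ⟨_, hθ.map_add _ _ _ _ h1 h3, hθ'.map_add _ _ _ _ h2 h4⟩⟩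
      zero_mem' := ⟨0, mem_pcomp.mpr ⟨0, hθ.zero_mem_zero, hθ'.zero_mem_zero⟩⟩
      mul_mem' := by
        rintro a b ⟨a', ha⟩ ⟨b', hb⟩
        obtain ⟨a'', h1, h2⟩ := mem_pcomp.mp ha
        obtain ⟨b'', h3, h4⟩ := mem_pcomp.mp hb
        exact ⟨_, mem_pcomp.mpr ⟨_, hθ.map_mul _ _ _ _ h1 h3, hθ'.map_mul _ _ _ _ h2 h4⟩⟩
      smul_mem' := by
        rintro c a ⟨a', ha⟩
        obtain ⟨a'', h1, h2⟩ := mem_pcomp.mp ha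
        exact ⟨_, mem_pcomp.mpr ⟨_, hθ.map_smul c _ _ h1, hθ'.map_smul c _ _ h2⟩⟩
      star_mem' := by
        rintro a ⟨a', ha⟩
        obtain ⟨a'', h1, h2⟩ := mem_pcomp.mp ha
        exact ⟨_, mem_pcomp.mpr ⟨_, hθ.map_star _ _ h1, hθ'.map_star _ _ h2⟩⟩ }
  have hK : ∀ b, b ∈ K ↔ b ∈ pdom θ ∧ papply θ b ∈ pdom θ' := fun b => mem_pdom_pcomp
  refine isClosedIdeal_of_mem hcl K.zero_mem (fun a ha b hb => K.add_mem ha hb)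
    (fun a ha => neg_mem (s := K) ha) (fun a b hb => ?_) (fun b hb a => ?_)
  -- `a b = (a c) d` with `c` and `d` in the domain, and `θ (a c) (θ d)` is in the ideal `Dom θ'`
  · obtain ⟨c, hc, d, hd, rfl⟩ := exists_mul_of_mem (S := K) hcl hb
    have h1 := hθ.isClosedIdeal_dom.mul_mem_left a ((hK c).mp hc).1
    have h2 := (hK d).mp hd
    rw [← mul_assoc]
    refine (hK _).mpr ⟨hθ.isClosedIdeal_dom.mul_mem_left _ h2.1, ?_⟩
    rw [hθ.papply_mul h1 h2.1]
    exact hθ'.isClosedIdeal_dom.mul_mem_left _ h2.2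
  · obtain ⟨c, hc, d, hd, rfl⟩ := exists_mul_of_mem (S := K) hcl hb
    have h1 := hθ.isClosedIdeal_dom.mul_mem_right ((hK d).mp hd).1 a
    have h2 := (hK c).mp hc
    rw [mul_assoc]
    refine (hK _).mpr ⟨hθ.isClosedIdeal_dom.mul_mem_right h2.1 _, ?_⟩
    rw [hθ.papply_mul h2.1 h1]
    exact hθ'.isClosedIdeal_dom.mul_mem_right h2.2 _

include hθ' in
theorem pcomp : IsPartialAut (pcomp θ' θ) where
  isClosedIdeal_dom := hθ.isClosedIdeal_pdom_pcomp hθ'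
  isClosedIdeal_img := by
    rw [pcomp_symm]
    exact hθ'.symm.isClosedIdeal_pdom_pcomp hθ.symm
  map_add a a' b b' ha hb := by
    obtain ⟨a'', h1, h2⟩ := mem_pcomp.mp ha
    obtain ⟨b'', h3, h4⟩ := mem_pcomp.mp hb
    exact mem_pcomp.mpr ⟨_, hθ.map_add _ _ _ _ h1 h3, hθ'.map_add _ _ _ _ h2 h4⟩
  map_smul c a a' ha := by
    obtain ⟨a'', h1, h2⟩ := mem_pcomp.mp ha
    exact mem_pcomp.mpr ⟨_, hθ.map_smul c _ _ h1, hθ'.map_smul c _ _ h2⟩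
  map_mul a a' b b' ha hb := by
    obtain ⟨a'', h1, h2⟩ := mem_pcomp.mp ha
    obtain ⟨b'', h3, h4⟩ := mem_pcomp.mp hb
    exact mem_pcomp.mpr ⟨_, hθ.map_mul _ _ _ _ h1 h3, hθ'.map_mul _ _ _ _ h2 h4⟩
  map_star a a' ha := by
    obtain ⟨a'', h1, h2⟩ := mem_pcomp.mp ha
    exact mem_pcomp.mpr ⟨_, hθ.map_star _ _ h1, hθ'.map_star _ _ h2⟩

end IsPartialAut

end

/-! ### Closed linear spans -/

section

section Clspan

variable {V W : Type*} [NormedAddCommGroup V] [NormedSpace ℂ V] [NormedAddCommGroup W]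
  [NormedSpace ℂ W]

theorem subset_clspan (s : Set V) : s ⊆ clspan s :=
  Submodule.subset_span.trans subset_closure

theorem clspan_subset {s : Set V} {U : Submodule ℂ V} (hU : IsClosed (U : Set V))
    (h : s ⊆ U) : clspan s ⊆ U :=
  closure_minimal (Submodule.span_le.mpr h) hU

theorem clspan_le_clspan {s t : Set V} (h : s ⊆ clspan t) : clspan s ⊆ clspan t :=
  clspan_subset (U := (Submodule.span ℂ t).topologicalClosure)
    (Submodule.isClosed_topologicalClosure _) h

theorem clspan_mono {s t : Set V} (h : s ⊆ t) : clspan s ⊆ clspan t :=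
  clspan_le_clspan (h.trans (subset_clspan t))

theorem map_mem_of_mem_clspan {s : Set V} (f : V →L[ℂ] W) {U : Submodule ℂ W}
    (hU : IsClosed (U : Set W)) (h : ∀ x ∈ s, f x ∈ U) {x : V} (hx : x ∈ clspan s) : f x ∈ U :=
  clspan_subset (U := U.comap f.toLinearMap) (hU.preimage f.continuous) h hx

theorem map_mem_clspan {s : Set V} (f : V →L[ℂ] W) {t : Set W} (h : ∀ x ∈ s, f x ∈ clspan t)
    {x : V} (hx : x ∈ clspan s) : f x ∈ clspan t :=
  map_mem_of_mem_clspan f (U := (Submodule.span ℂ t).topologicalClosure)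
    (Submodule.isClosed_topologicalClosure _) h hx

theorem clspan_singleton_zero : clspan ({0} : Set V) = {0} := by
  rw [clspan, Submodule.span_zero_singleton, Submodule.bot_coe, closure_singleton]

theorem clspan_eq_of_subset_insert_zero {s t : Set V} (h : t ⊆ s) (h' : s ⊆ insert 0 t) :
    clspan s = clspan t := by
  refine (clspan_le_clspan fun x hx => ?_).antisymm (clspan_mono h)
  rcases h' hx with rfl | hx
  · exact (Submodule.span ℂ t).topologicalClosure.zero_mem
  · exact subset_clspan t hx

/-- An isometry of a complete space preserves closed linear spans. -/
theorem image_clspan_of_isometry [CompleteSpace V] (f : V →L[ℂ] W) (hf : ∀ x, ‖f x‖ = ‖x‖)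
    (s : Set V) : f '' clspan s = clspan (f '' s) := by
  have hiso : Isometry f := AddMonoidHomClass.isometry_of_norm f hf
  rw [clspan, clspan, ← hiso.isClosedEmbedding.isClosedMap.closure_image_eq_of_continuous
    f.continuous]
  congr 1
  have := Submodule.map_span f.toLinearMap s
  exact congrArg (fun U : Submodule ℂ W => (U : Set W)) this

/-- Contractions that converge to the identity on a linearly dense set converge strongly to the
identity. -/
theorem tendsto_apply_of_clspan {ι : Type*} {l : Filter ι} {T : ι → V →L[ℂ] V}
    (hT : ∀ᶠ i in l, ‖T i‖ ≤ 1) {s : Set V} (hs : clspan s = Set.univ)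
    (h : ∀ x ∈ s, Filter.Tendsto (fun i => T i x) l (nhds x)) (x : V) :
    Filter.Tendsto (fun i => T i x) l (nhds x) := by
  let U : Submodule ℂ V :=
    { carrier := {y | Filter.Tendsto (fun i => T i y) l (nhds y)}
      add_mem' := fun {y z} hy hz =>
        (Filter.Tendsto.add hy hz).congr fun i => (map_add (T i) y z).symm
      zero_mem' := by simpa using tendsto_const_nhds
      smul_mem' := fun c y hy =>
        (Filter.Tendsto.const_smul hy c).congr fun i => (map_smul (T i) c y).symm }
  have hU : IsClosed (U : Set V) := by
    refine isClosed_of_closure_subset fun y hy => ?_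
    change Filter.Tendsto _ _ _
    rw [Metric.tendsto_nhds]
    intro ε hε
    obtain ⟨z, hz, hyz⟩ := Metric.mem_closure_iff.mp hy (ε / 3) (by positivity)
    filter_upwards [Metric.tendsto_nhds.mp hz (ε / 3) (by positivity), hT] with i h1 h2
    have h3 : dist (T i y) (T i z) ≤ dist y z := by
      rw [dist_eq_norm, ← map_sub, dist_eq_norm]
      exact ((T i).le_opNorm _).trans (mul_le_of_le_one_left (norm_nonneg _) h2)
    have h4 := dist_triangle4 (T i y) (T i z) z y
    rw [dist_comm z y] at h4
    linarith
  have h1 : x ∈ clspan s := hs ▸ Set.mem_univ x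
  exact clspan_subset hU h h1

end Clspan

variable {B : Type u} [NonUnitalCStarAlgebra B] [PartialOrder B] [StarOrderedRing B]

namespace CStarBimod

/-! ### Homogeneous elements of bimodules -/

/-- Right multiplication by `b` as a bounded operator. -/
noncomputable def rmulL (E : CStarBimod B) (b : B) : E →L[ℂ] E :=
  (E.mod.rmul b).mkContinuous ‖b‖ fun x => by rw [mul_comm]; exact E.norm_rmul_le b x

@[simp] theorem rmulL_apply (E : CStarBimod B) (b : B) (x : E) :
    E.rmulL b x = E.mod.rmul b x := rfl

variable {E F G : CStarBimod B} {θ θ' : B ≃. B}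

/-- The submodule `E Dom(θ)` consists of all `ξ` such that the inner products `⟨z|ξ⟩` belong to the
ideal `Dom(θ)`. -/
theorem mem_homog_iff (hθ : IsPartialAut θ) {ξ : E} :
    ξ ∈ E.homog θ ↔ (∀ z, E.mod.inner z ξ ∈ pdom θ) ∧
      ∀ b b', b' ∈ θ b → E.mod.rmul b ξ = E.lmul b' ξ := by
  refine and_congr_left fun _ => ⟨?_, fun h => ?_⟩
  · rintro ⟨η, b, hb, rfl⟩ z
    rw [E.mod.inner_rmul]
    exact hθ.isClosedIdeal_dom.mul_mem_left _ hb
  · obtain ⟨ζ, h1, h2, -⟩ := E.exists_cube_root hθ.isClosed_dom ξ (h ξ)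
    exact ⟨ζ, _, h2, h1⟩

/-- The space `E_θ` as a subspace of `E`. -/
def homogSubmodule (E : CStarBimod B) (hθ : IsPartialAut θ) : Submodule ℂ E where
  carrier := E.homog θ
  add_mem' := fun {x y} hx hy => by
    rw [mem_homog_iff hθ] at *
    refine ⟨fun z => ?_, fun b b' hb => ?_⟩
    · rw [map_add]; exact hθ.dom.add_mem (hx.1 z) (hy.1 z)
    · rw [map_add, map_add, hx.2 b b' hb, hy.2 b b' hb]
  zero_mem' := by
    rw [mem_homog_iff hθ]
    refine ⟨fun z => ?_, fun b b' _ => ?_⟩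
    · rw [map_zero]; exact hθ.isClosedIdeal_dom.zero_mem
    · rw [map_zero, map_zero]
  smul_mem' := fun c x hx => by
    rw [mem_homog_iff hθ] at *
    refine ⟨fun z => ?_, fun b b' hb => ?_⟩
    · rw [map_smul]; exact hθ.dom.smul_mem' c (hx.1 z)
    · rw [map_smul, map_smul, hx.2 b b' hb]

theorem isClosed_homog (hθ : IsPartialAut θ) : IsClosed (E.homog θ) := by
  have : E.homog θ = (⋂ z, E.innerL z ⁻¹' pdom θ) ∩
      ⋂ b, ⋂ b', ⋂ _ : b' ∈ θ b, {ξ | E.rmulL b ξ = E.lmulL b' ξ} := by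
    ext ξ
    rw [mem_homog_iff hθ]
    simp
  rw [this]
  exact (isClosed_iInter fun z => hθ.isClosedIdeal_dom.1.preimage (E.innerL z).continuous).inter
    (isClosed_iInter fun b => isClosed_iInter fun b' => isClosed_iInter fun _ =>
      isClosed_eq (E.rmulL b).continuous (E.lmulL b').continuous)

theorem clspan_subset_homog (hθ : IsPartialAut θ) {s : Set E} (h : s ⊆ E.homog θ) :
    clspan s ⊆ E.homog θ :=
  clspan_subset (U := E.homogSubmodule hθ) (isClosed_homog hθ) h

/-- A homogeneous element `ξ` has a homogeneous cube root `ζ`, and `⟨ζ|ζ⟩` is central in `B`. -/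
theorem exists_homog_cube_root (hθ : IsPartialAut θ) {ξ : E} (hξ : ξ ∈ E.homog θ) :
    ∃ ζ ∈ E.homog θ, ξ = E.mod.rmul (E.mod.inner ζ ζ) ζ ∧ E.mod.inner ζ ζ ∈ pdom θ ∧
      ∀ b, b * E.mod.inner ζ ζ = E.mod.inner ζ ζ * b := by
  have hξ' := (mem_homog_iff hθ).mp hξ
  -- the elements of `Dom(θ)` that commute with `Dom(θ)` act on `E_θ` from the right
  let S := hθ.dom ⊓ NonUnitalStarSubalgebra.centralizer ℂ (pdom θ)
  have hS : IsClosed (S : Set B) := by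
    rw [NonUnitalStarAlgebra.coe_inf, NonUnitalStarSubalgebra.coe_centralizer]
    exact hθ.isClosed_dom.inter (Set.isClosed_centralizer _)
  have hmem : ∀ z, z ∈ S ↔ z ∈ pdom θ ∧ ∀ d ∈ pdom θ, d * z = z * d := fun z => by
    rw [NonUnitalStarAlgebra.mem_inf, NonUnitalStarSubalgebra.mem_centralizer_iff]
    refine and_congr_right fun _ => ⟨fun h d hd => (h d hd).1, fun h d hd => ⟨h d hd, ?_⟩⟩
    exact h _ (star_mem (s := hθ.dom) hd)
  have hcomm : E.mod.inner ξ ξ ∈ S := by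
    refine (hmem _).mpr ⟨hξ'.1 ξ, fun d hd => ?_⟩
    have h1 := hξ'.2 _ _ (papply_mem hd)
    have h2 := hξ'.2 _ _ (hθ.map_star _ _ (papply_mem hd))
    rw [← E.mod.inner_rmul, h1, E.inner_lmul', ← h2, E.mod.rmul_inner, star_star]
  obtain ⟨ζ, h1, h2, h3⟩ := E.exists_cube_root hS ξ hcomm
  refine ⟨ζ, closure_minimal ?_ (isClosed_homog hθ) h3, h1, ((hmem _).mp h2).1,
    hθ.commute_of_commute_dom ((hmem _).mp h2).1 ((hmem _).mp h2).2⟩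
  rintro _ ⟨c, hc, rfl⟩
  refine (mem_homog_iff hθ).mpr ⟨fun z => ?_, fun b b' hb => ?_⟩
  · rw [E.mod.inner_rmul]
    exact hθ.isClosedIdeal_dom.mul_mem_right (hξ'.1 z) c
  · rw [← E.mod.rmul_mul, ← ((hmem c).mp hc).2 b (mem_pdom hb), E.mod.rmul_mul, hξ'.2 b b' hb,
      E.rmul_lmul]

theorem homog_mono (hθ : IsPartialAut θ) (hθ' : IsPartialAut θ') (h : θ ≤ θ') :
    E.homog θ ⊆ E.homog θ' := by
  intro ξ hξ
  obtain ⟨ζ, hζ, h1, h2, h3⟩ := exists_homog_cube_root hθ hξ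
  have hζ' := (mem_homog_iff hθ).mp hζ
  have hle := PEquiv.le_def.mp h
  refine ⟨⟨ζ, _, pdom_mono h h2, h1⟩, fun b b' hb => ?_⟩
  have h4 := papply_mem h2
  set w := E.mod.inner ζ ζ
  have h5 : b' * papply θ w ∈ θ (b * w) := by
    have h6 := hθ'.map_mul _ _ _ _ hb (hle _ _ h4)
    obtain ⟨e, he⟩ := hθ.isClosedIdeal_dom.mul_mem_left b h2
    rwa [← Option.mem_unique (hle _ _ he) h6]
  rw [h1, ← E.mod.rmul_mul, ← h3, hζ'.2 _ _ h5, map_mul, Module.End.mul_apply, hζ'.2 _ _ h4]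

/-- A map on `E × F` that is balanced over `B` and `B`-bilinear, like the tensor product, maps
`E_θ × F_θ'` into the `θθ'`-homogeneous elements. -/
theorem mem_homog_of_balanced (hθ' : IsPartialAut θ') (M : E → F → G)
    (hb : ∀ b ξ η, M (E.mod.rmul b ξ) η = M ξ (F.lmul b η))
    (hl : ∀ b ξ η, M (E.lmul b ξ) η = G.lmul b (M ξ η))
    (hr : ∀ b ξ η, M ξ (F.mod.rmul b η) = G.mod.rmul b (M ξ η)) (hθ : IsPartialAut θ)
    {ξ : E} {η : F} (hξ : ξ ∈ E.homog θ) (hη : η ∈ F.homog θ') :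
    M ξ η ∈ G.homog (pcomp θ θ') := by
  refine ⟨?_, fun b c hbc => ?_⟩
  · obtain ⟨⟨ξ₀, v, hv, rfl⟩, -⟩ := hξ
    obtain ⟨ζ, hζ, h1, h2, -⟩ := exists_homog_cube_root hθ' hη
    have hζ' := (mem_homog_iff hθ').mp hζ
    set w := F.mod.inner ζ ζ
    have h3 := hθ'.isClosedIdeal_img.mul_mem_left v (papply_mem_pdom_symm h2)
    have h4 := symm_papply_mem h3
    obtain ⟨e, he⟩ := hθ.isClosedIdeal_dom.mul_mem_right hv (papply θ' w)
    refine ⟨M ξ₀ ζ, papply θ'.symm (v * papply θ' w), ⟨e, mem_pcomp.mpr ⟨_, h4, he⟩⟩, ?_⟩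
    rw [h1, hb, hζ'.2 _ _ (papply_mem h2), ← Module.End.mul_apply, ← map_mul, ← hr,
      hζ'.2 _ _ h4]
  · obtain ⟨d, h1, h2⟩ := mem_pcomp.mp hbc
    rw [← hr, hη.2 _ _ h1, ← hb, hξ.2 _ _ h2, hl]

/-- A map on `E × G` with the invariance properties of an inner product maps `E_θ × G_θ'` into the
`θ⋆θ'`-homogeneous elements. -/
theorem mem_homog_of_sesquilinear (hθ : IsPartialAut θ) (hθ' : IsPartialAut θ') (L : E → G → F)
    (hb : ∀ b ξ x, L ξ (G.lmul b x) = L (E.lmul (star b) ξ) x)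
    (hl : ∀ b ξ x, L (E.mod.rmul b ξ) x = F.lmul (star b) (L ξ x))
    (hr : ∀ b ξ x, L ξ (G.mod.rmul b x) = F.mod.rmul b (L ξ x))
    {ξ : E} {x : G} (hξ : ξ ∈ E.homog θ) (hx : x ∈ G.homog θ') :
    L ξ x ∈ F.homog (pcomp θ.symm θ') := by
  refine ⟨?_, fun b c hbc => ?_⟩
  · obtain ⟨ζ, hζ, h1, h2, -⟩ := exists_homog_cube_root hθ hξ
    obtain ⟨y, hy, h3, h4, -⟩ := exists_homog_cube_root hθ' hx
    have hζ' := (mem_homog_iff hθ).mp hζ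
    have hy' := (mem_homog_iff hθ').mp hy
    set w := G.mod.inner y y
    set v := E.mod.inner ζ ζ
    have h5 := hθ'.isClosedIdeal_img.mul_mem_left (star (papply θ v)) (papply_mem_pdom_symm h4)
    have h6 := symm_papply_mem h5
    obtain ⟨e, he⟩ := hθ.isClosedIdeal_img.mul_mem_right
      (star_mem (s := hθ.symm.dom) (papply_mem_pdom_symm h2)) (papply θ' w)
    refine ⟨L ζ y, papply θ'.symm (star (papply θ v) * papply θ' w),
      ⟨e, mem_pcomp.mpr ⟨_, h6, he⟩⟩, ?_⟩
    rw [← hr, hy'.2 _ _ h6, map_mul, Module.End.mul_apply, hb, star_star, ← hy'.2 _ _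
      (papply_mem h4), ← hζ'.2 _ _ (papply_mem h2), ← h1, ← h3]
  · obtain ⟨d, h1, h2⟩ := mem_pcomp.mp hbc
    have h3 := hθ.map_star _ _ ((PEquiv.mem_iff_mem _).mp h2)
    rw [← hr, hx.2 _ _ h1, hb, ← hξ.2 _ _ h3, hl, star_star]

theorem tmul_mem_homog (hθ : IsPartialAut θ) (hθ' : IsPartialAut θ') {ξ : E} {η : F}
    (hξ : ξ ∈ E.homog θ) (hη : η ∈ F.homog θ') :
    tmul E F ξ η ∈ (tensor E F).homog (pcomp θ θ') :=
  mem_homog_of_balanced hθ' (fun ξ η => tmul E F ξ η) (fun b ξ η => (tmul_balanced ξ η b).symm)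
    (fun b ξ η => (tensor_lmul b ξ η).symm) (fun b ξ η => (tensor_rmul b ξ η).symm) hθ hξ hη

theorem rmul_mem_homog (hθ : IsPartialAut θ) (hθ' : IsPartialAut θ') {ξ : E} {b : B}
    (hξ : ξ ∈ E.homog θ) (hb : toUnit B b ∈ (unit B).homog θ') :
    E.mod.rmul b ξ ∈ E.homog (pcomp θ θ') :=
  mem_homog_of_balanced hθ' (fun (ξ : E) (b : unit B) => E.mod.rmul (ofUnit B b) ξ)
    (fun a ξ b => by rw [ofUnit_lmul, E.mod.rmul_mul])
    (fun a ξ b => E.rmul_lmul a _ ξ)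
    (fun a ξ b => by rw [ofUnit_rmul, E.mod.rmul_mul]) hθ hξ hb

theorem inner_mem_homog (hθ : IsPartialAut θ) (hθ' : IsPartialAut θ') {ξ ξ' : E}
    (hξ : ξ ∈ E.homog θ) (hξ' : ξ' ∈ E.homog θ') :
    toUnit B (E.mod.inner ξ ξ') ∈ (unit B).homog (pcomp θ.symm θ') :=
  mem_homog_of_sesquilinear hθ hθ' (fun ξ ξ' : E => toUnit B (E.mod.inner ξ ξ'))
    (fun b ξ x => by rw [E.inner_lmul'])
    (fun b ξ x => by rw [E.mod.rmul_inner]; rfl)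
    (fun b ξ x => by rw [E.mod.inner_rmul]; rfl) hξ hξ'

/-- The homogeneous elements for the identity of `B` are the central elements. -/
theorem mem_homog_refl_iff {b : B} :
    toUnit B b ∈ (unit B).homog (.refl B) ↔ ∀ a, b * a = a * b := by
  rw [mem_homog_iff IsPartialAut.refl]
  refine ⟨fun h a => h.2 a a rfl, fun h => ⟨fun z => ⟨_, rfl⟩, ?_⟩⟩
  rintro a _ ⟨⟩
  exact h a

end CStarBimod

end

/-! ### The C⋆-algebra of adjointable operators -/

section

variable {B : Type u} [NonUnitalCStarAlgebra B] [PartialOrder B] [StarOrderedRing B]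

namespace CStarBimod

section Adjointable

variable (E : CStarBimod B)

/-- The algebra of adjointable operators on a Hilbert module. -/
def adjointable : Subalgebra ℂ (E →L[ℂ] E) where
  carrier := {T | ∃ S : E →L[ℂ] E, ∀ x y, E.mod.inner (T x) y = E.mod.inner x (S y)}
  mul_mem' := by
    rintro T₁ T₂ ⟨S₁, h₁⟩ ⟨S₂, h₂⟩
    exact ⟨S₂ * S₁, fun x y => by simp [h₁, h₂]⟩
  add_mem' := by
    rintro T₁ T₂ ⟨S₁, h₁⟩ ⟨S₂, h₂⟩
    exact ⟨S₁ + S₂, fun x y => by simp [h₁, h₂]⟩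
  algebraMap_mem' c := ⟨conj c • 1, fun x y => by
    simp [Algebra.algebraMap_eq_smul_one]⟩

variable {E}

noncomputable instance : Star E.adjointable :=
  ⟨fun T => ⟨T.2.choose, T.1, fun x y => by
    rw [← E.mod.star_inner, ← T.2.choose_spec, E.mod.star_inner]⟩⟩

theorem adjointable_inner (T : E.adjointable) (x y : E) :
    E.mod.inner (T.1 x) y = E.mod.inner x ((star T).1 y) := T.2.choose_spec x y

theorem adjointable_star_inner (T : E.adjointable) (x y : E) :
    E.mod.inner ((star T).1 x) y = E.mod.inner x (T.1 y) := by
  rw [← E.mod.star_inner, ← adjointable_inner, E.mod.star_inner]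

theorem adjointable_ext {S T : E.adjointable}
    (h : ∀ x y, E.mod.inner x (S.1 y) = E.mod.inner x (T.1 y)) : S = T :=
  Subtype.ext (ContinuousLinearMap.ext fun y => ext_inner fun x => h x y)

theorem norm_le_of_adjoint {T S : E →L[ℂ] E}
    (h : ∀ x y, E.mod.inner (T x) y = E.mod.inner x (S y)) : ‖S‖ ≤ ‖T‖ := by
  refine S.opNorm_le_bound (norm_nonneg _) fun y => ?_
  rcases (norm_nonneg (S y)).eq_or_lt with h0 | h0
  · rw [← h0]; positivity
  · refine le_of_mul_le_mul_left ?_ h0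
    rw [← sq, E.norm_sq, ← h]
    calc _ ≤ ‖T (S y)‖ * ‖y‖ := E.norm_inner_le _ _
      _ ≤ ‖T‖ * ‖S y‖ * ‖y‖ := by gcongr; exact T.le_opNorm _
      _ = _ := by ring

noncomputable instance : StarRing E.adjointable where
  star_involutive T := adjointable_ext fun x y => by
    rw [← adjointable_inner, adjointable_star_inner]
  star_mul S T := adjointable_ext fun x y => by
    rw [← adjointable_inner]
    change E.mod.inner (S.1 (T.1 x)) y = E.mod.inner x ((star T).1 ((star S).1 y))
    rw [adjointable_inner, adjointable_inner]
  star_add S T := adjointable_ext fun x y => by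
    rw [← adjointable_inner]
    change E.mod.inner (S.1 x + T.1 x) y = E.mod.inner x ((star S).1 y + (star T).1 y)
    rw [map_add, map_add, LinearMap.add_apply, adjointable_inner, adjointable_inner]

noncomputable instance : StarModule ℂ E.adjointable where
  star_smul c T := adjointable_ext fun x y => by
    rw [← adjointable_inner]
    change E.mod.inner (c • T.1 x) y = E.mod.inner x (conj c • (star T).1 y)
    rw [map_smulₛₗ, map_smul, LinearMap.smul_apply, adjointable_inner]

instance : CStarRing E.adjointable where
  norm_mul_self_le T := by
    have h : ‖T.1‖ ≤ √‖star T * T‖ := T.1.opNorm_le_bound (Real.sqrt_nonneg _) fun x => by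
      refine le_of_sq_le_sq ?_ (by positivity)
      have hs : √‖star T * T‖ ^ 2 = ‖star T * T‖ := Real.sq_sqrt (norm_nonneg _)
      rw [mul_pow, hs, E.norm_sq, adjointable_inner]
      calc _ ≤ ‖x‖ * ‖(star T * T).1 x‖ := E.norm_inner_le _ _
        _ ≤ ‖x‖ * (‖star T * T‖ * ‖x‖) := by gcongr; exact (star T * T).1.le_opNorm x
        _ = _ := by ring
    rw [← sq]
    exact (pow_le_pow_left₀ (norm_nonneg _) h 2).trans_eq (Real.sq_sqrt (norm_nonneg _))

theorem isClosed_adjointable : IsClosed (E.adjointable : Set (E →L[ℂ] E)) := by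
  refine isClosed_of_closure_subset fun T hT => ?_
  obtain ⟨t, ht, hlim⟩ := mem_closure_iff_seq_limit.mp hT
  choose s hs using ht
  have hcauchy : CauchySeq s := by
    have h1 := hlim.cauchySeq
    rw [Metric.cauchySeq_iff] at h1 ⊢
    intro ε hε
    obtain ⟨N, hN⟩ := h1 ε hε
    refine ⟨N, fun m hm n hn => lt_of_le_of_lt ?_ (hN m hm n hn)⟩
    rw [dist_eq_norm, dist_eq_norm]
    exact norm_le_of_adjoint fun x y => by simp [hs]
  obtain ⟨S, hS⟩ := cauchySeq_tendsto_of_complete hcauchy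
  refine ⟨S, fun x y => ?_⟩
  have h1 : Filter.Tendsto (fun n => E.mod.inner (t n x) y) Filter.atTop
      (nhds (E.mod.inner (T x) y)) :=
    (E.continuous_inner.tendsto (T x, y)).comp
      ((((ContinuousLinearMap.apply ℂ E x).continuous.tendsto T).comp hlim).prodMk_nhds
        tendsto_const_nhds)
  have h2 : Filter.Tendsto (fun n => E.mod.inner x (s n y)) Filter.atTop
      (nhds (E.mod.inner x (S y))) :=
    (E.continuous_inner.tendsto (x, S y)).comp (tendsto_const_nhds.prodMk_nhds
      (((ContinuousLinearMap.apply ℂ E y).continuous.tendsto S).comp hS))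
  exact tendsto_nhds_unique h1 (h2.congr fun n => (hs n x y).symm)

instance : CompleteSpace E.adjointable := isClosed_adjointable.completeSpace_coe

noncomputable instance : CStarAlgebra E.adjointable where

/-- If a set of adjointable operators is closed under products and adjoints and acts
nondegenerately, then every `x` is approximated by linear combinations of the elements `T x` for
operators `T` of the set: an approximate unit of the C⋆-algebra spanned by them converges strongly
to the identity. -/
theorem mem_clspan_of_nondegenerate {A : Set E.adjointable} (hmul : ∀ S ∈ A, ∀ T ∈ A, S * T ∈ A)
    (hstar : ∀ T ∈ A, star T ∈ A) (hA : clspan {y | ∃ T ∈ A, ∃ x, y = T.1 x} = Set.univ) (x : E) :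
    x ∈ clspan {y | ∃ T ∈ A, y = T.1 x} := by
  let N : NonUnitalStarSubalgebra ℂ E.adjointable :=
    { Submodule.span ℂ A with
      mul_mem' := fun {S T} hS hT => by
        have h := Submodule.mul_mem_mul (M := Submodule.span ℂ A) (N := Submodule.span ℂ A) hS hT
        rw [Submodule.span_mul_span] at h
        refine Submodule.span_mono ?_ h
        rintro _ ⟨S, hS, T, hT, rfl⟩
        exact hmul S hS T hT
      star_mem' := fun {T} hT => by
        change star T ∈ Submodule.span ℂ A
        induction hT using Submodule.span_induction with
        | mem T h => exact Submodule.subset_span (hstar T h)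
        | zero => rw [star_zero]; exact Submodule.zero_mem _
        | add S T _ _ hS hT => rw [star_add]; exact Submodule.add_mem _ hS hT
        | smul c T _ hT => rw [star_smul]; exact Submodule.smul_mem _ _ hT }
  let K := N.topologicalClosure
  have hK : IsClosed (K : Set E.adjointable) := N.isClosed_topologicalClosure
  let _ : PartialOrder K := CStarAlgebra.spectralOrder K
  have : StarOrderedRing K := CStarAlgebra.spectralOrderedRing K
  have hl := CStarAlgebra.increasingApproximateUnit K
  set l := CStarAlgebra.approximateUnit K
  have := hl.neBot
  have hlim : Filter.Tendsto (fun u : K => u.1.1 x) l (nhds x) := by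
    refine tendsto_apply_of_clspan (T := fun u : K => u.1.1) hl.eventually_norm hA ?_ x
    rintro _ ⟨T, hT, z, rfl⟩
    have hTK : T ∈ K := N.le_topologicalClosure (Submodule.subset_span hT)
    have h2 := hl.tendsto_mul_right (⟨T, hTK⟩ : K)
    have h3 : Continuous fun u : K => u.1.1 z :=
      (ContinuousLinearMap.apply ℂ E z).continuous.comp
        (continuous_subtype_val.comp continuous_subtype_val)
    exact (h3.tendsto _).comp h2
  refine isClosed_closure.mem_of_tendsto hlim (Filter.Eventually.of_forall fun u => ?_)
  let ev : E.adjointable →L[ℂ] E :=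
    (ContinuousLinearMap.apply ℂ E x).comp (E.adjointable.toSubmodule.subtypeL)
  have h1 : (u : E.adjointable) ∈ clspan A := u.2
  exact map_mem_clspan (s := A) ev (t := {y | ∃ T ∈ A, y = T.1 x})
    (fun T hT => subset_clspan _ ⟨T, hT, rfl⟩) h1

end Adjointable

end CStarBimod

end

/-! ### Homogeneous elements of tensor products -/

section

variable {B : Type u} [NonUnitalCStarAlgebra B] [PartialOrder B] [StarOrderedRing B]

namespace CStarBimod

variable {E F : CStarBimod B} {θ : B ≃. B} {Θ : Set (B ≃. B)}

variable (F) in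
/-- The operators `η ↦ ξ ⊗ η` are adjointable. -/
theorem exists_bra (ξ : E) : ∃ β : tensor E F →L[ℂ] F,
    ∀ x η, F.mod.inner (β x) η = (tensor E F).mod.inner x (tmul E F ξ η) := by
  let β₀ : E ⊗[ℂ] F →ₗ[ℂ] F := TensorProduct.lift
    (LinearMap.mk₂ ℂ (fun ξ' η' => F.lmul (E.mod.inner ξ ξ') η')
      (fun x y z => by simp) (fun c x y => by simp) (fun x y z => by simp)
      (fun c x y => by simp))
  have hβ₀ : ∀ x η, F.mod.inner (β₀ x) η = (preTensor E F).inner x (ξ ⊗ₜ η) := fun x η => by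
    induction x using TensorProduct.induction_on with
    | zero => simp
    | add x y hx hy => simp [hx, hy]
    | tmul ξ' η' =>
      rw [preTensor_inner, TensorProduct.lift.tmul, LinearMap.mk₂_apply, F.inner_lmul,
        E.mod.star_inner]
  have hnorm : ∀ x, ‖β₀ x‖ ≤ ‖ξ‖ * ‖(preTensor E F).toCompletion x‖ := fun x => by
    rcases (norm_nonneg (β₀ x)).eq_or_lt with h0 | h0
    · rw [← h0]; positivity
    · refine le_of_mul_le_mul_left ?_ h0
      rw [← sq, F.norm_sq, hβ₀]
      calc _ ≤ _ := (preTensor E F).norm_inner_le' _ _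
        _ ≤ ‖(preTensor E F).toCompletion x‖ * (‖ξ‖ * ‖β₀ x‖) := by
          gcongr; exact norm_tmul_le E F ξ _
        _ = _ := by ring
  let β : tensor E F →L[ℂ] F := β₀.extendOfNorm (preTensor E F).toCompletion
  have hβ : ∀ x, β ((preTensor E F).toCompletion x) = β₀ x :=
    LinearMap.extendOfNorm_eq (preTensor E F).denseRange_toCompletion ⟨_, hnorm⟩
  refine ⟨β, fun x η => ?_⟩
  refine (preTensor E F).denseRange_toCompletion.induction_on
    (p := fun x => F.mod.inner (β x) η = (tensor E F).mod.inner x (tmul E F ξ η)) x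
    (isClosed_eq (F.continuous_inner.comp (β.continuous.prodMk continuous_const))
      ((tensor E F).continuous_inner.comp (continuous_id.prodMk continuous_const))) fun x => ?_
  rw [hβ, hβ₀]
  exact ((preTensor E F).completion_inner x (ξ ⊗ₜ η)).symm

variable (F) in
/-- The adjoint of the operator `η ↦ ξ ⊗ η`; it maps `ξ' ⊗ η'` to `⟨ξ|ξ'⟩ η'`. -/
noncomputable def bra (ξ : E) : tensor E F →L[ℂ] F := (exists_bra F ξ).choose

theorem bra_inner (ξ : E) (x : tensor E F) (η : F) :
    F.mod.inner (bra F ξ x) η = (tensor E F).mod.inner x (tmul E F ξ η) :=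
  (exists_bra F ξ).choose_spec x η

theorem inner_bra (ξ : E) (x : tensor E F) (η : F) :
    F.mod.inner η (bra F ξ x) = (tensor E F).mod.inner (tmul E F ξ η) x := by
  rw [← F.mod.star_inner, bra_inner, (tensor E F).mod.star_inner]

theorem bra_tmul (ξ ξ' : E) (η' : F) :
    bra F ξ (tmul E F ξ' η') = F.lmul (E.mod.inner ξ ξ') η' :=
  ext_inner fun η => by rw [inner_bra, tensor_inner]

/-- The operator `ξ' ⊗ η ↦ x ⟨y|ξ'⟩ ⊗ η` on the tensor product. -/
noncomputable def ketBra (F : CStarBimod B) (x y : E) : (tensor E F).adjointable :=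
  ⟨(tmul E F x).comp (bra F y), (tmul E F y).comp (bra F x), fun z w => by
    rw [ContinuousLinearMap.comp_apply, ContinuousLinearMap.comp_apply, ← inner_bra, ← bra_inner]⟩

theorem ketBra_apply (x y : E) (z : tensor E F) :
    (ketBra F x y).1 z = tmul E F x (bra F y z) := rfl

theorem star_ketBra (x y : E) : star (ketBra F x y) = ketBra F y x :=
  adjointable_ext fun z w => by
    rw [← adjointable_inner, ketBra_apply, ketBra_apply, ← inner_bra, ← bra_inner]

theorem ketBra_mul_ketBra (x y x' y' : E) :
    ketBra F x y * ketBra F x' y' = ketBra F (E.mod.rmul (E.mod.inner y x') x) y' :=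
  adjointable_ext fun z w => by
    change (tensor E F).mod.inner z ((ketBra F x y).1 ((ketBra F x' y').1 w)) = _
    rw [ketBra_apply, ketBra_apply, ketBra_apply, bra_tmul, tmul_balanced]

theorem bra_mem_homog {θ' : B ≃. B} (hθ : IsPartialAut θ) (hθ' : IsPartialAut θ') {ξ : E}
    {x : tensor E F} (hξ : ξ ∈ E.homog θ) (hx : x ∈ (tensor E F).homog θ') :
    bra F ξ x ∈ F.homog (pcomp θ.symm θ') :=
  mem_homog_of_sesquilinear hθ hθ' (fun ξ x => bra F ξ x)
    (fun b ξ x => ext_inner fun η => by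
      rw [inner_bra, inner_bra, (tensor E F).inner_lmul', tensor_lmul])
    (fun b ξ x => ext_inner fun η => by
      rw [inner_bra, F.inner_lmul', star_star, inner_bra, tmul_balanced])
    (fun b ξ x => ext_inner fun η => by
      rw [inner_bra, F.mod.inner_rmul, (tensor E F).mod.inner_rmul, inner_bra]) hξ hx

/-- If `E` is `Θ`-decomposable, then a homogeneous element `x` of `E ⊗ F` is approximated by linear
combinations of the elements `ξ ⊗ ⟨ξ'|x⟩` with `ξ` and `ξ'` in the same space `E_ρ`. -/
theorem mem_clspan_tmul_bra (hΘ : ∀ θ ∈ Θ, IsPartialAut θ) (hE : IsDecomposableFor Θ E)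
    (hθ : IsPartialAut θ) {x : tensor E F} (hx : x ∈ (tensor E F).homog θ) :
    x ∈ clspan {z | ∃ ρ ∈ Θ, ∃ ξ ∈ E.homog ρ, ∃ η ∈ F.homog (pcomp ρ.symm θ),
      z = tmul E F ξ η} := by
  let A : Set (tensor E F).adjointable :=
    {T | ∃ ρ ∈ Θ, ∃ ξ ∈ E.homog ρ, ∃ ξ' ∈ E.homog ρ, T = ketBra F ξ ξ'}
  have hmul : ∀ S ∈ A, ∀ T ∈ A, S * T ∈ A := by
    rintro _ ⟨ρ, hρ, ξ, hξ, ξ', hξ', rfl⟩ _ ⟨κ, hκ, ζ, hζ, ζ', hζ', rfl⟩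
    refine ⟨κ, hκ, _, ?_, ζ', hζ', ketBra_mul_ketBra ξ ξ' ζ ζ'⟩
    have hρ' := hΘ ρ hρ
    have hκ' := hΘ κ hκ
    have h1 := rmul_mem_homog hρ' (hκ'.pcomp hρ'.symm) hξ (inner_mem_homog hρ' hκ' hξ' hζ)
    rw [← pcomp_assoc] at h1
    refine homog_mono (hκ'.pcomp (hρ'.symm.pcomp hρ')) hκ' ?_ h1
    conv_rhs => rw [← refl_pcomp κ]
    exact pcomp_mono (self_pcomp_symm_le ρ) le_rfl
  have hstar : ∀ T ∈ A, star T ∈ A := by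
    rintro _ ⟨ρ, hρ, ξ, hξ, ξ', hξ', rfl⟩
    exact ⟨ρ, hρ, ξ', hξ', ξ, hξ, star_ketBra ξ ξ'⟩
  have hA : clspan {y | ∃ T ∈ A, ∃ x, y = T.1 x} = Set.univ := by
    refine Set.eq_univ_of_forall fun y => ?_
    refine tensor_mem (U := (Submodule.span ℂ _).topologicalClosure)
      (Submodule.isClosed_topologicalClosure _) (fun ξ η => ?_) y
    refine map_mem_of_dense hE ((tmul E F).flip η) (Submodule.isClosed_topologicalClosure _) ?_ ξ
    rintro ξ ⟨ρ, hρ, hξ⟩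
    obtain ⟨ζ, hζ, h1, -⟩ := exists_homog_cube_root (hΘ ρ hρ) hξ
    refine subset_clspan _ ⟨ketBra F ζ ζ, ⟨ρ, hρ, ζ, hζ, ζ, hζ, rfl⟩, tmul E F ζ η, ?_⟩
    rw [ketBra_apply, bra_tmul, tmul_balanced, ← h1]
    rfl
  refine clspan_mono ?_ (mem_clspan_of_nondegenerate hmul hstar hA x)
  rintro _ ⟨_, ⟨ρ, hρ, ξ, hξ, ξ', hξ', rfl⟩, rfl⟩
  exact ⟨ρ, hρ, ξ, hξ, _, bra_mem_homog (hΘ ρ hρ) hθ hξ' hx, rfl⟩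

theorem hom_mem_homog (f : E ⟶ F) {ξ : E} (hξ : ξ ∈ E.homog θ) :
    Hom.toCLM f ξ ∈ F.homog θ := by
  obtain ⟨⟨η, b, hb, rfl⟩, h⟩ := hξ
  refine ⟨⟨_, b, hb, Hom.map_rmul f b η⟩, fun c c' hc => ?_⟩
  have := congrArg (fun x => Hom.toCLM f x) (h c c' hc)
  rwa [Hom.map_rmul f, Hom.map_lmul f] at this

/-- If `B` is `Θ`-supported, then every `Θ`-decomposable bimodule is `Θ`-supported. -/
theorem IsDecomposableFor.isSupportedFor (hΘ : IsAdmissibleSemigroup Θ)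
    (hE : IsDecomposableFor Θ E) : IsSupportedFor Θ E := by
  intro θ hθ
  have hΘ' := hΘ.isInverseSemigroup.isPartialAut
  refine Set.Subset.antisymm (fun ξ hξ => ?_) (clspan_subset_homog hθ ?_)
  · -- decompose the element of `E ⊗ B` that corresponds to `ξ`
    have h1 := mem_clspan_tmul_bra hΘ' hE hθ (hom_mem_homog (rightUnitor E).inv hξ)
    have h2 : Hom.toCLM (rightUnitor E).hom (Hom.toCLM (rightUnitor E).inv ξ) = ξ := by
      rw [← comp_apply, Iso.inv_hom_id, id_apply]
    rw [← h2]
    refine map_mem_clspan _ ?_ h1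
    rintro _ ⟨ρ, hρ, ζ, hζ, b, hb, rfl⟩
    rw [rightUnitor_tmul]
    rw [hΘ.supported _ (hθ.pcomp (hΘ' ρ hρ).symm)] at hb
    refine map_mem_clspan ((E.lket ζ).comp (ofUnit B)) ?_ hb
    rintro b ⟨τ, hτ, hτρ, hb⟩
    refine subset_clspan _ ⟨pcomp ρ τ, hΘ.isInverseSemigroup.comp_mem _ hρ _ hτ, ?_,
      rmul_mem_homog (hΘ' ρ hρ) (hΘ' τ hτ) hζ hb⟩
    refine (pcomp_mono le_rfl hτρ).trans ?_
    rw [← pcomp_assoc]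
    conv_rhs => rw [← refl_pcomp θ]
    exact pcomp_mono (self_pcomp_symm_le ρ) le_rfl
  · rintro ξ ⟨θ', hθ', hle, hξ⟩
    exact homog_mono (hΘ' θ' hθ') hθ hle hξ

/-- The homogeneous elements of a tensor product of `Θ`-decomposable bimodules. -/
theorem homog_tensor (hΘ : IsAdmissibleSemigroup Θ) (hE : IsDecomposableFor Θ E)
    (hF : IsDecomposableFor Θ F) (hθ : IsPartialAut θ) :
    (tensor E F).homog θ = clspan {ζ | ∃ ρ ∈ Θ, ∃ κ ∈ Θ, pcomp ρ κ ≤ θ ∧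
      ∃ ξ ∈ E.homog ρ, ∃ η ∈ F.homog κ, ζ = tmul E F ξ η} := by
  have hΘ' := hΘ.isInverseSemigroup.isPartialAut
  refine Set.Subset.antisymm (fun x hx => ?_) (clspan_subset_homog hθ ?_)
  · refine clspan_le_clspan ?_ (mem_clspan_tmul_bra hΘ' hE hθ hx)
    rintro _ ⟨ρ, hρ, ξ, hξ, η, hη, rfl⟩
    rw [hF.isSupportedFor hΘ _ (hθ.pcomp (hΘ' ρ hρ).symm)] at hη
    refine map_mem_clspan (tmul E F ξ) ?_ hη
    rintro η ⟨τ, hτ, hτρ, hη⟩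
    refine subset_clspan _ ⟨ρ, hρ, τ, hτ, ?_, ξ, hξ, η, hη, rfl⟩
    refine (pcomp_mono le_rfl hτρ).trans ?_
    rw [← pcomp_assoc]
    conv_rhs => rw [← refl_pcomp θ]
    exact pcomp_mono (self_pcomp_symm_le ρ) le_rfl
  · rintro _ ⟨ρ, hρ, κ, hκ, hle, ξ, hξ, η, hη, rfl⟩
    exact homog_mono ((hΘ' κ hκ).pcomp (hΘ' ρ hρ)) hθ hle
      (tmul_mem_homog (hΘ' ρ hρ) (hΘ' κ hκ) hξ hη)

theorem isDecomposableFor_tensor (hΘ : IsInverseSemigroup Θ) (hE : IsDecomposableFor Θ E)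
    (hF : IsDecomposableFor Θ F) : IsDecomposableFor Θ (tensor E F) := by
  refine Set.eq_univ_of_forall fun x => ?_
  refine tensor_mem (U := (Submodule.span ℂ _).topologicalClosure)
    (Submodule.isClosed_topologicalClosure _) (fun ξ η => ?_) x
  refine map_mem_of_dense hE ((tmul E F).flip η) (Submodule.isClosed_topologicalClosure _) ?_ ξ
  rintro ξ ⟨ρ, hρ, hξ⟩
  refine map_mem_of_dense hF (tmul E F ξ) (Submodule.isClosed_topologicalClosure _) ?_ η
  rintro η ⟨κ, hκ, hη⟩
  exact subset_clspan _ ⟨pcomp ρ κ, hΘ.comp_mem _ hρ _ hκ,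
    tmul_mem_homog (hΘ.isPartialAut ρ hρ) (hΘ.isPartialAut κ hκ) hξ hη⟩

end CStarBimod

end

/-! ### The operators `l(ξ)` and `r(ξ)` -/

section

variable {B : Type u} [NonUnitalCStarAlgebra B] [PartialOrder B] [StarOrderedRing B]

namespace CStarBimod

variable {E F G : CStarBimod B} {θ σ τ : B ≃. B}

theorem lOp_apply (ξ : E) (b : unit B) : E.lOp ξ b = E.mod.rmul (ofUnit B b) ξ := rfl

theorem rOp_apply (ξ : E) (b : unit B) : E.rOp ξ b = E.lmul (ofUnit B b) ξ := rfl

variable (E) in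
/-- The map `ξ ↦ l(ξ)`. -/
noncomputable def lOpL : E →L[ℂ] unit B →L[ℂ] E :=
  LinearMap.mkContinuous
    { toFun := E.lOp
      map_add' := fun x y => ContinuousLinearMap.ext fun b => map_add (E.mod.rmul (ofUnit B b)) x y
      map_smul' := fun c x =>
        ContinuousLinearMap.ext fun b => map_smul (E.mod.rmul (ofUnit B b)) c x } 1
    fun ξ => by
      rw [one_mul]
      exact ContinuousLinearMap.opNorm_le_bound _ (norm_nonneg _) fun b => E.norm_rmul_le _ ξ

variable (E) in
/-- The map `ξ ↦ r(ξ)`. -/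
noncomputable def rOpL : E →L[ℂ] unit B →L[ℂ] E :=
  LinearMap.mkContinuous
    { toFun := E.rOp
      map_add' := fun x y => ContinuousLinearMap.ext fun b => map_add (E.lmul (ofUnit B b)) x y
      map_smul' := fun c x =>
        ContinuousLinearMap.ext fun b => map_smul (E.lmul (ofUnit B b)) c x } 1
    fun ξ => by
      rw [one_mul]
      exact ContinuousLinearMap.opNorm_le_bound _ (norm_nonneg _) fun b => by
        rw [mul_comm]; exact E.norm_lmul_le _ ξ

theorem norm_lOpL (ξ : E) : ‖E.lOpL ξ‖ = ‖ξ‖ := by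
  refine le_antisymm ?_ ?_
  · exact ContinuousLinearMap.opNorm_le_bound _ (norm_nonneg _) fun b => E.norm_rmul_le _ ξ
  rcases (norm_nonneg ξ).eq_or_lt with h0 | h0
  · rw [← h0]; positivity
  -- evaluate `l(ξ)` at `h = ⟨ξ|ξ⟩`, using that `⟨ξ|ξ h⟩ = h⋆ h`
  set h := E.mod.inner ξ ξ with hh
  have h1 : ‖ξ‖ ^ 2 = ‖h‖ := E.norm_sq ξ
  have h2 : ‖h‖ * ‖h‖ ≤ ‖ξ‖ * (‖E.lOpL ξ‖ * ‖h‖) := by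
    rw [← CStarRing.norm_star_mul_self, hh, E.mod.star_inner, ← E.mod.inner_rmul]
    refine (E.norm_inner_le _ _).trans ?_
    gcongr
    exact (E.lOpL ξ).le_opNorm (toUnit B h)
  have h3 : 0 < ‖h‖ := by rw [← h1]; positivity
  have h4 : ‖ξ‖ * ‖ξ‖ ≤ ‖ξ‖ * ‖E.lOpL ξ‖ := by
    rw [← sq, h1]
    refine le_of_mul_le_mul_right ?_ h3
    rwa [mul_assoc]
  exact le_of_mul_le_mul_left h4 h0

theorem norm_rOpL (ξ : E) : ‖E.rOpL ξ‖ = ‖ξ‖ := by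
  refine le_antisymm ?_ ?_
  · exact ContinuousLinearMap.opNorm_le_bound _ (norm_nonneg _) fun b => by
      rw [mul_comm]; exact E.norm_lmul_le _ ξ
  have hl := CStarAlgebra.increasingApproximateUnit B
  set l := CStarAlgebra.approximateUnit B
  have := hl.neBot
  have hlim : Filter.Tendsto (fun u => E.lmulL u ξ) l (nhds ξ) := by
    refine tendsto_apply_of_clspan ?_ E.nondegenerate ?_ ξ
    · filter_upwards [hl.eventually_norm] with u hu
      refine (ContinuousLinearMap.opNorm_le_bound _ (norm_nonneg u) fun x => ?_).trans hu
      exact E.norm_lmul_le u x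
    · rintro _ ⟨b, y, rfl⟩
      have h1 := ((E.rket y).continuous.tendsto b).comp (hl.tendsto_mul_right b)
      refine h1.congr fun u => ?_
      simp only [Function.comp_apply, rket_apply, map_mul, Module.End.mul_apply, lmulL_apply]
  refine le_of_tendsto hlim.norm ?_
  filter_upwards [hl.eventually_norm] with u hu
  exact ((E.rOpL ξ).le_opNorm (toUnit B u)).trans (mul_le_of_le_one_right (norm_nonneg _) hu)

theorem lOp_injective : Function.Injective E.lOp :=
  (AddMonoidHomClass.isometry_of_norm E.lOpL norm_lOpL).injective

theorem rOp_injective : Function.Injective E.rOp :=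
  (AddMonoidHomClass.isometry_of_norm E.rOpL norm_rOpL).injective

theorem image_lOp_clspan (s : Set E) : E.lOp '' clspan s = clspan (E.lOp '' s) :=
  image_clspan_of_isometry E.lOpL norm_lOpL s

theorem image_rOp_clspan (s : Set E) : E.rOp '' clspan s = clspan (E.rOp '' s) :=
  image_clspan_of_isometry E.rOpL norm_rOpL s

/-! ### Adjoints of `l(ξ)` and `r(ξ)` -/

omit [PartialOrder B] [StarOrderedRing B] in
theorem eq_of_mul_right_eq {a b : B} (h : ∀ c, a * c = b * c) : a = b := by
  have h1 := h (star (a - b))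
  rw [← sub_eq_zero, ← sub_mul, CStarRing.mul_star_self_eq_zero_iff] at h1
  exact sub_eq_zero.mp h1

variable (E) in
/-- The operator `η ↦ ⟨ξ|η⟩`, the adjoint of `l(ξ)`. -/
noncomputable def lAdj (ξ : E) : E →L[ℂ] unit B := (toUnit B).comp (E.innerL ξ)

theorem lAdj_apply (ξ η : E) : E.lAdj ξ η = toUnit B (E.mod.inner ξ η) := rfl

theorem isAdjoint_lOp_iff {ξ : E} {S : E →L[ℂ] unit B} :
    IsAdjoint (.refl B) (E.lOp ξ) S ↔ S = E.lAdj ξ := by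
  have h : ∀ (b : unit B) η, E.mod.inner η (E.lOp ξ b) =
      star (E.mod.inner ξ η) * ofUnit B b := fun b η => by
    rw [lOp_apply, E.mod.inner_rmul, E.mod.star_inner]
  constructor
  · refine fun hS => ContinuousLinearMap.ext fun η => ?_
    have h1 : star (ofUnit B (S η)) = star (E.mod.inner ξ η) := eq_of_mul_right_eq fun b =>
      (Option.some.inj (hS (toUnit B b) η)).trans (h (toUnit B b) η)
    exact star_injective (R := B) h1
  · rintro rfl b η
    rw [h]
    rfl

theorem inner_mem_pdom (hσ : IsPartialAut σ) {ξ : E} (hξ : ξ ∈ E.homog σ) (η : E) :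
    E.mod.inner ξ η ∈ pdom σ := by
  rw [← E.mod.star_inner]
  exact star_mem (s := hσ.dom) (((mem_homog_iff hσ).mp hξ).1 η)

/-- The form `(η, ζ) ↦ σ(⟨ξ|η⟩)` is left `B`-linear in `η` for `σ`-homogeneous `ξ`. -/
theorem papply_inner_lmul (hσ : IsPartialAut σ) {ξ : E} (hξ : ξ ∈ E.homog σ) (b : B) (η : E) :
    papply σ (E.mod.inner ξ (E.lmul b η)) = b * papply σ (E.mod.inner ξ η) := by
  obtain ⟨ζ, hζ, h1, h2, h3⟩ := exists_homog_cube_root hσ hξ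
  have hs : star (E.mod.inner ζ ζ) = E.mod.inner ζ ζ := E.mod.star_inner _ _
  set w := E.mod.inner ζ ζ
  have hζ' := (mem_homog_iff hσ).mp hζ
  have hv := papply_mem h2
  have hvs : star (papply σ w) = papply σ w := by rw [← hσ.papply_star h2, hs]
  have hin : ∀ η, E.mod.inner ξ η = w * E.mod.inner ζ η := fun η => by
    rw [h1, E.mod.rmul_inner, hs]
  have hm := inner_mem_pdom hσ hζ η
  -- `σ(w)` is central, since `w` is
  have hcomm : ∀ c, c * papply σ w = papply σ w * c := by
    refine hσ.symm.commute_of_commute_dom (papply_mem_pdom_symm h2) fun d hd => ?_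
    have h4 := symm_papply_mem hd
    rw [← papply_eq h4, ← hσ.papply_mul ⟨d, h4⟩ h2, h3, hσ.papply_mul h2 ⟨d, h4⟩]
  -- `⟨ξ|b η⟩ = ⟨b⋆ σ(w) ζ|η⟩ = ⟨ζ u|η⟩`, where `σ(u) = b⋆ σ(w)`
  have h4 := hσ.isClosedIdeal_img.mul_mem_left (star b) (papply_mem_pdom_symm h2)
  have h5 := symm_papply_mem h4
  set u := papply σ.symm (star b * papply σ w)
  have h6 : E.mod.inner ξ (E.lmul b η) = star u * E.mod.inner ζ η := by
    rw [E.inner_lmul', h1, hζ'.2 _ _ hv, ← Module.End.mul_apply, ← map_mul, ← hζ'.2 _ _ h5,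
      E.mod.rmul_inner]
  rw [h6, hσ.papply_mul (star_mem (s := hσ.dom) ⟨_, h5⟩) hm, hσ.papply_star ⟨_, h5⟩, papply_eq h5,
    hin, hσ.papply_mul h2 hm, star_mul, star_star, hvs, ← hcomm, mul_assoc]

/-- The operator `η ↦ σ(⟨ξ|η⟩)`, the adjoint of `r(ξ)` with respect to `σ⋆`. -/
noncomputable def rAdj (hσ : IsPartialAut σ) {ξ : E} (hξ : ξ ∈ E.homog σ) : E →L[ℂ] unit B :=
  LinearMap.mkContinuous
    { toFun := fun η => toUnit B (papply σ (E.mod.inner ξ η))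
      map_add' := fun x y => by
        rw [map_add, hσ.papply_add (inner_mem_pdom hσ hξ x) (inner_mem_pdom hσ hξ y), map_add]
      map_smul' := fun c x => by
        rw [map_smul, hσ.papply_smul c (inner_mem_pdom hσ hξ x), map_smul, RingHom.id_apply] } ‖ξ‖
    fun η => (hσ.norm_papply (inner_mem_pdom hσ hξ η)).trans_le (E.norm_inner_le ξ η)

theorem rAdj_apply (hσ : IsPartialAut σ) {ξ : E} (hξ : ξ ∈ E.homog σ) (η : E) :
    rAdj hσ hξ η = toUnit B (papply σ (E.mod.inner ξ η)) := rfl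

theorem isAdjoint_rOp_iff (hσ : IsPartialAut σ) {ξ : E} (hξ : ξ ∈ E.homog σ)
    {S : E →L[ℂ] unit B} : IsAdjoint σ.symm (E.rOp ξ) S ↔ S = rAdj hσ hξ := by
  have h : ∀ (b : unit B) η, star (papply σ (E.mod.inner ξ η)) * ofUnit B b ∈
      σ (E.mod.inner η (E.rOp ξ b)) := fun b η => by
    have h1 := papply_mem (((mem_homog_iff hσ).mp hξ).1 (E.lmul (star (ofUnit B b)) η))
    rw [← E.mod.star_inner, hσ.papply_star (inner_mem_pdom hσ hξ _), papply_inner_lmul hσ hξ,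
      star_mul, star_star, E.mod.star_inner, E.inner_lmul, star_star] at h1
    exact h1
  constructor
  · refine fun hS => ContinuousLinearMap.ext fun η => ?_
    have h1 : star (ofUnit B (S η)) = star (papply σ (E.mod.inner ξ η)) :=
      eq_of_mul_right_eq fun b =>
        Option.mem_unique ((PEquiv.mem_iff_mem _).mp (hS (toUnit B b) η)) (h (toUnit B b) η)
    exact star_injective (R := B) h1
  · rintro rfl b η
    exact (PEquiv.mem_iff_mem _).mpr (h b η)

theorem isAdjoint_zero_iff (hσ : IsPartialAut σ) {S : F →L[ℂ] E} :
    IsAdjoint σ (0 : E →L[ℂ] F) S ↔ S = 0 := by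
  constructor
  · refine fun hS => ContinuousLinearMap.ext fun η => ext_inner fun z => ?_
    have h1 := hS z η
    rw [_root_.zero_apply, map_zero] at h1
    rw [← E.mod.star_inner, σ.inj h1 hσ.zero_mem_zero, _root_.zero_apply, map_zero, star_zero]
  · rintro rfl ξ η
    simpa using hσ.zero_mem_zero

/-- For `σ`-homogeneous `ξ` and `τ`-homogeneous `η`, the element `σ(⟨ξ|η⟩)` is
`τσ⋆`-homogeneous. -/
theorem papply_inner_mem_homog (hσ : IsPartialAut σ) (hτ : IsPartialAut τ) {ξ η : E}
    (hξ : ξ ∈ E.homog σ) (hη : η ∈ E.homog τ) :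
    toUnit B (papply σ (E.mod.inner ξ η)) ∈ (unit B).homog (pcomp τ σ.symm) := by
  have h1 := inner_mem_pdom hσ hξ η
  have h2 := papply_mem h1
  have h3 : papply σ (E.mod.inner ξ η) ∈ pdom (pcomp τ σ.symm) := by
    refine IsPartialAut.mem_pdom_pcomp.mpr ⟨papply_mem_pdom_symm h1, ?_⟩
    rw [papply_eq ((PEquiv.mem_iff_mem _).mpr h2)]
    exact ((mem_homog_iff hτ).mp hη).1 ξ
  refine (mem_homog_iff (hσ.symm.pcomp hτ)).mpr ⟨fun z => ?_, fun d d' hd => ?_⟩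
  · exact (hσ.symm.pcomp hτ).isClosedIdeal_dom.mul_mem_left _ h3
  · obtain ⟨e, h4, h5⟩ := mem_pcomp.mp hd
    have h6 := (PEquiv.mem_iff_mem _).mp h4
    change papply σ (E.mod.inner ξ η) * d = d' * papply σ (E.mod.inner ξ η)
    rw [← papply_inner_lmul hσ hξ, ← hη.2 _ _ h5, E.mod.inner_rmul, hσ.papply_mul h1 ⟨d, h6⟩,
      papply_eq h6]

end CStarBimod

end

/-! ### Products of families of operators -/

section

variable {B : Type u} [NonUnitalCStarAlgebra B] [PartialOrder B] [StarOrderedRing B]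

namespace CStarBimod

variable {E F G : CStarBimod B}

omit [NonUnitalCStarAlgebra B] [PartialOrder B] [StarOrderedRing B] in
theorem eq_refl_of_refl_le {θ : B ≃. B} (h : .refl B ≤ θ) : θ = .refl B := by
  rw [PEquiv.le_def] at h
  ext a b
  exact ⟨fun hb => Option.mem_unique (h a a rfl) hb ▸ rfl, fun hb => h a b hb⟩

theorem clspan_eq_zero {V : Type*} [NormedAddCommGroup V] [NormedSpace ℂ V] {s : Set V}
    (h : ∀ x ∈ s, x = 0) : clspan s = {0} := by
  rw [← clspan_singleton_zero]
  exact (clspan_eq_of_subset_insert_zero (t := ∅) (Set.empty_subset _)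
    fun x hx => Or.inl (h x hx)).trans
    (clspan_eq_of_subset_insert_zero (Set.empty_subset _) fun x hx => Or.inl hx).symm

namespace Fam

/-- The family with exchanged upper and lower indices. The exchange turns `r(E)` and `|F]₂` into
families supported on a column, like `l(E)` and `|E⟩₁`. -/
def swap (C : Fam E F) : Fam E F := fun ρ σ => C σ ρ

/-- The components of a family at all indices `(ρ,σ)` with `σ ≠ Id` are `0`. -/
def IsCol (C : Fam E F) : Prop :=
  ∀ ρ σ, IsPartialAut ρ → IsPartialAut σ → σ ≠ .refl B → C ρ σ = {0}

theorem swap_prod_swap (D : Fam F G) (C : Fam E F) (ρ σ : B ≃. B) :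
    D.swap.prod C.swap σ ρ = D.prod C ρ σ := by
  rw [prod, prod]
  congr 1
  ext R
  constructor <;> rintro ⟨ρ, ρ', σ, σ', h1, h2, h3, h4, h5, h6, h7⟩ <;>
    exact ⟨σ, σ', ρ, ρ', h3, h4, h1, h2, h6, h5, h7⟩

/-- The generators of the component at `(ρ'', Id)` of a product of families that are supported on
the column `σ = Id`. -/
def colGen (D : Fam F G) (C : Fam E F) (ρ'' : B ≃. B) : Set (E →L[ℂ] G) :=
  {R | ∃ ρ ρ', IsPartialAut ρ ∧ IsPartialAut ρ' ∧ pcomp ρ' ρ ≤ ρ'' ∧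
    ∃ T' ∈ D ρ' (.refl B), ∃ T ∈ C ρ (.refl B), R = T'.comp T}

theorem IsCol.prod_refl {D : Fam F G} {C : Fam E F} (hD : D.IsCol) (hC : C.IsCol)
    (ρ'' : B ≃. B) : D.prod C ρ'' (.refl B) = clspan (colGen D C ρ'') := by
  refine clspan_eq_of_subset_insert_zero ?_ ?_
  · rintro _ ⟨ρ, ρ', h1, h2, h3, T', hT', T, hT, rfl⟩
    exact ⟨ρ, ρ', _, _, h1, h2, .refl, .refl, h3, by rw [pcomp_refl], T', hT', T, hT, rfl⟩
  · rintro _ ⟨ρ, ρ', σ, σ', h1, h2, h3, h4, h5, h6, T', hT', T, hT, rfl⟩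
    by_cases hσ : σ = .refl B
    · by_cases hσ' : σ' = .refl B
      · subst hσ hσ'
        exact Or.inr ⟨ρ, ρ', h1, h2, h5, T', hT', T, hT, rfl⟩
      · rw [hD ρ' σ' h2 h4 hσ'] at hT'
        obtain rfl : T' = 0 := hT'
        exact Or.inl T.zero_comp
    · rw [hC ρ σ h1 h3 hσ] at hT
      obtain rfl : T = 0 := hT
      exact Or.inl T'.comp_zero

theorem IsCol.prod {D : Fam F G} {C : Fam E F} (hD : D.IsCol) (hC : C.IsCol) :
    (D.prod C).IsCol := by
  intro ρ'' σ'' _ _ hσ''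
  refine clspan_eq_zero ?_
  rintro _ ⟨ρ, ρ', σ, σ', h1, h2, h3, h4, h5, h6, T', hT', T, hT, rfl⟩
  by_cases hσ : σ = .refl B
  · have hσ' : σ' ≠ .refl B := by
      rintro rfl
      rw [hσ, pcomp_refl] at h6
      exact hσ'' (eq_refl_of_refl_le h6)
    rw [hD ρ' σ' h2 h4 hσ'] at hT'
    obtain rfl : T' = 0 := hT'
    exact T.zero_comp
  · rw [hC ρ σ h1 h3 hσ] at hT
    obtain rfl : T = 0 := hT
    exact T'.comp_zero

theorem IsCol.eqv_iff {C D : Fam E F} (hC : C.IsCol) (hD : D.IsCol) :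
    C.Eqv D ↔ ∀ ρ, IsPartialAut ρ → C ρ (.refl B) = D ρ (.refl B) := by
  refine ⟨fun h ρ hρ => h ρ _ hρ .refl, fun h ρ σ hρ hσ => ?_⟩
  by_cases hσ' : σ = .refl B
  · rw [hσ']; exact h ρ hρ
  · rw [hC ρ σ hρ hσ hσ', hD ρ σ hρ hσ hσ']

theorem swap_eqv_swap {C D : Fam E F} : C.swap.Eqv D.swap ↔ C.Eqv D :=
  ⟨fun h ρ σ hρ hσ => h σ ρ hσ hρ, fun h ρ σ hρ hσ => h σ ρ hσ hρ⟩

theorem IsCol.adjoint {C : Fam E F} (hC : C.IsCol) : C.adjoint.IsCol := by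
  intro ρ σ hρ hσ hσ'
  have h1 : σ.symm ≠ .refl B := fun h => hσ' (by rw [← σ.symm_symm, h, PEquiv.symm_refl])
  ext S
  rw [Fam.adjoint, Set.mem_ofPred_eq, hC _ _ hρ.symm hσ.symm h1]
  simp only [Set.mem_singleton_iff, exists_eq_left, isAdjoint_zero_iff hσ.symm]

theorem swap_adjoint_isCol {C : Fam E F} (hC : C.swap.IsCol) : C.adjoint.swap.IsCol := by
  intro σ ρ hσ hρ hρ'
  have h1 : ρ.symm ≠ .refl B := fun h => hρ' (by rw [← ρ.symm_symm, h, PEquiv.symm_refl])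
  ext S
  rw [Fam.swap, Fam.adjoint, Set.mem_ofPred_eq, show C ρ.symm σ.symm = {0} from
    hC _ _ hσ.symm hρ.symm h1]
  simp only [Set.mem_singleton_iff, exists_eq_left, isAdjoint_zero_iff hσ.symm]

end Fam

theorem famL_refl (E : CStarBimod B) (θ : B ≃. B) :
    E.famL θ (.refl B) = E.lOp '' E.homog θ := if_pos rfl

theorem famR_refl (E : CStarBimod B) (θ : B ≃. B) :
    E.famR (.refl B) θ = E.rOp '' E.homog θ.symm := if_pos rfl

theorem famKet_refl (E F : CStarBimod B) (θ : B ≃. B) :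
    famKet E F θ (.refl B) = (fun ξ => tmul E F ξ) '' E.homog θ := if_pos rfl

theorem famKet'_refl (E F : CStarBimod B) (θ : B ≃. B) :
    famKet' E F (.refl B) θ = (fun η => (tmul E F).flip η) '' F.homog θ.symm := if_pos rfl

theorem isCol_famL (E : CStarBimod B) : E.famL.IsCol := fun _ _ _ _ h => if_neg h

theorem isCol_famR (E : CStarBimod B) : E.famR.swap.IsCol := fun _ _ _ _ h => if_neg h

theorem isCol_famKet (E F : CStarBimod B) : (famKet E F).IsCol := fun _ _ _ _ h => if_neg h

theorem isCol_famKet' (E F : CStarBimod B) : (famKet' E F).swap.IsCol :=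
  fun _ _ _ _ h => if_neg h

/-! ### The conditions on `l(E)` and `r(E)` in terms of elements -/

/-- The elements `⟨ξ|η⟩` of `B` with `ξ ∈ E_σ` and `η ∈ E_τ`, where `σ⋆τ ≤ θ`. -/
def leftGen (E : CStarBimod B) (θ : B ≃. B) : Set (unit B) :=
  {b | ∃ σ τ, IsPartialAut σ ∧ IsPartialAut τ ∧ pcomp σ.symm τ ≤ θ ∧
    ∃ ξ ∈ E.homog σ, ∃ η ∈ E.homog τ, b = toUnit B (E.mod.inner ξ η)}

/-- The elements `σ(⟨ξ|η⟩)` of `B` with `ξ ∈ E_σ` and `η ∈ E_τ`, where `τσ⋆ ≤ θ`. -/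
def rightGen (E : CStarBimod B) (θ : B ≃. B) : Set (unit B) :=
  {b | ∃ σ τ, IsPartialAut σ ∧ IsPartialAut τ ∧ pcomp τ σ.symm ≤ θ ∧
    ∃ ξ ∈ E.homog σ, ∃ η ∈ E.homog τ, b = toUnit B (papply σ (E.mod.inner ξ η))}

theorem clspan_leftGen_subset {θ : B ≃. B} (hθ : IsPartialAut θ) :
    clspan (E.leftGen θ) ⊆ (unit B).homog θ := by
  refine clspan_subset_homog hθ ?_
  rintro _ ⟨σ, τ, hσ, hτ, hle, ξ, hξ, η, hη, rfl⟩
  exact homog_mono (hτ.pcomp hσ.symm) hθ hle (inner_mem_homog hσ hτ hξ hη)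

theorem clspan_rightGen_subset {θ : B ≃. B} (hθ : IsPartialAut θ) :
    clspan (E.rightGen θ) ⊆ (unit B).homog θ := by
  refine clspan_subset_homog hθ ?_
  rintro _ ⟨σ, τ, hσ, hτ, hle, ξ, hξ, η, hη, rfl⟩
  exact homog_mono (hσ.symm.pcomp hτ) hθ hle (papply_inner_mem_homog hσ hτ hξ hη)

/-- The condition `[l(E)⋆ l(E)] = l(B)`. -/
theorem left_eqv_iff : (E.famL.adjoint.prod E.famL).Eqv (unit B).famL ↔
    ∀ θ, IsPartialAut θ → (unit B).homog θ = clspan (E.leftGen θ) := by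
  have hcol := E.isCol_famL
  rw [(hcol.adjoint.prod hcol).eqv_iff (isCol_famL _)]
  refine forall_congr' fun θ => forall_congr' fun _ => ?_
  have hgen : Fam.colGen E.famL.adjoint E.famL θ = (unit B).lOp '' E.leftGen θ := by
    have hcomp : ∀ ξ η : E, (E.lAdj ξ).comp (E.lOp η) =
        (unit B).lOp (toUnit B (E.mod.inner ξ η)) := fun ξ η => ContinuousLinearMap.ext fun b => by
      rw [ContinuousLinearMap.comp_apply, lAdj_apply, lOp_apply, lOp_apply, E.mod.inner_rmul]
      rfl
    ext R
    constructor
    · rintro ⟨τ, σ, hτ, hσ, hle, S, ⟨T, hT, hS⟩, T', hT', rfl⟩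
      rw [PEquiv.symm_refl, famL_refl] at hT
      rw [famL_refl] at hT'
      obtain ⟨ξ, hξ, rfl⟩ := hT
      obtain ⟨η, hη, rfl⟩ := hT'
      rw [PEquiv.symm_refl, isAdjoint_lOp_iff] at hS
      exact ⟨_, ⟨σ.symm, τ, hσ.symm, hτ, hle, ξ, hξ, η, hη, rfl⟩, by rw [hS, hcomp]⟩
    · rintro ⟨_, ⟨σ, τ, hσ, hτ, hle, ξ, hξ, η, hη, rfl⟩, rfl⟩
      refine ⟨τ, σ.symm, hτ, hσ.symm, hle, E.lAdj ξ, ⟨E.lOp ξ, ?_, ?_⟩, E.lOp η, ?_, ?_⟩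
      · rw [PEquiv.symm_refl, famL_refl]; exact ⟨ξ, hξ, rfl⟩
      · rw [PEquiv.symm_refl, isAdjoint_lOp_iff]
      · rw [famL_refl]; exact ⟨η, hη, rfl⟩
      · rw [hcomp]
  rw [hcol.adjoint.prod_refl hcol, hgen, ← image_lOp_clspan, famL_refl,
    lOp_injective.image_injective.eq_iff, eq_comm]

/-- The condition `[r(E)⋆ r(E)] = r(B)`. -/
theorem right_eqv_iff : (E.famR.adjoint.prod E.famR).Eqv (unit B).famR ↔
    ∀ θ, IsPartialAut θ → (unit B).homog θ = clspan (E.rightGen θ) := by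
  have hcol := E.isCol_famR
  have hcol' := Fam.swap_adjoint_isCol hcol
  have hswap : (E.famR.adjoint.prod E.famR).swap = E.famR.adjoint.swap.prod E.famR.swap := by
    funext σ ρ
    exact (Fam.swap_prod_swap _ _ ρ σ).symm
  have hsymm : (∀ θ, IsPartialAut θ → (unit B).homog θ = clspan (E.rightGen θ)) ↔
      ∀ θ, IsPartialAut θ → (unit B).homog θ.symm = clspan (E.rightGen θ.symm) :=
    ⟨fun h θ hθ => h _ hθ.symm, fun h θ hθ => by
      have := h _ hθ.symm
      rwa [θ.symm_symm] at this⟩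
  rw [← Fam.swap_eqv_swap, hswap, (hcol'.prod hcol).eqv_iff (isCol_famR _), hsymm]
  refine forall_congr' fun θ => forall_congr' fun _ => ?_
  have hgen : Fam.colGen E.famR.adjoint.swap E.famR.swap θ =
      (unit B).rOp '' E.rightGen θ.symm := by
    have hcomp : ∀ {σ : B ≃. B} (hσ : IsPartialAut σ) {ξ : E} (hξ : ξ ∈ E.homog σ) (η : E),
        (rAdj hσ hξ).comp (E.rOp η) =
          (unit B).rOp (toUnit B (papply σ (E.mod.inner ξ η))) :=
      fun hσ ξ hξ η => ContinuousLinearMap.ext fun b => by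
        rw [ContinuousLinearMap.comp_apply, rAdj_apply, rOp_apply, rOp_apply,
          papply_inner_lmul hσ hξ]
        rfl
    ext R
    constructor
    · rintro ⟨τ, σ, hτ, hσ, hle, S, ⟨T, hT, hS⟩, T', hT', rfl⟩
      rw [PEquiv.symm_refl, famR_refl, σ.symm_symm] at hT
      rw [Fam.swap, famR_refl] at hT'
      obtain ⟨ξ, hξ, rfl⟩ := hT
      obtain ⟨η, hη, rfl⟩ := hT'
      rw [isAdjoint_rOp_iff hσ hξ] at hS
      refine ⟨_, ⟨σ, τ.symm, hσ, hτ.symm, ?_, ξ, hξ, η, hη, rfl⟩, by rw [hS, hcomp]⟩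
      rw [← pcomp_symm]
      exact symm_mono hle
    · rintro ⟨_, ⟨σ, τ, hσ, hτ, hle, ξ, hξ, η, hη, rfl⟩, rfl⟩
      refine ⟨τ.symm, σ, hτ.symm, hσ, ?_, rAdj hσ hξ, ⟨E.rOp ξ, ?_, ?_⟩, E.rOp η, ?_, ?_⟩
      · have := symm_mono hle
        rwa [pcomp_symm, σ.symm_symm, θ.symm_symm] at this
      · rw [PEquiv.symm_refl, famR_refl]; exact ⟨ξ, hξ, rfl⟩
      · rw [isAdjoint_rOp_iff hσ hξ]
      · rw [Fam.swap, famR_refl]; exact ⟨η, hη, rfl⟩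
      · rw [hcomp]
  rw [hcol'.prod_refl hcol, hgen, ← image_rOp_clspan, Fam.swap, famR_refl,
    rOp_injective.image_injective.eq_iff, eq_comm]

end CStarBimod

end

/-! ### Admissibility of tensor products -/

section

variable {B : Type u} [NonUnitalCStarAlgebra B] [PartialOrder B] [StarOrderedRing B]

namespace CStarBimod

variable {E F : CStarBimod B} {θ : B ≃. B} {Θ : Set (B ≃. B)}

/-- A homogeneous element absorbs central elements of `B` on both sides. -/
theorem exists_central_factor (hθ : IsPartialAut θ) {ξ : E} (hξ : ξ ∈ E.homog θ) :
    ∃ ζ ∈ E.homog θ,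
      (∃ z, toUnit B z ∈ (unit B).homog (.refl B) ∧ ξ = E.mod.rmul z ζ) ∧
      ∃ c, toUnit B c ∈ (unit B).homog (.refl B) ∧ ξ = E.lmul c ζ := by
  obtain ⟨ζ, hζ, h1, h2, h3⟩ := exists_homog_cube_root hθ hξ
  refine ⟨ζ, hζ, ⟨_, mem_homog_refl_iff.mpr fun a => (h3 a).symm, h1⟩, _, ?_,
    h1.trans (hζ.2 _ _ (papply_mem h2))⟩
  exact homog_mono (hθ.symm.pcomp hθ) .refl (self_pcomp_symm_le θ)
    (papply_inner_mem_homog hθ hθ hζ hζ)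

theorem left_tensor (hE : (unit B).homog (.refl B) = clspan (E.leftGen (.refl B)))
    (hθ : IsPartialAut θ) (hF : (unit B).homog θ = clspan (F.leftGen θ)) :
    (unit B).homog θ = clspan ((tensor E F).leftGen θ) := by
  refine Set.Subset.antisymm ?_ (clspan_leftGen_subset hθ)
  rw [hF]
  refine clspan_le_clspan ?_
  rintro _ ⟨σ, τ, hσ, hτ, hle, η, hη, η', hη', rfl⟩
  -- insert a central element between `η` and `η'` and approximate it by inner products in `E`
  obtain ⟨ζ, hζ, -, c, hc, rfl⟩ := exists_central_factor hτ hη'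
  rw [hE] at hc
  refine map_mem_clspan ((F.lAdj η).comp ((F.rket ζ).comp (ofUnit B))) ?_ hc
  rintro _ ⟨ρ, κ, hρ, hκ, hle', ξ, hξ, ξ', hξ', rfl⟩
  refine subset_clspan _ ⟨_, _, hσ.pcomp hρ, hτ.pcomp hκ, ?_, _, tmul_mem_homog hρ hσ hξ hη, _,
    tmul_mem_homog hκ hτ hξ' hζ, ?_⟩
  · rw [pcomp_symm, pcomp_assoc, ← pcomp_assoc ρ.symm]
    refine (pcomp_mono le_rfl (pcomp_mono hle' le_rfl)).trans ?_
    rwa [refl_pcomp]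
  · rw [tensor_inner]
    rfl

theorem right_tensor (hF : (unit B).homog (.refl B) = clspan (F.rightGen (.refl B)))
    (hθ : IsPartialAut θ) (hE : (unit B).homog θ = clspan (E.rightGen θ)) :
    (unit B).homog θ = clspan ((tensor E F).rightGen θ) := by
  refine Set.Subset.antisymm ?_ (clspan_rightGen_subset hθ)
  rw [hE]
  refine clspan_le_clspan ?_
  rintro _ ⟨σ, τ, hσ, hτ, hle, ξ, hξ, ξ', hξ', rfl⟩
  obtain ⟨ζ, hζ, ⟨z, hz, rfl⟩, -⟩ := exists_central_factor hτ hξ'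
  rw [hF] at hz
  refine map_mem_clspan ((rAdj hσ hξ).comp ((E.lket ζ).comp (ofUnit B))) ?_ hz
  rintro _ ⟨ρ, κ, hρ, hκ, hle', η, hη, η', hη', rfl⟩
  refine subset_clspan _ ⟨_, _, hρ.pcomp hσ, hκ.pcomp hτ, ?_, _, tmul_mem_homog hσ hρ hξ hη, _,
    tmul_mem_homog hτ hκ hζ hη', ?_⟩
  · rw [pcomp_symm, pcomp_assoc, ← pcomp_assoc κ]
    refine (pcomp_mono le_rfl (pcomp_mono hle' le_rfl)).trans ?_
    rwa [refl_pcomp]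
  · -- `σ(⟨ξ|ζ⟩ ρ(⟨η|η'⟩)) = σ(ρ(⟨η|⟨ξ|ζ⟩ η'⟩))`
    have h1 := papply_mem (inner_mem_pdom hρ hη (F.lmul (E.mod.inner ξ ζ) η'))
    rw [papply_inner_lmul hρ hη] at h1
    have h2 := papply_mem (hσ.isClosedIdeal_dom.mul_mem_right (inner_mem_pdom hσ hξ ζ)
      (papply ρ (F.mod.inner η η')))
    rw [tensor_inner, papply_eq (mem_pcomp.mpr ⟨_, h1, h2⟩), ← E.mod.inner_rmul]
    rfl

theorem IsAdmissible.tensor (hΘ : IsInverseSemigroup Θ) (hE : IsAdmissible Θ E)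
    (hF : IsAdmissible Θ F) : IsAdmissible Θ (tensor E F) where
  decomposable := isDecomposableFor_tensor hΘ hE.decomposable hF.decomposable
  left := left_eqv_iff.mpr fun θ hθ =>
    left_tensor (left_eqv_iff.mp hE.left _ .refl) hθ (left_eqv_iff.mp hF.left θ hθ)
  right := right_eqv_iff.mpr fun θ hθ =>
    right_tensor (right_eqv_iff.mp hF.right _ .refl) hθ (right_eqv_iff.mp hE.right θ hθ)

/-- The elementary tensors `ξ ⊗ η` with `ξ ∈ E_ρ` and `η ∈ F_κ`, where `ρκ ≤ θ`. -/
def tensorGen (E F : CStarBimod B) (θ : B ≃. B) : Set (tensor E F) :=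
  {ζ | ∃ ρ κ, IsPartialAut ρ ∧ IsPartialAut κ ∧ pcomp ρ κ ≤ θ ∧
    ∃ ξ ∈ E.homog ρ, ∃ η ∈ F.homog κ, ζ = tmul E F ξ η}

theorem homog_tensor_eq_clspan_tensorGen (hΘ : IsAdmissibleSemigroup Θ)
    (hE : IsDecomposableFor Θ E) (hF : IsDecomposableFor Θ F) (hθ : IsPartialAut θ) :
    (tensor E F).homog θ = clspan (tensorGen E F θ) := by
  refine Set.Subset.antisymm ?_ (clspan_subset_homog hθ ?_)
  · have hΘ' := hΘ.isInverseSemigroup.isPartialAut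
    rw [homog_tensor hΘ hE hF hθ]
    refine clspan_mono ?_
    rintro _ ⟨ρ, hρ, κ, hκ, hle, ξ, hξ, η, hη, rfl⟩
    exact ⟨ρ, κ, hΘ' ρ hρ, hΘ' κ hκ, hle, ξ, hξ, η, hη, rfl⟩
  · rintro _ ⟨ρ, κ, hρ, hκ, hle, ξ, hξ, η, hη, rfl⟩
    exact homog_mono (hκ.pcomp hρ) hθ hle (tmul_mem_homog hρ hκ hξ hη)

theorem famL_tensor (hΘ : IsAdmissibleSemigroup Θ) (hE : IsDecomposableFor Θ E)
    (hF : IsDecomposableFor Θ F) : (tensor E F).famL.Eqv ((famKet E F).prod F.famL) := by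
  have h1 := isCol_famKet E F
  have h2 := isCol_famL F
  rw [(isCol_famL _).eqv_iff (h1.prod h2)]
  intro θ hθ
  have hgen : Fam.colGen (famKet E F) F.famL θ = (tensor E F).lOp '' tensorGen E F θ := by
    have hcomp : ∀ (ξ : E) (η : F), (tmul E F ξ).comp (F.lOp η) =
        (tensor E F).lOp (tmul E F ξ η) := fun ξ η => ContinuousLinearMap.ext fun b => by
      rw [ContinuousLinearMap.comp_apply, lOp_apply, lOp_apply, tensor_rmul]
    ext R
    constructor
    · rintro ⟨κ, ρ, hκ, hρ, hle, T, hT, T', hT', rfl⟩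
      rw [famKet_refl] at hT
      rw [famL_refl] at hT'
      obtain ⟨ξ, hξ, rfl⟩ := hT
      obtain ⟨η, hη, rfl⟩ := hT'
      exact ⟨_, ⟨ρ, κ, hρ, hκ, hle, ξ, hξ, η, hη, rfl⟩, (hcomp ξ η).symm⟩
    · rintro ⟨_, ⟨ρ, κ, hρ, hκ, hle, ξ, hξ, η, hη, rfl⟩, rfl⟩
      refine ⟨κ, ρ, hκ, hρ, hle, tmul E F ξ, ?_, F.lOp η, ?_, (hcomp ξ η).symm⟩
      · rw [famKet_refl]; exact ⟨ξ, hξ, rfl⟩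
      · rw [famL_refl]; exact ⟨η, hη, rfl⟩
  rw [h1.prod_refl h2, hgen, famL_refl, homog_tensor_eq_clspan_tensorGen hΘ hE hF hθ,
    image_lOp_clspan]

theorem famR_tensor (hΘ : IsAdmissibleSemigroup Θ) (hE : IsDecomposableFor Θ E)
    (hF : IsDecomposableFor Θ F) : (tensor E F).famR.Eqv ((famKet' E F).prod E.famR) := by
  have h1 := isCol_famKet' E F
  have h2 := isCol_famR E
  have hswap : ((famKet' E F).prod E.famR).swap = (famKet' E F).swap.prod E.famR.swap := by
    funext σ ρ
    exact (Fam.swap_prod_swap _ _ ρ σ).symm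
  rw [← Fam.swap_eqv_swap, hswap, (isCol_famR _).eqv_iff (h1.prod h2)]
  intro θ hθ
  have hgen : Fam.colGen (famKet' E F).swap E.famR.swap θ =
      (tensor E F).rOp '' tensorGen E F θ.symm := by
    have hcomp : ∀ (ξ : E) (η : F), ((tmul E F).flip η).comp (E.rOp ξ) =
        (tensor E F).rOp (tmul E F ξ η) := fun ξ η => ContinuousLinearMap.ext fun b => by
      rw [ContinuousLinearMap.comp_apply, rOp_apply, rOp_apply, tensor_lmul]
      rfl
    ext R
    constructor
    · rintro ⟨ρ, κ, hρ, hκ, hle, T, hT, T', hT', rfl⟩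
      rw [Fam.swap, famKet'_refl] at hT
      rw [Fam.swap, famR_refl] at hT'
      obtain ⟨η, hη, rfl⟩ := hT
      obtain ⟨ξ, hξ, rfl⟩ := hT'
      refine ⟨_, ⟨ρ.symm, κ.symm, hρ.symm, hκ.symm, ?_, ξ, hξ, η, hη, rfl⟩, (hcomp ξ η).symm⟩
      rw [← pcomp_symm]
      exact symm_mono hle
    · rintro ⟨_, ⟨ρ, κ, hρ, hκ, hle, ξ, hξ, η, hη, rfl⟩, rfl⟩
      refine ⟨ρ.symm, κ.symm, hρ.symm, hκ.symm, ?_, (tmul E F).flip η, ?_, E.rOp ξ, ?_,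
        (hcomp ξ η).symm⟩
      · have := symm_mono hle
        rwa [pcomp_symm, θ.symm_symm] at this
      · rw [Fam.swap, famKet'_refl]; exact ⟨η, hη, rfl⟩
      · rw [Fam.swap, famR_refl]; exact ⟨ξ, hξ, rfl⟩
  rw [h1.prod_refl h2, hgen, Fam.swap, famR_refl,
    homog_tensor_eq_clspan_tensorGen hΘ hE hF hθ.symm, image_rOp_clspan]

/-! ### Admissibility of the unit -/

theorem isAdmissible_unit (hΘ : IsAdmissibleSemigroup Θ) (hB : (unit B).IsDecomposable) :
    IsAdmissible Θ (unit B) := by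
  -- a homogeneous element `b` is a product of a central element `c` and a homogeneous element `b'`
  have hfac : ∀ θ, IsPartialAut θ → ∀ b ∈ (unit B).homog θ,
      ∃ c ∈ (unit B).homog (.refl B), ∃ b' ∈ (unit B).homog θ,
        b = toUnit B ((unit B).mod.inner c b') := fun θ hθ b hb => by
    obtain ⟨b', hb', -, c, hc, h⟩ := exists_central_factor hθ hb
    rw [mem_homog_refl_iff] at hc
    refine ⟨toUnit B (star c), mem_homog_refl_iff.mpr fun a => ?_, b', hb', ?_⟩
    · rw [← star_star a, ← star_mul, ← star_mul, hc]
    · rw [h, unit_inner, ofUnit_toUnit, star_star]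
      rfl
  refine ⟨?_, left_eqv_iff.mpr fun θ hθ => ?_, right_eqv_iff.mpr fun θ hθ => ?_⟩
  · refine Set.eq_univ_of_univ_subset (hB.symm.subset.trans (clspan_le_clspan ?_))
    rintro b ⟨θ, hθ, hb⟩
    rw [hΘ.supported θ hθ] at hb
    refine clspan_mono ?_ hb
    rintro b ⟨θ', hθ', -, hb⟩
    exact ⟨θ', hθ', hb⟩
  · refine Set.Subset.antisymm (fun b hb => ?_) (clspan_leftGen_subset hθ)
    obtain ⟨c, hc, b', hb', h⟩ := hfac θ hθ b hb
    exact subset_clspan _ ⟨_, θ, .refl, hθ, (refl_pcomp θ).le, c, hc, b', hb', h⟩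
  · refine Set.Subset.antisymm (fun b hb => ?_) (clspan_rightGen_subset hθ)
    obtain ⟨c, hc, b', hb', h⟩ := hfac θ hθ b hb
    exact subset_clspan _ ⟨_, θ, .refl, hθ, (pcomp_refl θ).le, c, hc, b', hb', h⟩

end CStarBimod

end

theorem mainTheorem2 {B : Type u} [NonUnitalCStarAlgebra B] [PartialOrder B] [StarOrderedRing B]
    (Θ : Set (B ≃. B)) (hΘ : CStarBimod.IsAdmissibleSemigroup Θ) :
    (∀ E F : CStarBimod B, CStarBimod.IsAdmissible Θ E → CStarBimod.IsAdmissible Θ F →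
      CStarBimod.IsAdmissible Θ (E.tensor F) ∧
      (∀ θ'', IsPartialAut θ'' → (E.tensor F).homog θ'' =
        clspan {ζ | ∃ θ ∈ Θ, ∃ θ' ∈ Θ, pcomp θ θ' ≤ θ'' ∧
          ∃ ξ ∈ E.homog θ, ∃ η ∈ F.homog θ', ζ = CStarBimod.tmul E F ξ η}) ∧
      (E.tensor F).famL.Eqv ((CStarBimod.famKet E F).prod F.famL) ∧
      (E.tensor F).famR.Eqv ((CStarBimod.famKet' E F).prod E.famR)) ∧
    ((CStarBimod.unit B).IsDecomposable → (CStarBimod.admissible Θ).IsMonoidal) := by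
  refine ⟨fun E F hE hF => ⟨hE.tensor hΘ.isInverseSemigroup hF, fun θ'' hθ'' => ?_,
    CStarBimod.famL_tensor hΘ hE.decomposable hF.decomposable,
    CStarBimod.famR_tensor hΘ hE.decomposable hF.decomposable⟩, fun hB => ?_⟩
  · exact CStarBimod.homog_tensor hΘ hE.decomposable hF.decomposable hθ''
  · exact
      { prop_unit := CStarBimod.isAdmissible_unit hΘ hB
        prop_tensor := fun E F hE hF =>
          CStarBimod.IsAdmissible.tensor hΘ.isInverseSemigroup hE hF }
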